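/- Let $k\neq 0$ and $\nu>0$, $\lambda$ be real parameters. The Pomeransky–Senkov (PS) metric in coordinates $(t,y,\psi,\varphi,x)\in\mathbb R^5$ is $$ds^2=\frac{2H(x,y)k^2}{(1-\nu)^2(x-y)^2}\Big(\frac{dx^2}{G(x)}-\frac{dy^2}{G(y)}\Big)-2\frac{J(x,y)}{H(y,x)}d\varphi\, d\psi-\frac{H(y,x)}{H(x,y)}(dt+M\,d\psi+P\,d\varphi)^2-\frac{F(x,y)}{H(y,x)}d\psi^2+\frac{F(y,x)}{H(y,x)}d\varphi^2,$$ where $G(x)=(1-x^2)(\nu x^2+\lambda x+1)$, $$H(x,y)=\lambda^2+2\nu(1-x^2)y\lambda+2x(1-\nu^2y^2)\lambda-\nu^2+\nu(1-\lambda^2-\nu^2)x^2y^2+1,$$ $$\begin{aligned}F(x,y)=\tfrac{2k^2}{(x-y)^2(1-\nu)^2}\Big[&(1-y^2)\big(((1-\nu)^2-\lambda^2)(\nu+1)+y\lambda(1+2\nu-3\nu^2-\lambda^2)\big)G(x)\\&+\big(-(1-\nu)\nu(\lambda^2+\nu^2-1)x^4+\lambda(2\nu^3-3\nu^2-\lambda^2+1)x^3\\&\quad+((1-\nu)^2-\lambda^2)(\nu+1)x^2+\lambda(\lambda^2+(1-\nu)^2)x+2\lambda^2\big)G(y)\Big],\end{aligned}$$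 $$J(x,y)=\tfrac{2k^2(1-x^2)(1-y^2)\lambda\sqrt\nu\,\left(\lambda^2+2(x+y)\nu\lambda-\nu^2-xy\nu(1-\lambda^2-\nu^2)+1\right)}{(x-y)(1-\nu)^2},$$ $$M=\tfrac{2k\lambda\sqrt{(\nu+1)^2-\lambda^2}\,(y+1)\left(-\lambda+\nu-2\nu x+\nu x((\lambda+\nu-1)x+2)y-1\right)}{(1-\lambda+\nu)H(y,x)},\qquad P=\tfrac{2k\lambda\sqrt\nu\sqrt{(\nu+1)^2-\lambda^2}\,(x^2-1)y}{H(y,x)}.$$ Let $D$ be the set of points with $G(x),\,G(y),\,x-y,\,H(x,y),\,H(y,x)$ all nonzero. Put $y_h=\frac{-\lambda+\sqrt{\lambda^2-4\nu}}{2\nu}$ and $y_c=\frac{-\lambda-\sqrt{\lambda^2-4\nu}}{2\nu}$. **Non-degenerate case.** Assume $\nu\neq1$, $|\lambda|<1+\nu$ and $\lambda^2>4\nu$. Let $y_\star\in\{y_h,y_c\}$, let $y_\bullet$ be the other root, and take the upper signs for $y_\star=y_h$ and the lower signs for $y_\star=y_c$. Put $$a=\frac{1-\lambda+\nu}{2k\sqrt{(1+\nu)^2-\lambda^2}},\qquad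 b=\frac{\big(\pm(\nu-1)\sqrt{\lambda^2-4\nu}+\lambda(1+\nu)\big)(1+\nu-\lambda)}{4k\lambda\sqrt{\nu((1+\nu)^2-\lambda^2)}},$$ $$s_\star=\frac{2k^2\lambda^2\big(\lambda^2(\nu^2+1)\mp\lambda(\nu^2-1)\sqrt{\lambda^2-4\nu}-2\nu(\nu+1)^2\big)}{(\nu-1)^2(\lambda^2-4\nu)(1+\nu-\lambda)^2},$$ and for $\sigma\neq0$ let $u=t+\sigma\ln|y-y_\star|$, $v=t-\sigma\ln|y-y_\star|$, $\hat\psi=\psi-at$, $\hat\varphi=\varphi-bt$. Then: 1. For every $\sigma\ne0$ and every $x$ with $G(x)\ne0$, $x\neq y_\star$, $H(x,y_\star)\neq0$, the coefficients $g_{uu},g_{vv},g_{uv},g_{u\hat\psi},g_{v\hat\psi},g_{u\hat\varphi},g_{v\hat\varphi}$ tend to $0$ as $y\to y_\star$, and $g_{uu}=O((y-y_\star)^2)$ there if and only if $\sigma^2=s_\star$. Moreover $s_\star>0$. 2. Let $\sigma^2=s_\star$ and $\gamma=1/(2\sigma)$. On the open set $W$ of points $(\hat u,\hat v,\hat\psi,\hat\varphi,x)\in\mathbb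 R^5$ at which $y:=y_\star+\hat u\hat v$ satisfies $y^2\neq1$, $y\neq y_\bullet$, $x\ne y$, $G(x)\neq0$, $H(x,y)\neq0$, there is a real-analytic nondegenerate symmetric tensor field $\hat g$, with coefficients depending only on $(\hat u,\hat v,x)$ and $$\det\hat g=-\frac{64k^8\sigma^2H(x,y)^2}{(1-\nu)^6(x-y)^8},$$ such that for $\epsilon=\pm1$ the map $\hat u=\epsilon e^{\gamma u}$, $\hat v=\epsilon\,\mathrm{sgn}(y-y_\star)e^{-\gamma v}$ (which is $\hat u=e^{\gamma u}$, $\hat v=e^{-\gamma v}$ when $\epsilon=1$ and $y>y_\star$), together with $\hat\psi,\hat\varphi,x$, is an injective analytic map from $D$ into $W$ that pulls $\hat g$ back to the PS metric. 3. If moreover $\nu<1$ and $\lambda>0$, then for some $\delta>0$ the set $W$ contains all points with $|x|<1$ and $|\hat u\hat v|<\delta$; so the PS metric extends analytically across the horizon $\{y=y_\star\}=\{\hat u\hat v=0\}$. **Degenerate case.** Assume $0<\nu<1$ and $\lambda=2\sqrt\nu$. Let $y_0=-1/\sqrt\nu$, $a_\psi=\frac{1-\nu}{2k(1+\sqrt\nu)^2}$,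 $a_\varphi=\frac{1-\nu^2}{4k\sqrt\nu(1+\sqrt\nu)^2}$, and for constants $a_0,a_1,b^\psi,b^\varphi$ define coordinates $(v,z,\Psi,\Phi,x)$ by $$t=v-\frac{a_0}{z-y_0}+a_1\ln|z-y_0|,\quad y=z,\quad \psi-a_\psi t=\Psi+b^\psi\ln|z-y_0|,\quad \varphi-a_\varphi t=\Phi+b^\varphi\ln|z-y_0|.$$ Then: 1. For every $x\in(-1,1)$, as $z\to y_0$: $g_{vv}=O((z-y_0)^2)$ and $g_{v\Psi},g_{v\Phi}=O(z-y_0)$ for all values of the constants, while $g_{zz},g_{z\Psi},g_{z\Phi}$ are all bounded if and only if $$(a_0,b^\psi,b^\varphi,a_1)=\pm\Big(\frac{4k}{(1-\sqrt\nu)^2},\,0,\,-1,\,\frac{4k\sqrt\nu(1+\nu)}{(1-\sqrt\nu)^2(1-\nu)}\Big)$$ for one of the two signs. 2. For each of these two choices, on the open set $W_0$ of points $(v,z,\Psi,\Phi,x)$ with $z^2\neq1$, $x\neq z$, $G(x)\neq0$, $H(x,z)\ne0$ there is a real-analytic nondegenerate symmetric tensor field $\hat g$, with coefficients depending only on $(z,x)$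 and $\det\hat g=-\frac{16k^8H(x,z)^2}{(1-\nu)^6(x-z)^8}$, which the change of coordinates $D\to W_0$ (injective and analytic) pulls back to the PS metric. 3. For some $\delta>0$ the set $W_0$ contains all points with $|x|<1$ and $|z-y_0|<\delta$; so the PS metric extends analytically across the degenerate horizon $y=y_0$. -/

import Mathlib

open scoped Topology Matrix
open Filter Asymptotics

noncomputable section

namespace PomeranskySenkov

/-- Coordinate space `ℝ⁵`. -/
abbrev Coords : Type := Fin 5 → ℝ

/-- The matrix of components of a symmetric two-tensor at a point. -/
abbrev Mat5 : Type := Matrix (Fin 5) (Fin 5) ℝ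

/-! ### Tensors and changes of coordinates -/

/-- The Jacobian matrix `∂Φⁱ/∂pʲ` of a map at a point. -/
def jac (Φ : Coords → Coords) (p : Coords) : Mat5 :=
  LinearMap.toMatrix' (fderiv ℝ Φ p : Coords →ₗ[ℝ] Coords)

/-- The components, at the point with old coordinates `p`, of the tensor `g` with respect to the
new coordinates `Φ`. -/
def newComponents (Φ : Coords → Coords) (g : Coords → Mat5) (p : Coords) : Mat5 :=
  ((jac Φ p)⁻¹)ᵀ * g p * (jac Φ p)⁻¹

/-- `g` is a real-analytic, symmetric, nondegenerate tensor field on the open set `W`. -/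
structure IsAnalyticMetricOn (g : Coords → Mat5) (W : Set Coords) : Prop where
  isOpen : IsOpen W
  analytic : ∀ i j, AnalyticOnNhd ℝ (fun p => g p i j) W
  symm : ∀ p ∈ W, (g p).IsSymm
  nondegenerate : ∀ p ∈ W, (g p).det ≠ 0

/-- `Φ` is an injective analytic map from `D` into `W` that pulls back `g'` to `g`. -/
structure IsIsometricEmbeddingOn (Φ : Coords → Coords) (D : Set Coords) (g : Coords → Mat5)
    (W : Set Coords) (g' : Coords → Mat5) : Prop where
  analytic : AnalyticOnNhd ℝ Φ D
  injOn : Set.InjOn Φ D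
  mapsTo : Set.MapsTo Φ D W
  pullback : ∀ p ∈ D, (jac Φ p)ᵀ * g' (Φ p) * jac Φ p = g p

/-! ### The Pomeransky–Senkov metric, with parameters `k`, `ν` and `lam = λ` -/

def H (ν lam x y : ℝ) : ℝ :=
  lam ^ 2 + 2 * ν * (1 - x ^ 2) * y * lam + 2 * x * (1 - ν ^ 2 * y ^ 2) * lam - ν ^ 2
    + ν * (-lam ^ 2 - ν ^ 2 + 1) * x ^ 2 * y ^ 2 + 1

def G (ν lam x : ℝ) : ℝ := (1 - x ^ 2) * (ν * x ^ 2 + lam * x + 1)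

def F (k ν lam x y : ℝ) : ℝ :=
  2 * k ^ 2 / ((x - y) ^ 2 * (1 - ν) ^ 2) *
    ((1 - y ^ 2) * (((1 - ν) ^ 2 - lam ^ 2) * (ν + 1)
        + y * lam * (-lam ^ 2 - 3 * ν ^ 2 + 2 * ν + 1)) * G ν lam x
      + (-(1 - ν) * ν * (lam ^ 2 + ν ^ 2 - 1) * x ^ 4
        + lam * (2 * ν ^ 3 - 3 * ν ^ 2 - lam ^ 2 + 1) * x ^ 3
        + ((1 - ν) ^ 2 - lam ^ 2) * (ν + 1) * x ^ 2
        + lam * (lam ^ 2 + (1 - ν) ^ 2) * x + 2 * lam ^ 2) * G ν lam y)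

def J (k ν lam x y : ℝ) : ℝ :=
  2 * k ^ 2 * (1 - x ^ 2) * (1 - y ^ 2) * lam * √ν *
      (lam ^ 2 + 2 * (x + y) * ν * lam - ν ^ 2 - x * y * ν * (-lam ^ 2 - ν ^ 2 + 1) + 1)
    / ((x - y) * (1 - ν) ^ 2)

/-- The `dψ`-component of the one-form `Ω`. -/
def M (k ν lam x y : ℝ) : ℝ :=
  2 * k * lam * √((ν + 1) ^ 2 - lam ^ 2) * (y + 1) *
      (-lam + ν - 2 * ν * x + ν * x * ((lam + ν - 1) * x + 2) * y - 1)
    / ((1 - lam + ν) * H ν lam y x)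

/-- The `dφ`-component of the one-form `Ω`. -/
def P (k ν lam x y : ℝ) : ℝ :=
  2 * k * lam * √ν * √((ν + 1) ^ 2 - lam ^ 2) * (x ^ 2 - 1) * y / H ν lam y x

/-- The Pomeransky–Senkov metric in the coordinates `(t, y, ψ, φ, x)`. -/
def metric (k ν lam : ℝ) (p : Coords) : Mat5 :=
  let y := p 1
  let x := p 4
  let c := 2 * H ν lam x y * k ^ 2 / ((1 - ν) ^ 2 * (x - y) ^ 2)
  -- the one-form `dt + Ω`
  let ω : Fin 5 → ℝ := ![1, 0, M k ν lam x y, P k ν lam x y, 0]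
  !![0, 0, 0, 0, 0;
     0, -(c / G ν lam y), 0, 0, 0;
     0, 0, -(F k ν lam x y / H ν lam y x), -(J k ν lam x y / H ν lam y x), 0;
     0, 0, -(J k ν lam x y / H ν lam y x), F k ν lam y x / H ν lam y x, 0;
     0, 0, 0, 0, c / G ν lam x]
    - (H ν lam y x / H ν lam x y) • Matrix.vecMulVec ω ω

/-- The set of points `(t, y, ψ, φ, x)` at which no denominator in the line element vanishes. -/
def domain (ν lam : ℝ) : Set Coords :=
  {p | G ν lam (p 4) ≠ 0 ∧ G ν lam (p 1) ≠ 0 ∧ p 4 ≠ p 1 ∧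
    H ν lam (p 4) (p 1) ≠ 0 ∧ H ν lam (p 1) (p 4) ≠ 0}

/-! ### Non-degenerate horizons -/

/-- The two Killing horizons `y = y_h` and `y = y_c`. -/
inductive Horizon
  | h
  | c

def yh (ν lam : ℝ) : ℝ := -(lam - √(lam ^ 2 - 4 * ν)) / (2 * ν)

def yc (ν lam : ℝ) : ℝ := -(lam + √(lam ^ 2 - 4 * ν)) / (2 * ν)

namespace Horizon

/-- The value of `y` on the horizon. -/
def root (ν lam : ℝ) : Horizon → ℝ
  | h => yh ν lam
  | c => yc ν lam

/-- The value of `y` on the other horizon. -/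
def otherRoot (ν lam : ℝ) : Horizon → ℝ
  | h => yc ν lam
  | c => yh ν lam

/-- The constant `b`. -/
def b (k ν lam : ℝ) : Horizon → ℝ
  | h => ((ν - 1) * √(lam ^ 2 - 4 * ν) + lam * (1 + ν)) * (1 + ν - lam)
      / (4 * k * lam * √(ν * ((1 + ν) ^ 2 - lam ^ 2)))
  | c => ((-ν + 1) * √(lam ^ 2 - 4 * ν) + lam * (1 + ν)) * (1 + ν - lam)
      / (4 * k * lam * √(ν * ((1 + ν) ^ 2 - lam ^ 2)))

/-- The value of `σ²`. -/
def sigmaSq (k ν lam : ℝ) : Horizon → ℝ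
  | h => 2 * k ^ 2 * lam ^ 2 *
        (lam ^ 2 * (ν ^ 2 + 1) - lam * (ν ^ 2 - 1) * √(lam ^ 2 - 4 * ν) - 2 * ν * (ν + 1) ^ 2)
      / ((ν - 1) ^ 2 * (lam ^ 2 - 4 * ν) * (-lam + ν + 1) ^ 2)
  | c => 2 * k ^ 2 * lam ^ 2 *
        (lam ^ 2 * (ν ^ 2 + 1) + lam * (ν ^ 2 - 1) * √(lam ^ 2 - 4 * ν) - 2 * ν * (ν + 1) ^ 2)
      / ((ν - 1) ^ 2 * (lam ^ 2 - 4 * ν) * (-lam + ν + 1) ^ 2)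

end Horizon

/-- The constant `a`, which is the same at both horizons. -/
def aConst (k ν lam : ℝ) : ℝ := (1 - lam + ν) / (2 * k * √((1 + ν) ^ 2 - lam ^ 2))

/-- The coordinates `(u, v, ψ̂, φ̂, x)` as functions of `(t, y, ψ, φ, x)`:
`u = t + σ log |y - y⋆|`, `v = t - σ log |y - y⋆|`, `ψ̂ = ψ - a t`, `φ̂ = φ - b t`
(recall that `Real.log r = log |r|`). -/
def uvChart (σ a b ystar : ℝ) (p : Coords) : Coords :=
  ![p 0 + σ * Real.log (p 1 - ystar), p 0 - σ * Real.log (p 1 - ystar),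
    p 2 - a * p 0, p 3 - b * p 0, p 4]

/-- The exponential coordinates `(û, v̂, ψ̂, φ̂, x)` as functions of `(t, y, ψ, φ, x)`. For `ε = 1`
and `y > y⋆` these are `û = e^{γ u}`, `v̂ = e^{-γ v}` with `γ = 1 / (2 σ)`. The signs are such that
`û v̂ = y - y⋆` on both sides of the horizon; the choices `ε = ±1` and `y > y⋆`, `y < y⋆` correspond
to the four quadrants of the `(û, v̂)`-plane. -/
def ksChart (ε σ a b ystar : ℝ) (p : Coords) : Coords :=
  let γ := 1 / (2 * σ)
  let q := uvChart σ a b ystar p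
  ![ε * Real.exp (γ * q 0), ε * Real.sign (p 1 - ystar) * Real.exp (-γ * q 1), q 2, q 3, q 4]

/-- The function `y = y⋆ + û v̂` in the coordinates `(û, v̂, ψ̂, φ̂, x)`. -/
def ksY (ystar : ℝ) (p : Coords) : ℝ := ystar + p 0 * p 1

/-- The domain of the extended metric in the coordinates `(û, v̂, ψ̂, φ̂, x)`; `y = y⋆`, that is
`û v̂ = 0`, is allowed, and so is `H(y,x) = 0`. -/
def ksDomain (ν lam : ℝ) (hor : Horizon) : Set Coords :=
  {p | G ν lam (p 4) ≠ 0 ∧ p 4 ≠ ksY (hor.root ν lam) p ∧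
    ksY (hor.root ν lam) p ^ 2 ≠ 1 ∧ ksY (hor.root ν lam) p ≠ hor.otherRoot ν lam ∧
    H ν lam (p 4) (ksY (hor.root ν lam) p) ≠ 0}

/-! ### The degenerate horizon, `λ = 2 √ν` -/

def y0 (ν : ℝ) : ℝ := -1 / √ν

def aPsi (k ν : ℝ) : ℝ := (1 - ν) / (2 * k * (1 + √ν) ^ 2)

def aPhi (k ν : ℝ) : ℝ := (1 - ν ^ 2) / (4 * k * √ν * (1 + √ν) ^ 2)

/-- The coordinates `(v, z, Ψ, Φ, x)` as functions of `(t, y, ψ, φ, x)`, with `z = y`,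
`t = v - a₀ / (z - y₀) + a₁ log |z - y₀|`, `ψ - a_ψ t = Ψ + b^ψ log |z - y₀|` and
`φ - a_φ t = Φ + b^φ log |z - y₀|`. -/
def degChart (k ν a₀ a₁ bψ bφ : ℝ) (p : Coords) : Coords :=
  ![p 0 + a₀ / (p 1 - y0 ν) - a₁ * Real.log (p 1 - y0 ν), p 1,
    p 2 - aPsi k ν * p 0 - bψ * Real.log (p 1 - y0 ν),
    p 3 - aPhi k ν * p 0 - bφ * Real.log (p 1 - y0 ν), p 4]

/-- The two admissible choices of `(a₀, a₁, b^ψ, b^φ)`, labelled by `s = 1` and `s = -1`. -/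
def IsDegConstants (k ν s a₀ a₁ bψ bφ : ℝ) : Prop :=
  a₀ = s * (4 * k / (1 - √ν) ^ 2) ∧
  a₁ = s * (4 * k * √ν * (1 + ν) / ((1 - √ν) ^ 2 * (1 - ν))) ∧
  bψ = 0 ∧ bφ = -s

/-- The domain of the extended metric in the coordinates `(v, z, Ψ, Φ, x)`; `z = y₀` is allowed,
and so is `H(z,x) = 0`. -/
def degDomain (ν : ℝ) : Set Coords :=
  {p | G ν (2 * √ν) (p 4) ≠ 0 ∧ p 4 ≠ p 1 ∧ p 1 ^ 2 ≠ 1 ∧ H ν (2 * √ν) (p 4) (p 1) ≠ 0}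

end PomeranskySenkov

end

/-!
Near `y = r` the Killing field `K = ∂t + a ∂ψ + b ∂φ` becomes null: once the factor `H(y,x)` is
cancelled from the numerators, the components of the metric in the frame `(K, ∂y, ∂ψ, ∂φ, ∂x)` are
analytic there, except that `g(∂y, ∂y) = B / (y - r)`, and `g(K, ·)` vanishes to first order,
`g(K, K) = (y - r) A`.

In the coordinates `û = ε exp(γ u)`, `v̂ = ± ε exp(-γ v)` one has `y - r = û v̂`, and the only pole
left is proportional to `(σ² A + B) / (y - r)`. The function `σ² A + B` vanishes on `y = r`
precisely when `σ²` has the stated value, whatever `x` is; a polynomial division then exhibits the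
quotient as an analytic function.

For a degenerate horizon `g(K, K)` has a double zero and `g(∂y, ∂y)` a double pole. The change of
coordinates replaces `∂y` by `∂y + h K + (bψ ∂ψ + bφ ∂φ) / (y - r)` with `h` having a double pole,
and the constants are determined by the cancellation of all polar parts of its products.

The determinants come from the identity for `F(x,y) F(y,x) + J(x,y)²` equivalent to
`det g = -16 k⁸ H(x,y)² / ((1-ν)⁶ (x-y)⁸)`, and extend to the horizon by continuity.
-/

noncomputable section

namespace PomeranskySenkov

/-- The polynomial `fAntisymm ν λ (x + y) (x y)` is the part of `F(x,y)` that is antisymmetric in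
`x` and `y`, see `fFactor`. -/
def fAntisymm (ν lam s t : ℝ) : ℝ :=
  ν * (lam * (1 + 2 * ν - 3 * ν ^ 2 - lam ^ 2) * t + (1 + ν) * ((1 - ν) ^ 2 - lam ^ 2) * s
    - lam * ((1 - ν) * (3 + ν) + lam ^ 2))

/-- The polynomial factor of `F`, decomposed along `F(x,y)` at `x = y`. -/
def fFactor (ν lam x y : ℝ) : ℝ :=
  (1 - y ^ 2) * ((1 - x ^ 2) * (x - y) * fAntisymm ν lam (x + y) (x * y)
    + (1 - ν) * H ν lam x x * (ν * y ^ 2 + lam * y + 1))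

/-- The polynomial factor of `J` that is not a product of linear ones. -/
def jFactor (ν lam x y : ℝ) : ℝ :=
  lam ^ 2 + 2 * (x + y) * ν * lam - ν ^ 2 - x * y * ν * (1 - ν ^ 2 - lam ^ 2) + 1

theorem F_eq (k ν lam x y : ℝ) :
    F k ν lam x y = 2 * k ^ 2 * fFactor ν lam x y / ((1 - ν) ^ 2 * (x - y) ^ 2) := by
  unfold F fFactor fAntisymm H G
  ring

theorem J_eq (k ν lam : ℝ) {x y : ℝ} (hxy : x ≠ y) :
    J k ν lam x y = 2 * k ^ 2 * √ν * (lam * ((1 - x ^ 2) * (1 - y ^ 2) * (x - y))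
      * jFactor ν lam x y) / ((1 - ν) ^ 2 * (x - y) ^ 2) := by
  have hsub : x - y ≠ 0 := sub_ne_zero.mpr hxy
  unfold J jFactor
  field_simp
  ring

/-- The quotient `(G(x) H(y,y) - G(y) H(x,x)) / (x - y)`, in terms of `s = x + y` and `t = x y`. -/
def ghSlope (ν lam s t : ℝ) : ℝ :=
  ν * lam * ((1 + ν) ^ 2 - lam ^ 2) * t ^ 3
    + ν * ((1 - ν) * (1 - ν ^ 2 - lam ^ 2) * s + lam * ((1 + ν) ^ 2 - lam ^ 2)) * t ^ 2
    + (ν * lam * (ν ^ 2 - 2 * ν + lam ^ 2 - 3) * s ^ 2 + 2 * (1 - ν ^ 2) * (2 * ν - lam ^ 2) * s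
      - lam * ((1 + ν) ^ 2 - lam ^ 2)) * t
    - 2 * ν * (1 - ν ^ 2) * s ^ 3 + lam * (3 * ν ^ 2 + 2 * ν - lam ^ 2 - 1) * s ^ 2
    - (1 - ν) * (1 - ν ^ 2 + lam ^ 2) * s - lam * ((1 + ν) ^ 2 - lam ^ 2)

/-- The quotient `(H(x,x) H(y,y) - H(x,y) H(y,x)) / (x - y)²`, in terms of `s = x + y` and
`t = x y`. -/
def hhSlope (ν lam s t : ℝ) : ℝ :=
  ν * (-(4 * ν ^ 2 * lam ^ 2 * t ^ 2)
    + (2 * lam * (1 + ν) * (1 - ν ^ 2 - lam ^ 2) * s - 4 * lam ^ 2 * (1 + ν ^ 2)) * t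
    + ((1 - ν ^ 2) ^ 2 - lam ^ 4) * s ^ 2 - 2 * lam * (1 + ν) * (1 - ν ^ 2 + lam ^ 2) * s
    - 4 * lam ^ 2)

theorem mul_ghSlope (ν lam x y : ℝ) :
    (x - y) * ghSlope ν lam (x + y) (x * y)
      = G ν lam x * H ν lam y y - G ν lam y * H ν lam x x := by
  unfold ghSlope H G
  ring

theorem sq_mul_hhSlope (ν lam x y : ℝ) :
    (x - y) ^ 2 * hhSlope ν lam (x + y) (x * y)
      = H ν lam x x * H ν lam y y - H ν lam x y * H ν lam y x := by
  unfold hhSlope H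
  ring

-- Here `(1 + t)² - s² = (1 - x²) (1 - y²)`, and the factor of `hhSlope` is the product of the
-- values of `ν z² + λ z + 1` at `z = x` and `z = y`.
theorem jFactor_fAntisymm_identity (ν lam s t : ℝ) :
    ((1 + t) ^ 2 - s ^ 2) * (ν * lam ^ 2 *
        (lam ^ 2 + 2 * s * ν * lam - ν ^ 2 - t * ν * (1 - ν ^ 2 - lam ^ 2) + 1) ^ 2
          - fAntisymm ν lam s t ^ 2)
      + (1 - ν) * fAntisymm ν lam s t * ghSlope ν lam s t
      + (1 - ν) ^ 2
        * (ν ^ 2 * t ^ 2 + (ν * lam * s - 2 * ν + lam ^ 2) * t + ν * s ^ 2 + lam * s + 1)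
        * hhSlope ν lam s t = 0 := by
  unfold fAntisymm ghSlope hhSlope
  ring

theorem fFactor_mul_fFactor_swap (ν lam x y : ℝ) :
    fFactor ν lam x y * fFactor ν lam y x
        + ν * (lam * ((1 - x ^ 2) * (1 - y ^ 2) * (x - y)) * jFactor ν lam x y) ^ 2
      = (1 - ν) ^ 2 * G ν lam x * G ν lam y * H ν lam x y * H ν lam y x := by
  have hgh := mul_ghSlope ν lam x y
  have hhh := sq_mul_hhSlope ν lam x y
  have hid := jFactor_fAntisymm_identity ν lam (x + y) (x * y)
  unfold fFactor jFactor
  rw [add_comm y x, mul_comm y x]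
  unfold G at hgh ⊢
  generalize fAntisymm ν lam (x + y) (x * y) = N at *
  generalize ghSlope ν lam (x + y) (x * y) = U at *
  generalize hhSlope ν lam (x + y) (x * y) = V at *
  generalize H ν lam x y = Hxy at *
  generalize H ν lam y x = Hyx at *
  generalize H ν lam x x = Hxx at *
  generalize H ν lam y y = Hyy at *
  linear_combination (1 - x ^ 2) * (1 - y ^ 2) * ((x - y) ^ 2 * hid - (1 - ν) * (x - y) * N * hgh
    - (1 - ν) ^ 2 * (ν * x ^ 2 + lam * x + 1) * (ν * y ^ 2 + lam * y + 1) * hhh)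

/-- The components at a point of a symmetric tensor of the block form shared by all the adapted
coordinate systems, in a frame `(K, ∂y, ∂ψ, ∂φ, ∂x)` where `K = ∂t + a ∂ψ + b ∂φ` for constants
`a`, `b`. The components that are not listed vanish. -/
@[ext]
structure FrameCoeffs where
  KK : ℝ
  Kψ : ℝ
  Kφ : ℝ
  ψψ : ℝ
  ψφ : ℝ
  φφ : ℝ
  yy : ℝ
  xx : ℝ

namespace FrameCoeffs

variable (c : FrameCoeffs)

/-- The components in the frame `(K, ∂y, ∂ψ, ∂φ, ∂x)`, in this order. -/
def toMatrix : Mat5 :=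
  !![c.KK, 0, c.Kψ, c.Kφ, 0;
     0, c.yy, 0, 0, 0;
     c.Kψ, 0, c.ψψ, c.ψφ, 0;
     c.Kφ, 0, c.ψφ, c.φφ, 0;
     0, 0, 0, 0, c.xx]

theorem det_toMatrix :
    c.toMatrix.det = c.yy * c.xx * (c.KK * (c.ψψ * c.φφ - c.ψφ ^ 2) - c.Kψ ^ 2 * c.φφ
      + 2 * c.Kψ * c.Kφ * c.ψφ - c.Kφ ^ 2 * c.ψψ) := by
  simp [toMatrix, Matrix.det_succ_row_zero, Fin.sum_univ_succ, Fin.succAbove]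
  ring

end FrameCoeffs

/-- The factor of the `(x, y)` part of the metric, whose components are `-conf / G(y)` and
`conf / G(x)`. -/
def conf (k ν lam x y : ℝ) : ℝ := 2 * H ν lam x y * k ^ 2 / ((1 - ν) ^ 2 * (x - y) ^ 2)

/-- The components of the Pomeransky–Senkov metric in the frame `(∂t, ∂y, ∂ψ, ∂φ, ∂x)`. -/
def metricCoeffs (k ν lam x y : ℝ) : FrameCoeffs where
  KK := -(H ν lam y x / H ν lam x y)
  Kψ := -(H ν lam y x / H ν lam x y * M k ν lam x y)
  Kφ := -(H ν lam y x / H ν lam x y * P k ν lam x y)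
  ψψ := -(F k ν lam x y / H ν lam y x) - H ν lam y x / H ν lam x y * M k ν lam x y ^ 2
  ψφ := -(J k ν lam x y / H ν lam y x)
    - H ν lam y x / H ν lam x y * (M k ν lam x y * P k ν lam x y)
  φφ := F k ν lam y x / H ν lam y x - H ν lam y x / H ν lam x y * P k ν lam x y ^ 2
  yy := -(conf k ν lam x y / G ν lam y)
  xx := conf k ν lam x y / G ν lam x

theorem metric_eq_toMatrix (k ν lam : ℝ) (p : Coords) :
    metric k ν lam p = (metricCoeffs k ν lam (p 4) (p 1)).toMatrix := by
  ext i j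
  rw [metric, Matrix.sub_apply, Matrix.smul_apply, Matrix.vecMulVec_apply]
  fin_cases i <;> fin_cases j <;>
    simp [FrameCoeffs.toMatrix, metricCoeffs, conf, sq, mul_comm]

theorem det_metric {k ν lam : ℝ} (hν : 0 ≤ ν) (hν1 : ν ≠ 1) {p : Coords} (hp : p ∈ domain ν lam) :
    (metric k ν lam p).det
      = -(16 * k ^ 8 * H ν lam (p 4) (p 1) ^ 2) / ((1 - ν) ^ 6 * (p 4 - p 1) ^ 8) := by
  obtain ⟨hGx, hGy, hxy, hH, hH'⟩ := hp
  have hν' : 1 - ν ≠ 0 := sub_ne_zero.mpr hν1.symm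
  have hsub : p 4 - p 1 ≠ 0 := sub_ne_zero.mpr hxy
  have hdet : F k ν lam (p 4) (p 1) * F k ν lam (p 1) (p 4) + J k ν lam (p 4) (p 1) ^ 2
      = 4 * k ^ 4 * (G ν lam (p 4) * G ν lam (p 1) * H ν lam (p 4) (p 1) * H ν lam (p 1) (p 4))
        / ((1 - ν) ^ 2 * (p 4 - p 1) ^ 4) := by
    have hff := fFactor_mul_fFactor_swap ν lam (p 4) (p 1)
    have hsqrt : √ν ^ 2 = ν := Real.sq_sqrt hν
    rw [F_eq, F_eq, J_eq _ _ _ hxy, show (p 1 - p 4) ^ 2 = (p 4 - p 1) ^ 2 by ring]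
    field_simp
    linear_combination 4 * k ^ 4 * (hff + (lam * ((1 - p 4 ^ 2) * (1 - p 1 ^ 2) * (p 4 - p 1))
      * jFactor ν lam (p 4) (p 1)) ^ 2 * hsqrt)
  rw [metric_eq_toMatrix, FrameCoeffs.det_toMatrix]
  calc _ = -(conf k ν lam (p 4) (p 1) ^ 2 / (G ν lam (p 1) * G ν lam (p 4)))
        * ((F k ν lam (p 4) (p 1) * F k ν lam (p 1) (p 4) + J k ν lam (p 4) (p 1) ^ 2)
          / (H ν lam (p 4) (p 1) * H ν lam (p 1) (p 4))) := by
        simp only [metricCoeffs]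
        field_simp
        ring
    _ = _ := by
        rw [hdet]
        unfold conf
        field_simp
        ring

/-- The polynomial factor of `M` that is not a product of linear ones. -/
def mFactor (ν lam x y : ℝ) : ℝ :=
  -lam + ν - 2 * ν * x + ν * x * ((lam + ν - 1) * x + 2) * y - 1

/-- The factor of the numerator of `g_ψφ` left after cancelling `H(y,x)` and linear factors. -/
def psiPhiReduced (ν lam x y : ℝ) : ℝ :=
  ν * ((1 - ν ^ 2 - lam ^ 2) * x - 2 * ν * lam) * y ^ 2
    + (ν * ((ν + lam) ^ 2 - 4 * lam - 1) * x + ν ^ 2 + 4 * ν * lam - lam ^ 2 - 2 * lam - 1) * y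
    + 2 * lam * x + 1 - ν ^ 2 + lam ^ 2

/-- The quotient of the numerator of `g_ψψ` by `H(y,x)`, up to a multiple of `mFactor` and one of
`psiPhiReduced`, see `psiPsiNum`. -/
def killingPsiReduced (ν lam x y : ℝ) : ℝ :=
  ν * (x ^ 2 - 1) * ((1 - ν ^ 2 - lam ^ 2) * x - 2 * ν * lam) * y ^ 2
    + (-ν * (1 - ν ^ 2 - lam ^ 2 + 2 * lam) * x ^ 3
      + ν * (1 - ν ^ 2 - lam ^ 2 + 2 * ν * lam) * x ^ 2
      + ν * (1 - ν ^ 2 - lam ^ 2 - 4 * ν * lam + 6 * lam) * x + (1 + lam) ^ 2 - ν ^ 2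
      - 4 * ν * lam) * y
    + 2 * ν * lam * x ^ 3 + (ν * ((ν + lam) ^ 2 - 4 * lam - 1) + 2 * lam) * x ^ 2
    + 2 * lam * (ν - 2) * x - (1 - ν ^ 2 + lam ^ 2)

/-- The factor of the numerator of `g_φφ` left after cancelling `H(y,x)` and `1 - x²`. -/
def phiPhiReduced (ν lam x y : ℝ) : ℝ :=
  ν ^ 2 * ((1 - ν) * (1 - ν ^ 2 - lam ^ 2) * x ^ 2
      + lam * (3 * ν ^ 2 - 2 * ν + lam ^ 2 - 1) * x + 2 * ν * lam ^ 2) * y ^ 4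
    + ν * lam * ((1 - ν) ^ 2 - lam ^ 2) * ((x ^ 2 - 1) * (y ^ 3 - y) + 2 * x * y ^ 2)
    + ν * (((1 - ν) * (1 - ν ^ 2 - lam ^ 2) - 2 * lam ^ 2) * x ^ 2 + (1 - ν) ^ 2 * (1 + ν)
      + lam ^ 2 * (1 - 3 * ν)) * y ^ 2
    + 2 * lam ^ 2 * x ^ 2 + lam * (lam ^ 2 + (1 - ν) * (3 + ν)) * x
    + (1 - ν) * (1 - ν ^ 2 + lam ^ 2)

/-- The factor of the numerator of `g(K, ∂φ)`, up to a multiple of `phiPhiReduced`, that is left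
after cancelling `ν y² + λ y + 1`, see `killingPhiReduced_identity`. -/
def killingPhiReduced (ν lam x y : ℝ) : ℝ :=
  -ν * ((1 - ν) * (1 - ν ^ 2 - lam ^ 2) * x ^ 2
      + lam * (3 * ν ^ 2 - 2 * ν + lam ^ 2 - 1) * x + 2 * ν * lam ^ 2) * y ^ 3
    + lam * (2 * ν * (1 - ν) * x ^ 2 - 2 * ν * lam * x + (1 - ν) ^ 2 - lam ^ 2) * y ^ 2
    + (lam * (ν ^ 2 + 2 * ν + lam ^ 2 - 3) * x - (1 - ν) ^ 2 * (1 + ν)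
      - lam ^ 2 * (1 - 3 * ν)) * y
    + lam * (2 * lam * x + 1 - ν ^ 2 + lam ^ 2)

theorem psiPhiReduced_mul_H (ν lam x y : ℝ) :
    psiPhiReduced ν lam x y * H ν lam y x = (1 - y) * jFactor ν lam x y * H ν lam x y
      - 2 * lam * (1 + ν + lam) * (1 - ν) ^ 2 * (x - y) * mFactor ν lam x y * y := by
  unfold psiPhiReduced jFactor mFactor H
  ring

theorem fAntisymm_eq_jFactor (ν lam x y : ℝ) :
    fAntisymm ν lam (x + y) (x * y) = ν * ((1 - ν) * y - lam) * jFactor ν lam x y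
      + ν * (1 - ν) * (ν * y ^ 2 + lam * y + 1) * ((1 - ν ^ 2 - lam ^ 2) * x - 2 * lam) := by
  unfold fAntisymm jFactor
  ring

theorem killingPsiReduced_mul_H (ν lam x y : ℝ) :
    killingPsiReduced ν lam x y * H ν lam y x = -((1 - y) * H ν lam x y *
        (ν * (x - y) * (1 - x ^ 2) * ((1 - ν ^ 2 - lam ^ 2) * x - 2 * lam) + H ν lam x x))
      - 2 * (1 + ν + lam) * ((1 - ν) ^ 2 * (x - y) ^ 2) * lam * mFactor ν lam x y := by
  unfold killingPsiReduced mFactor H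
  ring

theorem H_add_mFactor (ν lam x y : ℝ) :
    H ν lam y x + lam * ((y + 1) * mFactor ν lam x y)
      = ν * (1 - lam + ν) * ((x ^ 2 - 1) * y) * ((1 - ν) * y - lam)
        + (1 - ν) * (1 - lam + ν) * (ν * y ^ 2 + lam * y + 1) := by
  unfold mFactor H
  ring

theorem phiPhiReduced_mul_H (ν lam x y : ℝ) :
    phiPhiReduced ν lam x y * H ν lam y x
      = (-((1 - y ^ 2) * (x - y) * fAntisymm ν lam (x + y) (x * y))
          + (1 - ν) * H ν lam y y * (ν * x ^ 2 + lam * x + 1)) * H ν lam x y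
        - 2 * lam ^ 2 * ν * (1 - lam + ν) * (1 + ν + lam) * ((1 - ν) ^ 2 * (x - y) ^ 2)
          * (1 - x ^ 2) * y ^ 2 := by
  unfold phiPhiReduced fAntisymm H
  ring

theorem killingPhiReduced_identity (ν lam x y : ℝ) :
    2 * (1 + ν + lam) * ((1 - ν) ^ 2 * (x - y) ^ 2) * lam ^ 2 * y
      - lam ^ 2 * (x - y) * (1 + y) * psiPhiReduced ν lam x y
      - ((1 - ν) * y - lam) * phiPhiReduced ν lam x y
      = (1 - ν) * (ν * y ^ 2 + lam * y + 1) * killingPhiReduced ν lam x y := by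
  unfold psiPhiReduced phiPhiReduced killingPhiReduced
  ring

/-- The numerator of `g_ψψ` after cancellation of `H(y,x)`, up to a constant. -/
def psiPsiNum (ν lam x y : ℝ) : ℝ :=
  (1 + y) * (-(2 * (1 + ν + lam) * ((1 - ν) ^ 2 * (x - y) ^ 2) * lam * mFactor ν lam x y)
    + ν * (1 - lam + ν) * ((x - y) * (1 - x ^ 2)) * ((1 - ν) * y - lam) * psiPhiReduced ν lam x y
    - (1 - ν) * (1 - lam + ν) * (ν * y ^ 2 + lam * y + 1) * killingPsiReduced ν lam x y)

/-- The numerator of `g_ψφ` after cancellation of `H(y,x)`, up to a constant. -/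
def psiPhiNum (ν lam x y : ℝ) : ℝ :=
  lam * ((x - y) * (1 - x ^ 2) * (1 + y)) * psiPhiReduced ν lam x y

/-- The numerator of `g_φφ` after cancellation of `H(y,x)`, up to a constant. -/
def phiPhiNum (ν lam x y : ℝ) : ℝ := (1 - x ^ 2) * phiPhiReduced ν lam x y

theorem psiPsiNum_mul_H (ν lam x y : ℝ) :
    psiPsiNum ν lam x y * H ν lam y x = (1 - lam + ν) * fFactor ν lam x y * H ν lam x y
      + 2 * lam ^ 2 * (1 + ν + lam) * ((1 - ν) ^ 2 * (x - y) ^ 2)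
        * ((y + 1) * mFactor ν lam x y) ^ 2 := by
  have hq := psiPhiReduced_mul_H ν lam x y
  have hN := fAntisymm_eq_jFactor ν lam x y
  have hz := killingPsiReduced_mul_H ν lam x y
  have hHm := H_add_mFactor ν lam x y
  unfold psiPsiNum fFactor
  generalize fAntisymm ν lam (x + y) (x * y) = N at *
  generalize H ν lam x y = Hxy at *
  generalize H ν lam y x = Hyx at *
  generalize H ν lam x x = Hxx at *
  generalize psiPhiReduced ν lam x y = q at *
  generalize killingPsiReduced ν lam x y = z at *
  generalize jFactor ν lam x y = j at *
  generalize mFactor ν lam x y = μ at *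
  linear_combination (1 + y) * (-(2 * (1 + ν + lam) * ((1 - ν) ^ 2 * (x - y) ^ 2) * lam * μ) * hHm
    + ν * (1 - lam + ν) * ((x - y) * (1 - x ^ 2)) * ((1 - ν) * y - lam) * hq
    - (1 - lam + ν) * (1 - y) * (1 - x ^ 2) * (x - y) * Hxy * hN
    - (1 - ν) * (1 - lam + ν) * (ν * y ^ 2 + lam * y + 1) * hz)

theorem psiPhiNum_mul_H (ν lam x y : ℝ) :
    psiPhiNum ν lam x y * H ν lam y x
      = lam * ((1 - x ^ 2) * (1 - y ^ 2) * (x - y)) * jFactor ν lam x y * H ν lam x y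
      + 2 * lam ^ 2 * (1 + ν + lam) * ((1 - ν) ^ 2 * (x - y) ^ 2) * ((y + 1) * mFactor ν lam x y)
        * ((x ^ 2 - 1) * y) := by
  unfold psiPhiNum
  linear_combination lam * ((x - y) * (1 - x ^ 2) * (1 + y)) * psiPhiReduced_mul_H ν lam x y

theorem phiPhiNum_mul_H (ν lam x y : ℝ) :
    phiPhiNum ν lam x y * H ν lam y x = fFactor ν lam y x * H ν lam x y
      - 2 * lam ^ 2 * ν * (1 - lam + ν) * (1 + ν + lam) * ((1 - ν) ^ 2 * (x - y) ^ 2)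
        * ((x ^ 2 - 1) * y) ^ 2 := by
  unfold phiPhiNum fFactor
  rw [add_comm y x, mul_comm y x]
  linear_combination (1 - x ^ 2) * phiPhiReduced_mul_H ν lam x y

/-- The denominator common to the components of the metric after cancellation of `H(y,x)`. -/
def den (ν lam x y : ℝ) : ℝ := (1 - ν) ^ 2 * (x - y) ^ 2 * H ν lam x y

/-- Parameters of the metric together with a Killing horizon `y = r`, where `r` is a root of
`ν y² + λ y + 1` and `s` is the other root; `r = s` at a degenerate horizon. -/
structure KillingHorizon where
  k : ℝ
  ν : ℝ
  lam : ℝ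
  r : ℝ
  s : ℝ
  k_ne : k ≠ 0
  ν_pos : 0 < ν
  ν_ne : ν ≠ 1
  lam_ne : lam ≠ 0
  abs_lam_lt : |lam| < 1 + ν
  mul_roots : ν * (r * s) = 1
  add_roots : lam = -(ν * (r + s))

namespace KillingHorizon

variable (h : KillingHorizon) (x y : ℝ)

/-- The square root of `ν`. -/
def n : ℝ := √h.ν

/-- The square root of `(1 + ν)² - λ²`, which enters the one-form `Ω`. -/
def m : ℝ := √((1 + h.ν) ^ 2 - h.lam ^ 2)

/-- With `b`, the constants for which `K = ∂t + a ∂ψ + b ∂φ` is null at the horizon. -/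
def a : ℝ := (1 - h.lam + h.ν) / (2 * h.k * h.m)

/-- See `KillingHorizon.a`. -/
def b : ℝ := -(h.a * h.n * ((1 - h.ν) * h.r - h.lam) / h.lam)

theorem one_sub_lam_add_ν_pos : 0 < 1 - h.lam + h.ν := by
  linarith [(abs_lt.mp h.abs_lam_lt).2]

theorem one_add_ν_add_lam_pos : 0 < 1 + h.ν + h.lam := by
  linarith [(abs_lt.mp h.abs_lam_lt).1]

theorem one_sub_ν_ne : 1 - h.ν ≠ 0 := sub_ne_zero.mpr h.ν_ne.symm

theorem n_pos : 0 < h.n := Real.sqrt_pos.mpr h.ν_pos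

theorem n_sq : h.n ^ 2 = h.ν := Real.sq_sqrt h.ν_pos.le

theorem one_add_ν_sq_sub_lam_sq :
    (1 + h.ν) ^ 2 - h.lam ^ 2 = (1 - h.lam + h.ν) * (1 + h.ν + h.lam) := by
  ring

theorem m_pos : 0 < h.m := Real.sqrt_pos.mpr <|
  h.one_add_ν_sq_sub_lam_sq ▸ mul_pos h.one_sub_lam_add_ν_pos h.one_add_ν_add_lam_pos

theorem m_sq : h.m ^ 2 = (1 - h.lam + h.ν) * (1 + h.ν + h.lam) := by
  rw [← one_add_ν_sq_sub_lam_sq, m, Real.sq_sqrt]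
  exact h.one_add_ν_sq_sub_lam_sq ▸ (mul_pos h.one_sub_lam_add_ν_pos h.one_add_ν_add_lam_pos).le

theorem one_add_ν_add_lam_eq_div : 1 + h.ν + h.lam = h.m ^ 2 / (1 - h.lam + h.ν) := by
  rw [h.m_sq, mul_div_cancel_left₀ _ h.one_sub_lam_add_ν_pos.ne']

theorem quadratic_eq : h.ν * y ^ 2 + h.lam * y + 1 = h.ν * (y - h.r) * (y - h.s) := by
  rw [h.add_roots]
  linear_combination -h.mul_roots

theorem M_eq : M h.k h.ν h.lam x y = 2 * h.k * h.lam * h.m * ((y + 1) * mFactor h.ν h.lam x y)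
    / ((1 - h.lam + h.ν) * H h.ν h.lam y x) := by
  rw [M, mFactor, m, add_comm h.ν 1, mul_assoc (2 * h.k * h.lam * _)]

theorem P_eq : P h.k h.ν h.lam x y = 2 * h.k * h.lam * h.n * h.m * ((x ^ 2 - 1) * y)
    / H h.ν h.lam y x := by
  rw [P, n, m, add_comm h.ν 1, mul_assoc (2 * h.k * h.lam * _ * _)]

variable {x y}

theorem metricCoeffs_Kψ (hH' : H h.ν h.lam y x ≠ 0) :
    (metricCoeffs h.k h.ν h.lam x y).Kψ = -(2 * h.k * h.lam * h.m *
      ((y + 1) * mFactor h.ν h.lam x y) / ((1 - h.lam + h.ν) * H h.ν h.lam x y)) := by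
  simp only [metricCoeffs, M_eq]
  field_simp

theorem metricCoeffs_Kφ (hH' : H h.ν h.lam y x ≠ 0) :
    (metricCoeffs h.k h.ν h.lam x y).Kφ
      = -(2 * h.k * h.lam * h.n * h.m * ((x ^ 2 - 1) * y) / H h.ν h.lam x y) := by
  simp only [metricCoeffs, P_eq]
  field_simp

theorem metricCoeffs_ψψ (hxy : x ≠ y) (hH : H h.ν h.lam x y ≠ 0) (hH' : H h.ν h.lam y x ≠ 0) :
    (metricCoeffs h.k h.ν h.lam x y).ψψ
      = -(2 * h.k ^ 2 * psiPsiNum h.ν h.lam x y / ((1 - h.lam + h.ν) * den h.ν h.lam x y)) := by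
  have hsub : x - y ≠ 0 := sub_ne_zero.mpr hxy
  have hν := h.one_sub_ν_ne
  have he := h.one_sub_lam_add_ν_pos.ne'
  have hnum := eq_div_of_mul_eq hH' (psiPsiNum_mul_H h.ν h.lam x y)
  simp only [metricCoeffs, den, hnum, M_eq, F_eq, h.one_add_ν_add_lam_eq_div]
  field_simp
  ring

theorem metricCoeffs_ψφ (hxy : x ≠ y) (hH : H h.ν h.lam x y ≠ 0) (hH' : H h.ν h.lam y x ≠ 0) :
    (metricCoeffs h.k h.ν h.lam x y).ψφ
      = -(2 * h.k ^ 2 * h.n * psiPhiNum h.ν h.lam x y / den h.ν h.lam x y) := by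
  have hsub : x - y ≠ 0 := sub_ne_zero.mpr hxy
  have hν := h.one_sub_ν_ne
  have he := h.one_sub_lam_add_ν_pos.ne'
  have hn : √h.ν = h.n := rfl
  have hnum := eq_div_of_mul_eq hH' (psiPhiNum_mul_H h.ν h.lam x y)
  simp only [metricCoeffs, den, hnum, M_eq, P_eq, J_eq _ _ _ hxy, hn, h.one_add_ν_add_lam_eq_div]
  field_simp
  ring

theorem metricCoeffs_φφ (hxy : x ≠ y) (hH : H h.ν h.lam x y ≠ 0) (hH' : H h.ν h.lam y x ≠ 0) :
    (metricCoeffs h.k h.ν h.lam x y).φφ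
      = 2 * h.k ^ 2 * phiPhiNum h.ν h.lam x y / den h.ν h.lam x y := by
  have hsub : x - y ≠ 0 := sub_ne_zero.mpr hxy
  have hν := h.one_sub_ν_ne
  have he := h.one_sub_lam_add_ν_pos.ne'
  have hnum := eq_div_of_mul_eq hH' (phiPhiNum_mul_H h.ν h.lam x y)
  simp only [metricCoeffs, den, hnum, P_eq, F_eq, h.one_add_ν_add_lam_eq_div,
    show (y - x) ^ 2 = (x - y) ^ 2 by ring]
  field_simp
  rw [h.n_sq]
  ring

end KillingHorizon

/-- The matrix of the change from the frame `(∂t, ∂y, ∂ψ, ∂φ, ∂x)` to `(K, ∂y, ∂ψ, ∂φ, ∂x)`, where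
`K = ∂t + a ∂ψ + b ∂φ`. -/
def shiftMat (a b : ℝ) : Mat5 :=
  !![1, 0, 0, 0, 0;
     0, 1, 0, 0, 0;
     -a, 0, 1, 0, 0;
     -b, 0, 0, 1, 0;
     0, 0, 0, 0, 1]

theorem shiftMat_mul_shiftMat_neg (a b : ℝ) : shiftMat a b * shiftMat (-a) (-b) = 1 := by
  ext i j
  fin_cases i <;> fin_cases j <;> simp [shiftMat, Matrix.mul_apply, Fin.sum_univ_five]

theorem det_shiftMat (a b : ℝ) : (shiftMat a b).det = 1 := by
  simp [shiftMat, Matrix.det_succ_row_zero, Fin.sum_univ_succ, Fin.succAbove]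

namespace FrameCoeffs

/-- The components with respect to `K + a ∂ψ + b ∂φ` in place of `K`. -/
def shear (c : FrameCoeffs) (a b : ℝ) : FrameCoeffs where
  KK := c.KK + 2 * a * c.Kψ + 2 * b * c.Kφ + a ^ 2 * c.ψψ + 2 * a * b * c.ψφ + b ^ 2 * c.φφ
  Kψ := c.Kψ + a * c.ψψ + b * c.ψφ
  Kφ := c.Kφ + a * c.ψφ + b * c.φφ
  ψψ := c.ψψ
  ψφ := c.ψφ
  φφ := c.φφ
  yy := c.yy
  xx := c.xx

theorem toMatrix_eq_shear (c : FrameCoeffs) (a b : ℝ) :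
    c.toMatrix = (shiftMat a b)ᵀ * (c.shear a b).toMatrix * shiftMat a b := by
  ext i j
  fin_cases i <;> fin_cases j <;>
    simp [shiftMat, toMatrix, shear, Matrix.mul_apply, Fin.sum_univ_five] <;> ring

/-- The components of a metric for which `K` is null on a horizon, from those with the zero and the
pole at the horizon divided out: `w` vanishes at the horizon, and `d` is the order of vanishing of
`g(K, K)` and of the pole of `g_yy`. -/
def atHorizon (c : FrameCoeffs) (d : ℕ) (w : ℝ) : FrameCoeffs where
  KK := w ^ d * c.KK
  Kψ := w * c.Kψ
  Kφ := w * c.Kφ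
  ψψ := c.ψψ
  ψφ := c.ψφ
  φφ := c.φφ
  yy := c.yy / w ^ d
  xx := c.xx

end FrameCoeffs

/-- The numerator of `g(K, ∂ψ) / (y - r)`, up to constants and `1 + y`. -/
def killingPsiNum (ν lam s x y : ℝ) : ℝ :=
  ν * (y - s) * killingPsiReduced ν lam x y - ν * ((x - y) * (1 - x ^ 2)) * psiPhiReduced ν lam x y

/-- The numerator of `g(K, ∂φ) / (y - r)`, up to constants and `1 - x²`. -/
def killingPhiNum (ν lam s x y : ℝ) : ℝ :=
  ν * (y - s) * killingPhiReduced ν lam x y + phiPhiReduced ν lam x y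

/-- The numerator of `g(K, K) / (y - r)`, up to constants. -/
def killingKillingNum (ν lam r s x y : ℝ) : ℝ :=
  -(2 * (1 + ν + lam) * ((1 - ν) ^ 2 * (x - y) ^ 2) * (ν * (x ^ 2 * y - s)))
    + (1 + y) * killingPsiNum ν lam s x y
    - ν * ((1 - ν) * r - lam) / lam ^ 2 * ((1 - x ^ 2) * killingPhiNum ν lam s x y)

namespace KillingHorizon

variable (h : KillingHorizon) (x y : ℝ)

/-- The components of the metric in the frame `(K, ∂y, ∂ψ, ∂φ, ∂x)`, with the zero of `g(K, ·)` and
the pole of `g_yy` at `y = r` divided out. -/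
def coeffs : FrameCoeffs where
  KK := (1 - h.ν) * (1 - h.lam + h.ν) * killingKillingNum h.ν h.lam h.r h.s x y
    / (2 * (1 + h.ν + h.lam) * den h.ν h.lam x y)
  Kψ := h.k * (1 - h.ν) * (1 - h.lam + h.ν) * ((1 + y) * killingPsiNum h.ν h.lam h.s x y)
    / (h.m * den h.ν h.lam x y)
  Kφ := h.k * h.n * (1 - h.ν) * (1 - h.lam + h.ν)
    * ((1 - x ^ 2) * killingPhiNum h.ν h.lam h.s x y) / (h.lam * h.m * den h.ν h.lam x y)
  ψψ := -(2 * h.k ^ 2 * psiPsiNum h.ν h.lam x y / ((1 - h.lam + h.ν) * den h.ν h.lam x y))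
  ψφ := -(2 * h.k ^ 2 * h.n * psiPhiNum h.ν h.lam x y / den h.ν h.lam x y)
  φφ := 2 * h.k ^ 2 * phiPhiNum h.ν h.lam x y / den h.ν h.lam x y
  yy := -(conf h.k h.ν h.lam x y / ((1 - y ^ 2) * (h.ν * (y - h.s))))
  xx := conf h.k h.ν h.lam x y / G h.ν h.lam x

theorem sub_mul_killingPsiNum :
    (y - h.r) * ((1 - h.ν) * (1 - h.lam + h.ν) * ((1 + y) * killingPsiNum h.ν h.lam h.s x y))
      = -(2 * (1 + h.ν + h.lam) * ((1 - h.ν) ^ 2 * (x - y) ^ 2) * h.lam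
          * ((y + 1) * mFactor h.ν h.lam x y))
        - psiPsiNum h.ν h.lam x y
        + ((1 - h.ν) * h.r - h.lam) / h.lam * h.ν * (1 - h.lam + h.ν)
          * psiPhiNum h.ν h.lam x y := by
  have hlam := h.lam_ne
  unfold psiPsiNum psiPhiNum killingPsiNum
  rw [h.quadratic_eq y]
  field_simp
  ring

theorem sub_mul_killingPhiNum :
    (y - h.r) * ((1 - h.ν) * ((1 - x ^ 2) * killingPhiNum h.ν h.lam h.s x y)) / h.lam
      = -(2 * (1 + h.ν + h.lam) * ((1 - h.ν) ^ 2 * (x - y) ^ 2) * h.lam * ((x ^ 2 - 1) * y))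
        - psiPhiNum h.ν h.lam x y
        - ((1 - h.ν) * h.r - h.lam) / h.lam * phiPhiNum h.ν h.lam x y := by
  have hlam := h.lam_ne
  have hid := killingPhiReduced_identity h.ν h.lam x y
  rw [h.quadratic_eq y] at hid
  unfold psiPhiNum phiPhiNum killingPhiNum
  field_simp
  linear_combination -(1 - x ^ 2) * hid

variable {x y}

theorem shear_Kψ (hxy : x ≠ y) (hH : H h.ν h.lam x y ≠ 0) (hH' : H h.ν h.lam y x ≠ 0) :
    ((metricCoeffs h.k h.ν h.lam x y).shear h.a h.b).Kψ = (y - h.r) * (h.coeffs x y).Kψ := by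
  have hlam := h.lam_ne
  have he := h.one_sub_lam_add_ν_pos.ne'
  have hk := h.k_ne
  have hm := h.m_pos.ne'
  have hν := h.one_sub_ν_ne
  have hsub : x - y ≠ 0 := sub_ne_zero.mpr hxy
  have hcoeff : (y - h.r) * (h.coeffs x y).Kψ = h.k * ((y - h.r) * ((1 - h.ν)
      * (1 - h.lam + h.ν) * ((1 + y) * killingPsiNum h.ν h.lam h.s x y)))
      / (h.m * den h.ν h.lam x y) := by
    simp only [coeffs]
    ring
  rw [hcoeff, sub_mul_killingPsiNum, FrameCoeffs.shear, h.metricCoeffs_Kψ hH',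
    h.metricCoeffs_ψψ hxy hH hH', h.metricCoeffs_ψφ hxy hH hH', h.one_add_ν_add_lam_eq_div, b, a,
    den, ← h.n_sq]
  rw [← h.n_sq] at hH he hν
  field_simp
  ring

theorem shear_Kφ (hxy : x ≠ y) (hH : H h.ν h.lam x y ≠ 0) (hH' : H h.ν h.lam y x ≠ 0) :
    ((metricCoeffs h.k h.ν h.lam x y).shear h.a h.b).Kφ = (y - h.r) * (h.coeffs x y).Kφ := by
  have hlam := h.lam_ne
  have he := h.one_sub_lam_add_ν_pos.ne'
  have hk := h.k_ne
  have hm := h.m_pos.ne'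
  have hν := h.one_sub_ν_ne
  have hsub : x - y ≠ 0 := sub_ne_zero.mpr hxy
  have hcoeff : (y - h.r) * (h.coeffs x y).Kφ = h.k * h.n * (1 - h.lam + h.ν) * ((y - h.r)
      * ((1 - h.ν) * ((1 - x ^ 2) * killingPhiNum h.ν h.lam h.s x y)) / h.lam)
      / (h.m * den h.ν h.lam x y) := by
    simp only [coeffs]
    field_simp
  rw [hcoeff, sub_mul_killingPhiNum, FrameCoeffs.shear, h.metricCoeffs_Kφ hH',
    h.metricCoeffs_φφ hxy hH hH', h.metricCoeffs_ψφ hxy hH hH', h.one_add_ν_add_lam_eq_div, b, a,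
    den]
  field_simp
  ring

theorem metricCoeffs_KK_add (hH' : H h.ν h.lam y x ≠ 0) :
    (metricCoeffs h.k h.ν h.lam x y).KK + h.a * (metricCoeffs h.k h.ν h.lam x y).Kψ
        + h.b * (metricCoeffs h.k h.ν h.lam x y).Kφ
      = -((y - h.r) * ((1 - h.ν) * (1 - h.lam + h.ν) * (h.ν * (x ^ 2 * y - h.s)))
        / H h.ν h.lam x y) := by
  have hlam := h.lam_ne
  have he := h.one_sub_lam_add_ν_pos.ne'
  have hk := h.k_ne
  have hm := h.m_pos.ne'
  have hHm := H_add_mFactor h.ν h.lam x y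
  rw [h.quadratic_eq y] at hHm
  have hnum : (y - h.r) * ((1 - h.ν) * (1 - h.lam + h.ν) * (h.ν * (x ^ 2 * y - h.s)))
      = H h.ν h.lam y x + h.lam * ((y + 1) * mFactor h.ν h.lam x y)
        - h.n ^ 2 * (1 - h.lam + h.ν) * ((x ^ 2 - 1) * y) * ((1 - h.ν) * h.r - h.lam) := by
    rw [h.n_sq]
    linear_combination -hHm
  rw [hnum, h.metricCoeffs_Kψ hH', h.metricCoeffs_Kφ hH', metricCoeffs, b, a]
  field_simp
  ring

theorem coeffs_KK_eq (hxy : x ≠ y) (hH : H h.ν h.lam x y ≠ 0) :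
    (h.coeffs x y).KK
      = -((1 - h.ν) * (1 - h.lam + h.ν) * (h.ν * (x ^ 2 * y - h.s)) / H h.ν h.lam x y)
        + h.a * (h.coeffs x y).Kψ + h.b * (h.coeffs x y).Kφ := by
  have hlam := h.lam_ne
  have he := h.one_sub_lam_add_ν_pos.ne'
  have hk := h.k_ne
  have hm := h.m_pos.ne'
  have hν := h.one_sub_ν_ne
  have hsub : x - y ≠ 0 := sub_ne_zero.mpr hxy
  simp only [coeffs, killingKillingNum, den]
  rw [h.one_add_ν_add_lam_eq_div, b, a, ← h.n_sq]
  rw [← h.n_sq] at hν hH he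
  field_simp
  ring

theorem shear_KK (hxy : x ≠ y) (hH : H h.ν h.lam x y ≠ 0) (hH' : H h.ν h.lam y x ≠ 0) :
    ((metricCoeffs h.k h.ν h.lam x y).shear h.a h.b).KK = (y - h.r) * (h.coeffs x y).KK := by
  have hKt := h.metricCoeffs_KK_add hH'
  have hKψ := h.shear_Kψ hxy hH hH'
  have hKφ := h.shear_Kφ hxy hH hH'
  simp only [FrameCoeffs.shear] at hKψ hKφ ⊢
  rw [h.coeffs_KK_eq hxy hH]
  linear_combination hKt + h.a * hKψ + h.b * hKφ

theorem shear_metricCoeffs (hxy : x ≠ y) (hH : H h.ν h.lam x y ≠ 0) (hH' : H h.ν h.lam y x ≠ 0) :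
    (metricCoeffs h.k h.ν h.lam x y).shear h.a h.b = (h.coeffs x y).atHorizon 1 (y - h.r) := by
  ext
  · simpa only [FrameCoeffs.atHorizon, pow_one] using h.shear_KK hxy hH hH'
  · exact h.shear_Kψ hxy hH hH'
  · exact h.shear_Kφ hxy hH hH'
  · exact h.metricCoeffs_ψψ hxy hH hH'
  · exact h.metricCoeffs_ψφ hxy hH hH'
  · exact h.metricCoeffs_φφ hxy hH hH'
  · simp only [FrameCoeffs.shear, FrameCoeffs.atHorizon, metricCoeffs, coeffs, pow_one, G,
      h.quadratic_eq y, neg_div, div_div]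
    ring_nf
  · rfl

theorem metric_eq_atHorizon {p : Coords} (hp : p ∈ domain h.ν h.lam) :
    metric h.k h.ν h.lam p = (shiftMat h.a h.b)ᵀ
      * ((h.coeffs (p 4) (p 1)).atHorizon 1 (p 1 - h.r)).toMatrix * shiftMat h.a h.b := by
  obtain ⟨-, -, hxy, hH, hH'⟩ := hp
  rw [metric_eq_toMatrix, FrameCoeffs.toMatrix_eq_shear _ h.a h.b, h.shear_metricCoeffs hxy hH hH']

theorem det_metric_eq_det_atHorizon {p : Coords} (hp : p ∈ domain h.ν h.lam) :
    (metric h.k h.ν h.lam p).det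
      = ((h.coeffs (p 4) (p 1)).atHorizon 1 (p 1 - h.r)).toMatrix.det := by
  rw [h.metric_eq_atHorizon hp, Matrix.det_mul, Matrix.det_mul, Matrix.det_transpose, det_shiftMat,
    one_mul, mul_one]

end KillingHorizon

/-- Polynomial functions of two variables. -/
@[fun_prop]
def IsPolynomial₂ {R : Type*} [CommRing R] (f : R × R → R) : Prop :=
  ∃ p : Polynomial (Polynomial R), ∀ z, f z = p.evalEval z.1 z.2

namespace IsPolynomial₂

section Ring

variable {R : Type*} [CommRing R] {f g : R × R → R}

@[fun_prop]
theorem const (c : R) : IsPolynomial₂ fun _ : R × R => c :=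
  ⟨.C (.C c), by simp⟩

@[fun_prop]
theorem fst : IsPolynomial₂ fun z : R × R => z.1 :=
  ⟨.C .X, by simp [Polynomial.evalEval]⟩

@[fun_prop]
theorem snd : IsPolynomial₂ fun z : R × R => z.2 :=
  ⟨.X, by simp⟩

@[fun_prop]
theorem neg (hf : IsPolynomial₂ f) : IsPolynomial₂ fun z => -f z := by
  obtain ⟨p, hp⟩ := hf
  exact ⟨-p, by simp [hp]⟩

@[fun_prop]
theorem add (hf : IsPolynomial₂ f) (hg : IsPolynomial₂ g) : IsPolynomial₂ fun z => f z + g z := by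
  obtain ⟨p, hp⟩ := hf
  obtain ⟨q, hq⟩ := hg
  exact ⟨p + q, by simp [hp, hq]⟩

@[fun_prop]
theorem sub (hf : IsPolynomial₂ f) (hg : IsPolynomial₂ g) : IsPolynomial₂ fun z => f z - g z := by
  simpa only [sub_eq_add_neg] using hf.add hg.neg

@[fun_prop]
theorem mul (hf : IsPolynomial₂ f) (hg : IsPolynomial₂ g) : IsPolynomial₂ fun z => f z * g z := by
  obtain ⟨p, hp⟩ := hf
  obtain ⟨q, hq⟩ := hg
  exact ⟨p * q, by simp [hp, hq]⟩

@[fun_prop]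
theorem pow (hf : IsPolynomial₂ f) (d : ℕ) : IsPolynomial₂ fun z => f z ^ d := by
  obtain ⟨p, hp⟩ := hf
  exact ⟨p ^ d, by simp [hp]⟩

theorem exists_eq_sub_mul [IsDomain R] [Infinite R] {r : R} (hf : IsPolynomial₂ f)
    (hr : ∀ x, f (x, r) = 0) :
    ∃ g, IsPolynomial₂ g ∧ ∀ x y, f (x, y) = (y - r) * g (x, y) := by
  obtain ⟨p, hp⟩ := hf
  have hroot : p.IsRoot (.C r) := Polynomial.funext fun x => by
    simpa [hp, Polynomial.evalEval] using hr x
  obtain ⟨q, rfl⟩ := Polynomial.dvd_iff_isRoot.mpr hroot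
  exact ⟨fun z => q.evalEval z.1 z.2, ⟨q, fun _ => rfl⟩, fun x y => by simp [hp]⟩

end Ring

theorem analyticAt {𝕜 : Type*} [NontriviallyNormedField 𝕜] {f : 𝕜 × 𝕜 → 𝕜}
    (hf : IsPolynomial₂ f) (z : 𝕜 × 𝕜) : AnalyticAt 𝕜 f z := by
  obtain ⟨p, hf⟩ := hf
  rw [funext hf]
  clear hf
  induction p using Polynomial.induction_on' with
  | add p q hp hq => simpa using hp.fun_add hq
  | monomial d a =>
    have ha := (analyticAt_fst (𝕜 := 𝕜) (p := z)).aeval_polynomial a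
    simpa [Polynomial.evalEval, Polynomial.coe_aeval_eq_eval] using
      ha.fun_mul (analyticAt_snd.fun_pow d)

theorem analyticAt_div {𝕜 : Type*} [NontriviallyNormedField 𝕜] {f g : 𝕜 × 𝕜 → 𝕜}
    (hf : IsPolynomial₂ f) (hg : IsPolynomial₂ g) {z : 𝕜 × 𝕜} (hz : g z ≠ 0) :
    AnalyticAt 𝕜 (fun z => f z / g z) z :=
  (hf.analyticAt z).fun_div (hg.analyticAt z) hz

end IsPolynomial₂

@[fun_prop]
theorem isPolynomial₂_H (ν lam : ℝ) :
    IsPolynomial₂ fun z : ℝ × ℝ => H ν lam z.1 z.2 := by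
  unfold H
  fun_prop

@[fun_prop]
theorem isPolynomial₂_den (ν lam : ℝ) :
    IsPolynomial₂ fun z : ℝ × ℝ => den ν lam z.1 z.2 := by
  unfold den
  fun_prop

@[fun_prop]
theorem isPolynomial₂_psiPsiNum (ν lam : ℝ) :
    IsPolynomial₂ fun z : ℝ × ℝ => psiPsiNum ν lam z.1 z.2 := by
  unfold psiPsiNum mFactor psiPhiReduced killingPsiReduced
  fun_prop

@[fun_prop]
theorem isPolynomial₂_psiPhiNum (ν lam : ℝ) :
    IsPolynomial₂ fun z : ℝ × ℝ => psiPhiNum ν lam z.1 z.2 := by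
  unfold psiPhiNum psiPhiReduced
  fun_prop

@[fun_prop]
theorem isPolynomial₂_phiPhiNum (ν lam : ℝ) :
    IsPolynomial₂ fun z : ℝ × ℝ => phiPhiNum ν lam z.1 z.2 := by
  unfold phiPhiNum phiPhiReduced
  fun_prop

@[fun_prop]
theorem isPolynomial₂_killingPsiNum (ν lam s : ℝ) :
    IsPolynomial₂ fun z : ℝ × ℝ => killingPsiNum ν lam s z.1 z.2 := by
  unfold killingPsiNum killingPsiReduced psiPhiReduced
  fun_prop

@[fun_prop]
theorem isPolynomial₂_killingPhiNum (ν lam s : ℝ) :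
    IsPolynomial₂ fun z : ℝ × ℝ => killingPhiNum ν lam s z.1 z.2 := by
  unfold killingPhiNum killingPhiReduced phiPhiReduced
  fun_prop

@[fun_prop]
theorem isPolynomial₂_killingKillingNum (ν lam r s : ℝ) :
    IsPolynomial₂ fun z : ℝ × ℝ => killingKillingNum ν lam r s z.1 z.2 := by
  unfold killingKillingNum
  fun_prop

theorem H_one_left (ν lam x : ℝ) :
    H ν lam 1 x = (1 + ν + lam) * (1 + lam - ν + ν * x ^ 2 * (1 - lam - ν)) := by
  unfold H
  ring

theorem H_neg_one_left (ν lam x : ℝ) :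
    H ν lam (-1) x = (1 - lam + ν) * (1 - lam - ν + ν * x ^ 2 * (1 + lam - ν)) := by
  unfold H
  ring

theorem den_ne_zero {ν lam x y : ℝ} (hν : ν ≠ 1) (hxy : x ≠ y) (hH : H ν lam x y ≠ 0) :
    den ν lam x y ≠ 0 :=
  mul_ne_zero (mul_ne_zero (pow_ne_zero 2 (sub_ne_zero.mpr hν.symm))
    (pow_ne_zero 2 (sub_ne_zero.mpr hxy))) hH

theorem eventually_ne_zero_of_analyticOnNhd {f : ℝ → ℝ} (hf : AnalyticOnNhd ℝ f Set.univ) {z : ℝ}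
    (hz : f z ≠ 0) (r : ℝ) : ∀ᶠ y in 𝓝[≠] r, f y ≠ 0 := by
  by_contra h
  have hfreq : ∃ᶠ y in 𝓝[≠] r, f y = 0 := by simpa using h
  exact hz (hf.eqOn_zero_of_preconnected_of_frequently_eq_zero isPreconnected_univ
    (Set.mem_univ r) hfreq (Set.mem_univ z))

namespace FrameCoeffs

/-- Analyticity at a point of all components. -/
structure IsAnalyticAt {E : Type*} [NormedAddCommGroup E] [NormedSpace ℝ E] (c : E → FrameCoeffs)
    (p : E) : Prop where
  KK : AnalyticAt ℝ (fun q => (c q).KK) p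
  Kψ : AnalyticAt ℝ (fun q => (c q).Kψ) p
  Kφ : AnalyticAt ℝ (fun q => (c q).Kφ) p
  ψψ : AnalyticAt ℝ (fun q => (c q).ψψ) p
  ψφ : AnalyticAt ℝ (fun q => (c q).ψφ) p
  φφ : AnalyticAt ℝ (fun q => (c q).φφ) p
  yy : AnalyticAt ℝ (fun q => (c q).yy) p
  xx : AnalyticAt ℝ (fun q => (c q).xx) p

theorem IsAnalyticAt.comp {E E' : Type*} [NormedAddCommGroup E] [NormedSpace ℝ E]
    [NormedAddCommGroup E'] [NormedSpace ℝ E'] {c : E → FrameCoeffs} {f : E' → E} {p : E'}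
    (hc : IsAnalyticAt c (f p)) (hf : AnalyticAt ℝ f p) : IsAnalyticAt (fun q => c (f q)) p where
  KK := hc.KK.fun_comp hf
  Kψ := hc.Kψ.fun_comp hf
  Kφ := hc.Kφ.fun_comp hf
  ψψ := hc.ψψ.fun_comp hf
  ψφ := hc.ψφ.fun_comp hf
  φφ := hc.φφ.fun_comp hf
  yy := hc.yy.fun_comp hf
  xx := hc.xx.fun_comp hf

/-- The factor of `det (c.atHorizon 1 w).toMatrix` that remains after the cancellation of `w`. -/
def reducedDet (c : FrameCoeffs) (w : ℝ) : ℝ :=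
  c.KK * (c.ψψ * c.φφ - c.ψφ ^ 2)
    - w * (c.Kψ ^ 2 * c.φφ - 2 * c.Kψ * c.Kφ * c.ψφ + c.Kφ ^ 2 * c.ψψ)

theorem IsAnalyticAt.reducedDet {E : Type*} [NormedAddCommGroup E] [NormedSpace ℝ E]
    {c : E → FrameCoeffs} {w : E → ℝ} {p : E} (hc : IsAnalyticAt c p) (hw : AnalyticAt ℝ w p) :
    AnalyticAt ℝ (fun q => (c q).reducedDet (w q)) p := by
  obtain ⟨hKK, hKψ, hKφ, hψψ, hψφ, hφφ, -, -⟩ := hc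
  unfold FrameCoeffs.reducedDet
  fun_prop

theorem det_atHorizon_one (c : FrameCoeffs) {w : ℝ} (hw : w ≠ 0) :
    (c.atHorizon 1 w).toMatrix.det = c.yy * c.xx * c.reducedDet w := by
  rw [det_toMatrix]
  simp only [atHorizon, reducedDet]
  field_simp
  ring

end FrameCoeffs

namespace KillingHorizon

variable (h : KillingHorizon)

/-- The points `(x, y)` at which the components of the metric adapted to the horizon are regular.
The horizon `y = r` itself is allowed, and so is `H(y,x) = 0`. -/
def IsRegular (x y : ℝ) : Prop :=
  G h.ν h.lam x ≠ 0 ∧ x ≠ y ∧ y ^ 2 ≠ 1 ∧ y ≠ h.s ∧ H h.ν h.lam x y ≠ 0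

theorem eventually_H_swap_ne (x y : ℝ) : ∀ᶠ z in 𝓝[≠] y, H h.ν h.lam z x ≠ 0 := by
  have hH : AnalyticOnNhd ℝ (fun z => H h.ν h.lam z x) Set.univ := fun z _ => by
    unfold H
    fun_prop
  by_cases h1 : H h.ν h.lam 1 x = 0
  · refine eventually_ne_zero_of_analyticOnNhd hH (z := -1) (fun h2 => ?_) y
    rw [H_one_left] at h1
    rw [H_neg_one_left] at h2
    have h1' := (mul_eq_zero.mp h1).resolve_left h.one_add_ν_add_lam_pos.ne'
    have h2' := (mul_eq_zero.mp h2).resolve_left h.one_sub_lam_add_ν_pos.ne'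
    have hpos : 0 < 1 + h.ν * x ^ 2 := by have := h.ν_pos; positivity
    exact mul_ne_zero h.one_sub_ν_ne hpos.ne' (by linear_combination (h1' + h2') / 2)
  · exact eventually_ne_zero_of_analyticOnNhd hH h1 y

theorem eventually_G_ne (y : ℝ) : ∀ᶠ z in 𝓝[≠] y, G h.ν h.lam z ≠ 0 := by
  refine eventually_ne_zero_of_analyticOnNhd (fun z _ => ?_) (z := 0) (by simp [G]) y
  unfold G
  fun_prop

variable {x y : ℝ}

theorem eventually_mem_domain (hG : G h.ν h.lam x ≠ 0) (hxy : x ≠ y) (hH : H h.ν h.lam x y ≠ 0)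
    (t ψ φ : ℝ) : ∀ᶠ z in 𝓝[≠] y, ![t, z, ψ, φ, x] ∈ domain h.ν h.lam := by
  have hcont : ContinuousAt (fun z => H h.ν h.lam x z) y := by
    unfold H
    fun_prop
  filter_upwards [h.eventually_G_ne y, h.eventually_H_swap_ne x y,
    nhdsWithin_le_nhds (eventually_ne_nhds hxy.symm),
    nhdsWithin_le_nhds (hcont.eventually_ne hH)] with z hGz hH' hxz hHz
  exact ⟨hG, hGz, hxz.symm, hHz, hH'⟩

theorem eq_of_eventually_eq_det (hG : G h.ν h.lam x ≠ 0) (hxy : x ≠ y) (hH : H h.ν h.lam x y ≠ 0)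
    {f : ℝ → ℝ} (hf : ContinuousAt f y) (hdet : ∀ᶠ z in 𝓝[≠] y, ![0, z, 0, 0, x] ∈
      domain h.ν h.lam → f z = (metric h.k h.ν h.lam ![0, z, 0, 0, x]).det) :
    f y = -(16 * h.k ^ 8 * H h.ν h.lam x y ^ 2) / ((1 - h.ν) ^ 6 * (x - y) ^ 8) := by
  have hcont : ContinuousAt (fun z => H h.ν h.lam x z) y := by
    unfold H
    fun_prop
  refine Filter.EventuallyEq.eq_of_nhds (g := fun z =>
      -(16 * h.k ^ 8 * H h.ν h.lam x z ^ 2) / ((1 - h.ν) ^ 6 * (x - z) ^ 8))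
    ((hf.eventuallyEq_nhds_iff_eventuallyEq_nhdsNE ?_).mp ?_)
  · exact ContinuousAt.div (by fun_prop) (by fun_prop) (mul_ne_zero (pow_ne_zero 6 h.one_sub_ν_ne)
      (pow_ne_zero 8 (sub_ne_zero.mpr hxy)))
  · filter_upwards [h.eventually_mem_domain hG hxy hH 0 0 0, hdet] with z hz hfz
    rw [hfz hz, det_metric h.ν_pos.le h.ν_ne hz]
    rfl

variable {h}

theorem IsRegular.den_ne (hxy : h.IsRegular x y) : den h.ν h.lam x y ≠ 0 :=
  den_ne_zero h.ν_ne hxy.2.1 hxy.2.2.2.2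

theorem IsRegular.one_sub_sq_ne (hxy : h.IsRegular x y) : 1 - y ^ 2 ≠ 0 :=
  sub_ne_zero.mpr hxy.2.2.1.symm

theorem isRegular_of_mem_domain {p : Coords} (hp : p ∈ domain h.ν h.lam) :
    h.IsRegular (p 4) (p 1) ∧ p 1 ≠ h.r := by
  obtain ⟨hGx, hGy, hxy, hH, -⟩ := hp
  rw [G, h.quadratic_eq] at hGy
  refine ⟨⟨hGx, hxy, ?_, ?_, hH⟩, ?_⟩ <;> intro h0 <;> simp [h0] at hGy

theorem IsRegular.isAnalyticAt_coeffs (hxy : h.IsRegular x y) :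
    FrameCoeffs.IsAnalyticAt (fun z : ℝ × ℝ => h.coeffs z.1 z.2) (x, y) := by
  have hsub : x - y ≠ 0 := sub_ne_zero.mpr hxy.2.1
  have hν := h.one_sub_ν_ne
  have hden := hxy.den_ne
  have hm := h.m_pos.ne'
  have hlam := h.lam_ne
  have he := h.one_sub_lam_add_ν_pos.ne'
  have he' := h.one_add_ν_add_lam_pos.ne'
  have hconf : AnalyticAt ℝ (fun z : ℝ × ℝ => conf h.k h.ν h.lam z.1 z.2) (x, y) :=
    IsPolynomial₂.analyticAt_div (by fun_prop) (by fun_prop) (by positivity)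
  exact
    { KK := IsPolynomial₂.analyticAt_div (by fun_prop) (by fun_prop) (by positivity)
      Kψ := IsPolynomial₂.analyticAt_div (by fun_prop) (by fun_prop) (by positivity)
      Kφ := IsPolynomial₂.analyticAt_div (by fun_prop) (by fun_prop) (by positivity)
      ψψ := (IsPolynomial₂.analyticAt_div (by fun_prop) (by fun_prop) (by positivity)).fun_neg
      ψφ := (IsPolynomial₂.analyticAt_div (by fun_prop) (by fun_prop) (by positivity)).fun_neg
      φφ := IsPolynomial₂.analyticAt_div (by fun_prop) (by fun_prop) (by positivity)
      yy := (hconf.fun_div (IsPolynomial₂.analyticAt (by fun_prop) _) (mul_ne_zero hxy.one_sub_sq_ne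
        (mul_ne_zero h.ν_pos.ne' (sub_ne_zero.mpr hxy.2.2.2.1)))).fun_neg
      xx := hconf.fun_div (IsPolynomial₂.analyticAt (by unfold G; fun_prop) _) hxy.1 }

theorem IsRegular.det_coeffs (hxy : h.IsRegular x y) :
    (h.coeffs x y).yy * (h.coeffs x y).xx * (h.coeffs x y).reducedDet (y - h.r)
      = -(16 * h.k ^ 8 * H h.ν h.lam x y ^ 2) / ((1 - h.ν) ^ 6 * (x - y) ^ 8) := by
  have hc := hxy.isAnalyticAt_coeffs.comp (f := fun z => (x, z)) (by fun_prop)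
  refine h.eq_of_eventually_eq_det hxy.1 hxy.2.1 hxy.2.2.2.2 (f := fun z => (h.coeffs x z).yy
    * (h.coeffs x z).xx * (h.coeffs x z).reducedDet (z - h.r))
    ((hc.yy.fun_mul hc.xx).fun_mul (hc.reducedDet (by fun_prop))).continuousAt
    (Eventually.of_forall fun z hz => ?_)
  rw [h.det_metric_eq_det_atHorizon hz]
  exact (FrameCoeffs.det_atHorizon_one _ (sub_ne_zero.mpr (isRegular_of_mem_domain hz).2)).symm

end KillingHorizon

namespace KillingHorizon

variable (h : KillingHorizon)

theorem r_ne : h.r ≠ 0 := by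
  intro h0
  simpa [h0] using h.mul_roots

theorem s_eq : h.s = 1 / (h.ν * h.r) := by
  rw [eq_div_iff (mul_ne_zero h.ν_pos.ne' h.r_ne), ← h.mul_roots]
  ring

theorem lam_eq : h.lam = -(h.ν * h.r ^ 2 + 1) / h.r := by
  have hr := h.r_ne
  have hν := h.ν_pos.ne'
  rw [h.add_roots, h.s_eq]
  field_simp

theorem one_sub_lam_add_ν_eq : 1 - h.lam + h.ν = (1 + h.ν * h.r) * (1 + h.r) / h.r := by
  have hr := h.r_ne
  rw [h.lam_eq]
  field_simp
  ring

theorem one_add_ν_add_lam_eq : 1 + h.ν + h.lam = -((1 - h.ν * h.r) * (1 - h.r) / h.r) := by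
  have hr := h.r_ne
  rw [h.lam_eq]
  field_simp
  ring

theorem one_add_mul_r_ne : 1 + h.ν * h.r ≠ 0 := fun h0 =>
  h.one_sub_lam_add_ν_pos.ne' (by simp [h.one_sub_lam_add_ν_eq, h0])

theorem one_add_r_ne : 1 + h.r ≠ 0 := fun h0 =>
  h.one_sub_lam_add_ν_pos.ne' (by simp [h.one_sub_lam_add_ν_eq, h0])

theorem one_sub_mul_r_ne : 1 - h.ν * h.r ≠ 0 := fun h0 =>
  h.one_add_ν_add_lam_pos.ne' (by simp [h.one_add_ν_add_lam_eq, h0])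

theorem one_sub_r_ne : 1 - h.r ≠ 0 := fun h0 =>
  h.one_add_ν_add_lam_pos.ne' (by simp [h.one_add_ν_add_lam_eq, h0])

theorem ν_mul_sub_roots : h.ν * (h.r - h.s) = (h.ν * h.r ^ 2 - 1) / h.r := by
  have hr := h.r_ne
  have hν := h.ν_pos.ne'
  rw [h.s_eq]
  field_simp

theorem ν_mul_r_sq_sub_one_ne (hrs : h.r ≠ h.s) : h.ν * h.r ^ 2 - 1 ≠ 0 := by
  intro h0
  refine mul_ne_zero h.ν_pos.ne' (sub_ne_zero.mpr hrs) ?_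
  rw [h.ν_mul_sub_roots, h0, zero_div]

theorem killingKillingNum_root (x : ℝ) : killingKillingNum h.ν h.lam h.r h.s x h.r
    = -((1 - h.ν) * (h.ν * h.r ^ 2 - 1) * h.r * H h.ν h.lam x h.r ^ 2)
      / ((1 - h.ν * h.r) * (1 + h.ν * h.r) * (h.ν * h.r ^ 2 + 1) ^ 2) := by
  have hr := h.r_ne
  have hν := h.ν_pos
  have hadd := h.one_add_mul_r_ne
  have hsub := h.one_sub_mul_r_ne
  have : 0 < h.ν * h.r ^ 2 + 1 := by positivity
  rw [eq_div_iff (by positivity), h.lam_eq, h.s_eq]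
  unfold killingKillingNum killingPsiNum killingPhiNum killingPsiReduced psiPhiReduced
    killingPhiReduced phiPhiReduced H
  field_simp
  ring

/-- The value of `σ²` for which the metric extends across the horizon: `σ = 1 / (2 κ)`, where `κ`
is the surface gravity of the horizon with respect to `K`. -/
def sigmaSq : ℝ :=
  (2 * h.k * (h.ν * h.r ^ 2 + 1) * (1 - h.ν * h.r)
    / ((1 - h.ν) * (h.ν * h.r ^ 2 - 1) * (1 + h.r))) ^ 2

/-- The numerator of `σ² g(K, K) + (y - r)² g_yy`, up to a factor `y - r`, for `σ² = sigmaSq`. -/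
def radialNum (x y : ℝ) : ℝ :=
  h.sigmaSq * ((1 - h.ν) * (1 - h.lam + h.ν)) * killingKillingNum h.ν h.lam h.r h.s x y
      * ((1 - y ^ 2) * (h.ν * (y - h.s)))
    - 4 * (1 + h.ν + h.lam) * h.k ^ 2 * H h.ν h.lam x y ^ 2

theorem sigmaSq_pos (hrs : h.r ≠ h.s) : 0 < h.sigmaSq := by
  have hν := h.ν_pos
  have hν' := h.one_sub_ν_ne
  have hk := h.k_ne
  have hr := h.one_add_r_ne
  have hsub := h.one_sub_mul_r_ne
  have hslope := h.ν_mul_r_sq_sub_one_ne hrs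
  have : 0 < h.ν * h.r ^ 2 + 1 := by positivity
  unfold sigmaSq
  positivity

theorem radialNum_root (hrs : h.r ≠ h.s) (x : ℝ) : h.radialNum x h.r = 0 := by
  have hν := h.ν_pos
  have hν' := h.one_sub_ν_ne
  have hr := h.r_ne
  have hr' := h.one_add_r_ne
  have hadd := h.one_add_mul_r_ne
  have := h.one_sub_mul_r_ne
  have hslope := h.ν_mul_r_sq_sub_one_ne hrs
  have : h.ν * h.r ^ 2 + 1 ≠ 0 := by positivity
  rw [radialNum, h.killingKillingNum_root, sigmaSq, h.ν_mul_sub_roots, h.one_sub_lam_add_ν_eq,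
    h.one_add_ν_add_lam_eq]
  field_simp
  ring

variable {h} in
theorem IsRegular.sigmaSq_mul_KK_add_yy {x y : ℝ} (hxy : h.IsRegular x y) :
    h.sigmaSq * (h.coeffs x y).KK + (h.coeffs x y).yy = h.radialNum x y
      / (2 * (1 + h.ν + h.lam) * den h.ν h.lam x y * ((1 - y ^ 2) * (h.ν * (y - h.s)))) := by
  have hν' := h.one_sub_ν_ne
  have hep := h.one_add_ν_add_lam_pos.ne'
  have hν := h.ν_pos.ne'
  have hy := hxy.one_sub_sq_ne
  obtain ⟨-, hsub, -, hs, hH⟩ := hxy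
  rw [← sub_ne_zero] at hsub hs
  simp only [coeffs, radialNum, den, conf]
  field_simp
  ring

theorem exists_radialQuotient (hrs : h.r ≠ h.s) : ∃ E : ℝ × ℝ → ℝ, ∀ x y, h.IsRegular x y →
    AnalyticAt ℝ E (x, y) ∧
    h.sigmaSq * (h.coeffs x y).KK + (h.coeffs x y).yy = (y - h.r) * E (x, y) := by
  obtain ⟨q, hq, hradial⟩ := IsPolynomial₂.exists_eq_sub_mul
    (f := fun z => h.radialNum z.1 z.2) (by unfold radialNum; fun_prop) (h.radialNum_root hrs)
  refine ⟨fun z => q z / (2 * (1 + h.ν + h.lam) * den h.ν h.lam z.1 z.2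
    * ((1 - z.2 ^ 2) * (h.ν * (z.2 - h.s)))), fun x y hxy => ⟨?_, ?_⟩⟩
  · refine (hq.analyticAt _).fun_div (IsPolynomial₂.analyticAt (by fun_prop) _) ?_
    exact mul_ne_zero (mul_ne_zero (mul_ne_zero two_ne_zero h.one_add_ν_add_lam_pos.ne')
      hxy.den_ne) (mul_ne_zero hxy.one_sub_sq_ne
        (mul_ne_zero h.ν_pos.ne' (sub_ne_zero.mpr hxy.2.2.2.1)))
  · rw [hxy.sigmaSq_mul_KK_add_yy, show h.radialNum x y = _ from hradial x y, mul_div_assoc]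

variable {h} in
theorem IsRegular.mul_KK_add_yy_eq_zero_iff {x : ℝ} (hx : h.IsRegular x h.r) (σ : ℝ) :
    σ ^ 2 * (h.coeffs x h.r).KK + (h.coeffs x h.r).yy = 0 ↔ σ ^ 2 = h.sigmaSq := by
  have hroot : h.sigmaSq * (h.coeffs x h.r).KK + (h.coeffs x h.r).yy = 0 := by
    rw [hx.sigmaSq_mul_KK_add_yy, h.radialNum_root hx.2.2.2.1, zero_div]
  have hyy : (h.coeffs x h.r).yy ≠ 0 := by
    have hdet := hx.det_coeffs
    intro h0
    rw [h0, zero_mul, zero_mul] at hdet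
    have hk := h.k_ne
    have hν := h.one_sub_ν_ne
    obtain ⟨-, hsub, -, -, hH⟩ := hx
    rw [← sub_ne_zero] at hsub
    refine div_ne_zero (neg_ne_zero.mpr ?_) ?_ hdet.symm <;> positivity
  have hKK : (h.coeffs x h.r).KK ≠ 0 := fun h0 => hyy (by simpa [h0] using hroot)
  constructor
  · intro hσ
    exact mul_right_cancel₀ hKK (by linear_combination hσ - hroot)
  · rintro hσ
    rwa [hσ]

end KillingHorizon

/-- The coordinate `j` as a continuous linear map, in terms of which derivatives are written. -/
abbrev coordProj (j : Fin 5) : Coords →L[ℝ] ℝ := ContinuousLinearMap.proj j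

theorem hasFDerivAt_coord (j : Fin 5) (p : Coords) :
    HasFDerivAt (fun q : Coords => q j) (coordProj j) p := hasFDerivAt_apply j p

theorem analyticAt_coord (j : Fin 5) (p : Coords) : AnalyticAt ℝ (fun q : Coords => q j) p :=
  (coordProj j).analyticAt p

theorem jac_eq_of_hasFDerivAt {Φ : Coords → Coords} {p : Coords} {A : Mat5}
    (hΦ : ∀ i, HasFDerivAt (fun q => Φ q i) (∑ j, A i j • coordProj j) p) : jac Φ p = A := by
  have hderiv : HasFDerivAt Φ (ContinuousLinearMap.pi fun i => ∑ j, A i j • coordProj j) p :=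
    hasFDerivAt_pi.2 hΦ
  unfold jac
  rw [hderiv.fderiv]
  ext i j
  simp [LinearMap.toMatrix'_apply, Pi.single_apply]

theorem newComponents_eq {Φ : Coords → Coords} {g : Coords → Mat5} {p : Coords}
    {U U' S S' A : Mat5} (hjac : jac Φ p = U * S) (hU : U * U' = 1) (hS : S * S' = 1)
    (hg : g p = Sᵀ * A * S) : newComponents Φ g p = U'ᵀ * A * U' := by
  have hinv : (jac Φ p)⁻¹ = S' * U' := by
    refine Matrix.inv_eq_right_inv ?_
    rw [hjac, Matrix.mul_assoc, ← Matrix.mul_assoc S, hS, Matrix.one_mul, hU]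
  have hcancel : S * (S' * U') = U' := by rw [← Matrix.mul_assoc, hS, Matrix.one_mul]
  rw [newComponents, hinv, hg]
  calc (S' * U')ᵀ * (Sᵀ * A * S) * (S' * U')
      = (S * (S' * U'))ᵀ * A * (S * (S' * U')) := by
        rw [Matrix.transpose_mul S]
        simp only [Matrix.mul_assoc]
    _ = U'ᵀ * A * U' := by rw [hcancel]

theorem hasFDerivAt_log_sub {p : Coords} {r : ℝ} (hp : p 1 ≠ r) :
    HasFDerivAt (fun q : Coords => Real.log (q 1 - r)) ((1 / (p 1 - r)) • coordProj 1) p := by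
  rw [one_div]
  exact ((hasFDerivAt_coord 1 p).sub_const r).log (sub_ne_zero.mpr hp)

theorem hasFDerivAt_div_sub (c : ℝ) {p : Coords} {r : ℝ} (hp : p 1 ≠ r) :
    HasFDerivAt (fun q : Coords => c / (q 1 - r)) (-(c / (p 1 - r) ^ 2) • coordProj 1) p := by
  refine (((hasDerivAt_inv (sub_ne_zero.mpr hp)).comp_hasFDerivAt p
    ((hasFDerivAt_coord 1 p).sub_const r)).const_mul c).congr_fderiv ?_
  ext v
  simp
  ring

theorem eventually_sign_sub_eq {p : Coords} {r : ℝ} (hp : p 1 ≠ r) :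
    ∀ᶠ q : Coords in 𝓝 p, Real.sign (q 1 - r) = Real.sign (p 1 - r) := by
  have hc : ContinuousAt (fun q : Coords => q 1 - r) p :=
    (analyticAt_coord 1 p).continuousAt.sub_const r
  rcases lt_or_gt_of_ne (sub_ne_zero.mpr hp) with hneg | hpos
  · filter_upwards [hc.eventually_lt_const hneg] with q hq
    rw [Real.sign_of_neg hneg, Real.sign_of_neg hq]
  · filter_upwards [hc.eventually_const_lt hpos] with q hq
    rw [Real.sign_of_pos hpos, Real.sign_of_pos hq]

/-- The Jacobian of `(t, y, ψ̂, φ̂, x) ↦ (u, v, ψ̂, φ̂, x)` at `y = r + w`. -/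
def uvMat (σ w : ℝ) : Mat5 :=
  !![1, σ / w, 0, 0, 0;
     1, -(σ / w), 0, 0, 0;
     0, 0, 1, 0, 0;
     0, 0, 0, 1, 0;
     0, 0, 0, 0, 1]

/-- The inverse of `uvMat`. -/
def uvMatInv (σ w : ℝ) : Mat5 :=
  !![1 / 2, 1 / 2, 0, 0, 0;
     w / (2 * σ), -(w / (2 * σ)), 0, 0, 0;
     0, 0, 1, 0, 0;
     0, 0, 0, 1, 0;
     0, 0, 0, 0, 1]

theorem uvMat_mul_uvMatInv {σ w : ℝ} (hσ : σ ≠ 0) (hw : w ≠ 0) :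
    uvMat σ w * uvMatInv σ w = 1 := by
  ext i j
  fin_cases i <;> fin_cases j <;> simp [uvMat, uvMatInv, Matrix.mul_apply, Fin.sum_univ_five] <;>
    field_simp <;> norm_num

/-- The Jacobian of `(t, y, ψ̂, φ̂, x) ↦ (û, v̂, ψ̂, φ̂, x)` at `û = u`, `v̂ = v`, `y = r + w`. -/
def ksMat (γ w u v : ℝ) : Mat5 :=
  !![γ * u, u / (2 * w), 0, 0, 0;
     -(γ * v), v / (2 * w), 0, 0, 0;
     0, 0, 1, 0, 0;
     0, 0, 0, 1, 0;
     0, 0, 0, 0, 1]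

/-- The Jacobian of `(t, y, ψ̂, φ̂, x) ↦ (v, z, Ψ, Φ, x)` at `y = r + w`. -/
def degMat (a₀ a₁ bψ bφ w : ℝ) : Mat5 :=
  !![1, -(a₀ / w ^ 2 + a₁ / w), 0, 0, 0;
     0, 1, 0, 0, 0;
     0, -(bψ / w), 1, 0, 0;
     0, -(bφ / w), 0, 1, 0;
     0, 0, 0, 0, 1]

theorem degMat_mul_degMat_neg (a₀ a₁ bψ bφ w : ℝ) :
    degMat a₀ a₁ bψ bφ w * degMat (-a₀) (-a₁) (-bψ) (-bφ) w = 1 := by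
  ext i j
  fin_cases i <;> fin_cases j <;> simp [degMat, Matrix.mul_apply, Fin.sum_univ_five] <;> ring

theorem jac_uvChart (σ a b : ℝ) {r : ℝ} {p : Coords} (hp : p 1 ≠ r) :
    jac (uvChart σ a b r) p = uvMat σ (p 1 - r) * shiftMat a b := by
  have ht := hasFDerivAt_coord 0 p
  have hlog := (hasFDerivAt_log_sub hp).const_mul σ
  refine jac_eq_of_hasFDerivAt (Fin.forall_fin_succ.mpr ⟨?_, Fin.forall_fin_succ.mpr ⟨?_,
    Fin.forall_fin_succ.mpr ⟨?_, Fin.forall_fin_two.mpr ⟨?_, ?_⟩⟩⟩⟩)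
  · refine (ht.add hlog).congr_fderiv ?_
    ext v
    simp [uvMat, shiftMat, Matrix.mul_apply, Fin.sum_univ_five]
    ring
  · refine (ht.sub hlog).congr_fderiv ?_
    ext v
    simp [uvMat, shiftMat, Matrix.mul_apply, Fin.sum_univ_five]
    ring
  · refine ((hasFDerivAt_coord 2 p).sub (ht.const_mul a)).congr_fderiv ?_
    ext v
    simp [uvMat, shiftMat, Matrix.mul_apply, Fin.sum_univ_five]
    ring
  · refine ((hasFDerivAt_coord 3 p).sub (ht.const_mul b)).congr_fderiv ?_
    ext v
    simp [uvMat, shiftMat, Matrix.mul_apply, Fin.sum_univ_five]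
    ring
  · refine (hasFDerivAt_coord 4 p).congr_fderiv ?_
    ext v
    simp [uvMat, shiftMat, Matrix.mul_apply, Fin.sum_univ_five]

theorem jac_ksChart (ε : ℝ) {σ : ℝ} (hσ : σ ≠ 0) (a b : ℝ) {r : ℝ} {p : Coords} (hp : p 1 ≠ r) :
    jac (ksChart ε σ a b r) p = ksMat (1 / (2 * σ)) (p 1 - r) (ksChart ε σ a b r p 0)
      (ksChart ε σ a b r p 1) * shiftMat a b := by
  have ht := hasFDerivAt_coord 0 p
  have hlog := (hasFDerivAt_log_sub hp).const_mul σ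
  have hw : p 1 - r ≠ 0 := sub_ne_zero.mpr hp
  refine jac_eq_of_hasFDerivAt (Fin.forall_fin_succ.mpr ⟨?_, Fin.forall_fin_succ.mpr ⟨?_,
    Fin.forall_fin_succ.mpr ⟨?_, Fin.forall_fin_two.mpr ⟨?_, ?_⟩⟩⟩⟩)
  · refine (((ht.add hlog).const_mul (1 / (2 * σ))).exp.const_mul ε).congr_fderiv ?_
    ext v
    simp [ksMat, shiftMat, ksChart, uvChart, Matrix.mul_apply, Fin.sum_univ_five]
    field_simp
  · have hexp := ((ht.sub hlog).const_mul (-(1 / (2 * σ)))).exp.const_mul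
      (ε * Real.sign (p 1 - r))
    refine (hexp.congr_of_eventuallyEq ?_).congr_fderiv ?_
    · filter_upwards [eventually_sign_sub_eq hp] with q hq
      simp [ksChart, uvChart, hq]
    · ext v
      simp [ksMat, shiftMat, ksChart, uvChart, Matrix.mul_apply, Fin.sum_univ_five]
      field_simp
      ring
  · refine ((hasFDerivAt_coord 2 p).sub (ht.const_mul a)).congr_fderiv ?_
    ext v
    simp [ksMat, shiftMat, Matrix.mul_apply, Fin.sum_univ_five]
    ring
  · refine ((hasFDerivAt_coord 3 p).sub (ht.const_mul b)).congr_fderiv ?_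
    ext v
    simp [ksMat, shiftMat, Matrix.mul_apply, Fin.sum_univ_five]
    ring
  · refine (hasFDerivAt_coord 4 p).congr_fderiv ?_
    ext v
    simp [ksMat, shiftMat, Matrix.mul_apply, Fin.sum_univ_five]

theorem jac_degChart (k ν a₀ a₁ bψ bφ : ℝ) {p : Coords} (hp : p 1 ≠ y0 ν) :
    jac (degChart k ν a₀ a₁ bψ bφ) p
      = degMat a₀ a₁ bψ bφ (p 1 - y0 ν) * shiftMat (aPsi k ν) (aPhi k ν) := by
  have ht := hasFDerivAt_coord 0 p
  have hlog := hasFDerivAt_log_sub hp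
  refine jac_eq_of_hasFDerivAt (Fin.forall_fin_succ.mpr ⟨?_, Fin.forall_fin_succ.mpr ⟨?_,
    Fin.forall_fin_succ.mpr ⟨?_, Fin.forall_fin_two.mpr ⟨?_, ?_⟩⟩⟩⟩)
  · refine ((ht.add (hasFDerivAt_div_sub a₀ hp)).sub (hlog.const_mul a₁)).congr_fderiv ?_
    ext v
    simp [degMat, shiftMat, Matrix.mul_apply, Fin.sum_univ_five]
    ring
  · refine (hasFDerivAt_coord 1 p).congr_fderiv ?_
    ext v
    simp [degMat, shiftMat, Matrix.mul_apply, Fin.sum_univ_five]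
  · refine (((hasFDerivAt_coord 2 p).sub (ht.const_mul _)).sub
      (hlog.const_mul bψ)).congr_fderiv ?_
    ext v
    simp [degMat, shiftMat, Matrix.mul_apply, Fin.sum_univ_five]
    ring
  · refine (((hasFDerivAt_coord 3 p).sub (ht.const_mul _)).sub
      (hlog.const_mul bφ)).congr_fderiv ?_
    ext v
    simp [degMat, shiftMat, Matrix.mul_apply, Fin.sum_univ_five]
    ring
  · refine (hasFDerivAt_coord 4 p).congr_fderiv ?_
    ext v
    simp [degMat, shiftMat, Matrix.mul_apply, Fin.sum_univ_five]

theorem eq_zero_of_isBigO_sub {f : ℝ → ℝ} {r : ℝ} (hf : ContinuousAt f r)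
    (hO : f =O[𝓝[≠] r] fun y => y - r) : f r = 0 := by
  have hlim : Tendsto (fun y : ℝ => y - r) (𝓝[≠] r) (𝓝 0) :=
    tendsto_nhdsWithin_of_tendsto_nhds (tendsto_sub_nhds_zero_iff.mpr tendsto_id)
  exact tendsto_nhds_unique (hf.tendsto.mono_left nhdsWithin_le_nhds) (hO.trans_tendsto hlim)

theorem isBigO_sub_mul_sq_iff {f : ℝ → ℝ} {r : ℝ} (hf : DifferentiableAt ℝ f r) :
    (fun y => (y - r) * f y) =O[𝓝[≠] r] (fun y => (y - r) ^ 2) ↔ f r = 0 := by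
  have hcancel : (fun y => (y - r) * f y) =O[𝓝[≠] r] (fun y => (y - r) ^ 2)
      ↔ f =O[𝓝[≠] r] (fun y => y - r) := by
    refine isBigO_iff_isBigOWith.trans (Iff.trans ?_ isBigO_iff_isBigOWith.symm)
    simp only [isBigOWith_iff]
    refine exists_congr fun C => eventually_congr ?_
    filter_upwards [self_mem_nhdsWithin] with y hy
    have hpos : 0 < ‖y - r‖ := norm_pos_iff.mpr (sub_ne_zero.mpr hy)
    rw [sq, norm_mul, norm_mul, mul_left_comm, mul_le_mul_iff_right₀ hpos]
  rw [hcancel]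
  refine ⟨eq_zero_of_isBigO_sub hf.continuousAt, fun h0 => ?_⟩
  simpa [h0] using hf.isBigO_sub.mono nhdsWithin_le_nhds

/-- The components of the metric in the coordinates `(u, v, ψ̂, φ̂, x)`. -/
def FrameCoeffs.uvMatrix (c : FrameCoeffs) (σ w : ℝ) : Mat5 :=
  let p := w * ((σ ^ 2 * c.KK + c.yy) / (4 * σ ^ 2))
  let q := w * ((σ ^ 2 * c.KK - c.yy) / (4 * σ ^ 2))
  !![p, q, w * c.Kψ / 2, w * c.Kφ / 2, 0;
     q, p, w * c.Kψ / 2, w * c.Kφ / 2, 0;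
     w * c.Kψ / 2, w * c.Kψ / 2, c.ψψ, c.ψφ, 0;
     w * c.Kφ / 2, w * c.Kφ / 2, c.ψφ, c.φφ, 0;
     0, 0, 0, 0, c.xx]

theorem FrameCoeffs.uvMatrix_eq (c : FrameCoeffs) {σ w : ℝ} (hσ : σ ≠ 0) (hw : w ≠ 0) :
    (uvMatInv σ w)ᵀ * (c.atHorizon 1 w).toMatrix * uvMatInv σ w = c.uvMatrix σ w := by
  ext i j
  fin_cases i <;> fin_cases j <;>
    simp [uvMatInv, toMatrix, atHorizon, uvMatrix, Matrix.mul_apply, Fin.sum_univ_five] <;>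
    field_simp <;> ring

namespace KillingHorizon

variable (h : KillingHorizon)

theorem isRegular_horizon (hrs : h.r ≠ h.s) {x : ℝ} (hG : G h.ν h.lam x ≠ 0) (hx : x ≠ h.r)
    (hH : H h.ν h.lam x h.r ≠ 0) : h.IsRegular x h.r := by
  refine ⟨hG, hx, fun hr => ?_, hrs, hH⟩
  exact mul_ne_zero h.one_add_r_ne h.one_sub_r_ne (by linear_combination -hr)

variable {h} {x : ℝ}

theorem IsRegular.eventually_newComponents_uvChart (hx : h.IsRegular x h.r) {σ : ℝ} (hσ : σ ≠ 0)
    (t ψ φ : ℝ) : ∀ᶠ y in 𝓝[≠] h.r,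
      newComponents (uvChart σ h.a h.b h.r) (metric h.k h.ν h.lam) ![t, y, ψ, φ, x]
        = (h.coeffs x y).uvMatrix σ (y - h.r) := by
  filter_upwards [h.eventually_mem_domain hx.1 hx.2.1 hx.2.2.2.2 t ψ φ,
    self_mem_nhdsWithin] with y hy hyr
  have hw : y - h.r ≠ 0 := sub_ne_zero.mpr hyr
  rw [newComponents_eq (jac_uvChart (p := ![t, y, ψ, φ, x]) σ h.a h.b hyr)
    (uvMat_mul_uvMatInv hσ hw) (shiftMat_mul_shiftMat_neg h.a h.b) (h.metric_eq_atHorizon hy)]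
  exact FrameCoeffs.uvMatrix_eq _ hσ hw

theorem IsRegular.tendsto_newComponents_uvChart (hx : h.IsRegular x h.r) {σ : ℝ} (hσ : σ ≠ 0)
    (t ψ φ : ℝ) {i j : Fin 5} (hi : i ∈ ({0, 1} : Set (Fin 5)))
    (hj : j ∈ ({0, 1, 2, 3} : Set (Fin 5))) :
    Tendsto (fun y => newComponents (uvChart σ h.a h.b h.r) (metric h.k h.ν h.lam)
      ![t, y, ψ, φ, x] i j) (𝓝[≠] h.r) (𝓝 0) := by
  obtain ⟨hKK, hKψ, hKφ, -, -, -, hyy, -⟩ :=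
    hx.isAnalyticAt_coeffs.comp (f := fun y => (x, y)) (by fun_prop)
  have hcont : ContinuousAt (fun y => (h.coeffs x y).uvMatrix σ (y - h.r) i j) h.r := by
    have hKK := hKK.continuousAt
    have hKψ := hKψ.continuousAt
    have hKφ := hKφ.continuousAt
    have hyy := hyy.continuousAt
    rcases hi with rfl | rfl <;> rcases hj with rfl | rfl | rfl | rfl <;>
      · simp only [FrameCoeffs.uvMatrix, Matrix.of_apply, Matrix.cons_val', Matrix.cons_val_zero,
          Matrix.cons_val_one, Matrix.cons_val, Matrix.cons_val_fin_one]
        fun_prop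
  have hzero : (h.coeffs x h.r).uvMatrix σ (h.r - h.r) i j = 0 := by
    rcases hi with rfl | rfl <;> rcases hj with rfl | rfl | rfl | rfl <;>
      simp [FrameCoeffs.uvMatrix]
  refine (tendsto_nhdsWithin_of_tendsto_nhds (hzero ▸ hcont.tendsto)).congr' ?_
  filter_upwards [hx.eventually_newComponents_uvChart hσ t ψ φ] with y hy
  rw [hy]

theorem IsRegular.newComponents_uvChart_isBigO_sq_iff (hx : h.IsRegular x h.r) {σ : ℝ}
    (hσ : σ ≠ 0) (t ψ φ : ℝ) :
    (fun y => newComponents (uvChart σ h.a h.b h.r) (metric h.k h.ν h.lam) ![t, y, ψ, φ, x] 0 0)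
      =O[𝓝[≠] h.r] (fun y => (y - h.r) ^ 2) ↔ σ ^ 2 = h.sigmaSq := by
  obtain ⟨hKK, -, -, -, -, -, hyy, -⟩ :=
    hx.isAnalyticAt_coeffs.comp (f := fun y => (x, y)) (by fun_prop)
  have hcongr : (fun y => newComponents (uvChart σ h.a h.b h.r) (metric h.k h.ν h.lam)
      ![t, y, ψ, φ, x] 0 0) =ᶠ[𝓝[≠] h.r] fun y => (y - h.r)
        * ((σ ^ 2 * (h.coeffs x y).KK + (h.coeffs x y).yy) / (4 * σ ^ 2)) := by
    filter_upwards [hx.eventually_newComponents_uvChart hσ t ψ φ] with y hy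
    rw [hy]
    rfl
  have hdiff : DifferentiableAt ℝ (fun y => (σ ^ 2 * (h.coeffs x y).KK + (h.coeffs x y).yy)
      / (4 * σ ^ 2)) h.r := by
    have hKK := hKK.differentiableAt
    have hyy := hyy.differentiableAt
    fun_prop
  rw [isBigO_congr hcongr (EventuallyEq.refl _ _), isBigO_sub_mul_sq_iff hdiff, div_eq_zero_iff,
    or_iff_left (by positivity), hx.mul_KK_add_yy_eq_zero_iff]

end KillingHorizon

/-- The components of the extended metric in the coordinates `(û, v̂, ψ̂, φ̂, x)` at `û = u` and
`v̂ = v`, where `E` stands for the quotient `(σ² g_KK + g_yy) / (u v)` of the rescaled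
components. -/
def FrameCoeffs.ksMatrix (c : FrameCoeffs) (σ E u v : ℝ) : Mat5 :=
  !![v ^ 2 * E, c.yy - σ ^ 2 * c.KK, σ * v * c.Kψ, σ * v * c.Kφ, 0;
     c.yy - σ ^ 2 * c.KK, u ^ 2 * E, -(σ * u * c.Kψ), -(σ * u * c.Kφ), 0;
     σ * v * c.Kψ, -(σ * u * c.Kψ), c.ψψ, c.ψφ, 0;
     σ * v * c.Kφ, -(σ * u * c.Kφ), c.ψφ, c.φφ, 0;
     0, 0, 0, 0, c.xx]

theorem FrameCoeffs.ksMatrix_isSymm (c : FrameCoeffs) (σ E u v : ℝ) :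
    (c.ksMatrix σ E u v).IsSymm := by
  ext i j
  fin_cases i <;> fin_cases j <;> rfl

theorem FrameCoeffs.IsAnalyticAt.ksMatrix {V : Type*} [NormedAddCommGroup V] [NormedSpace ℝ V]
    {c : V → FrameCoeffs} {E u v : V → ℝ} {p : V} (hc : IsAnalyticAt c p) (σ : ℝ)
    (hE : AnalyticAt ℝ E p) (hu : AnalyticAt ℝ u p) (hv : AnalyticAt ℝ v p) (i j : Fin 5) :
    AnalyticAt ℝ (fun q => (c q).ksMatrix σ (E q) (u q) (v q) i j) p := by
  obtain ⟨hKK, hKψ, hKφ, hψψ, hψφ, hφφ, hyy, hxx⟩ := hc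
  fin_cases i <;> fin_cases j <;>
    simp only [FrameCoeffs.ksMatrix, Fin.zero_eta, Fin.mk_one, Fin.reduceFinMk, Matrix.of_apply,
      Matrix.cons_val', Matrix.cons_val_zero, Matrix.cons_val_one, Matrix.cons_val,
      Matrix.cons_val_fin_one] <;> fun_prop

theorem FrameCoeffs.det_ksMatrix (c : FrameCoeffs) {σ E u v : ℝ}
    (hE : σ ^ 2 * c.KK + c.yy = u * v * E) :
    (c.ksMatrix σ E u v).det = 4 * σ ^ 2 * (c.yy * c.xx * c.reducedDet (u * v)) := by
  have hexpand : (c.ksMatrix σ E u v).det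
      = c.xx * ((c.ψψ * c.φφ - c.ψφ ^ 2) * ((u * v * E) ^ 2 - (c.yy - σ ^ 2 * c.KK) ^ 2)
        - 2 * (u * v) * σ ^ 2 * (u * v * E + c.yy - σ ^ 2 * c.KK)
          * (c.Kψ ^ 2 * c.φφ - 2 * c.Kψ * c.Kφ * c.ψφ + c.Kφ ^ 2 * c.ψψ)) := by
    simp [ksMatrix, Matrix.det_succ_row_zero, Fin.sum_univ_succ, Fin.succAbove]
    ring
  rw [hexpand, ← hE, reducedDet]
  ring

theorem FrameCoeffs.ksMatrix_pullback (c : FrameCoeffs) {σ E u v : ℝ} (hσ : σ ≠ 0)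
    (huv : u * v ≠ 0) (hE : σ ^ 2 * c.KK + c.yy = u * v * E) :
    (ksMat (1 / (2 * σ)) (u * v) u v)ᵀ * c.ksMatrix σ E u v * ksMat (1 / (2 * σ)) (u * v) u v
      = (c.atHorizon 1 (u * v)).toMatrix := by
  obtain ⟨hu, hv⟩ := mul_ne_zero_iff.mp huv
  obtain rfl : E = (σ ^ 2 * c.KK + c.yy) / (u * v) := by rw [hE, mul_div_cancel_left₀ _ huv]
  ext i j
  fin_cases i <;> fin_cases j <;>
    simp [ksMat, ksMatrix, toMatrix, atHorizon, Matrix.mul_apply, Fin.sum_univ_five] <;>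
    field_simp <;> ring

theorem analyticAt_log_of_ne_zero {V : Type*} [NormedAddCommGroup V] [NormedSpace ℝ V] {f : V → ℝ}
    {p : V} (hf : AnalyticAt ℝ f p) (hp : f p ≠ 0) :
    AnalyticAt ℝ (fun q => Real.log (f q)) p := by
  rcases lt_or_gt_of_ne hp with hneg | hpos
  · simpa only [Real.log_neg_eq_log] using
      (analyticAt_log (neg_pos.mpr hneg)).fun_comp (f := fun q => -f q) hf.fun_neg
  · exact (analyticAt_log hpos).fun_comp hf

section ksChart

variable {ε σ a b r : ℝ} {p : Coords}

theorem ksChart_zero_mul_ksChart_one (hε : ε ^ 2 = 1) (hσ : σ ≠ 0) (hp : p 1 ≠ r) :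
    ksChart ε σ a b r p 0 * ksChart ε σ a b r p 1 = p 1 - r := by
  have hw : p 1 - r ≠ 0 := sub_ne_zero.mpr hp
  have hexp : Real.exp (1 / (2 * σ) * (p 0 + σ * Real.log (p 1 - r)))
      * Real.exp (-(1 / (2 * σ)) * (p 0 - σ * Real.log (p 1 - r))) = |p 1 - r| := by
    rw [← Real.exp_add, ← Real.exp_log_eq_abs hw]
    congr 1
    field_simp
    ring
  have hsign : Real.sign (p 1 - r) * |p 1 - r| = p 1 - r := by
    rcases lt_or_gt_of_ne hw with hneg | hpos
    · rw [Real.sign_of_neg hneg, abs_of_neg hneg, neg_one_mul, neg_neg]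
    · rw [Real.sign_of_pos hpos, abs_of_pos hpos, one_mul]
  calc ksChart ε σ a b r p 0 * ksChart ε σ a b r p 1
      = ε ^ 2 * (Real.sign (p 1 - r)
        * (Real.exp (1 / (2 * σ) * (p 0 + σ * Real.log (p 1 - r)))
          * Real.exp (-(1 / (2 * σ)) * (p 0 - σ * Real.log (p 1 - r))))) := by
        simp only [ksChart, uvChart, Matrix.cons_val_zero, Matrix.cons_val_one]
        ring
    _ = p 1 - r := by rw [hexp, hε, one_mul, hsign]

theorem ksY_ksChart (hε : ε ^ 2 = 1) (hσ : σ ≠ 0) (hp : p 1 ≠ r) :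
    ksY r (ksChart ε σ a b r p) = p 1 := by
  rw [ksY, ksChart_zero_mul_ksChart_one hε hσ hp, add_sub_cancel]

theorem analyticAt_ksChart (ε σ a b : ℝ) (hp : p 1 ≠ r) :
    AnalyticAt ℝ (ksChart ε σ a b r) p := by
  have ht := analyticAt_coord 0 p
  have hψ := analyticAt_coord 2 p
  have hφ := analyticAt_coord 3 p
  have hlog : AnalyticAt ℝ (fun q : Coords => Real.log (q 1 - r)) p :=
    analyticAt_log_of_ne_zero ((analyticAt_coord 1 p).fun_sub analyticAt_const)
      (sub_ne_zero.mpr hp)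
  have hv : AnalyticAt ℝ (fun q : Coords => ε * Real.sign (p 1 - r)
      * Real.exp (-(1 / (2 * σ)) * (q 0 - σ * Real.log (q 1 - r)))) p :=
    analyticAt_const.fun_mul
      (analyticAt_const.fun_mul (ht.fun_sub (analyticAt_const.fun_mul hlog))).rexp'
  refine AnalyticAt.pi (Fin.forall_fin_succ.mpr ⟨?_, Fin.forall_fin_succ.mpr ⟨?_,
    Fin.forall_fin_succ.mpr ⟨?_, Fin.forall_fin_two.mpr ⟨?_, analyticAt_coord 4 p⟩⟩⟩⟩)
  · exact analyticAt_const.fun_mul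
      (analyticAt_const.fun_mul (ht.fun_add (analyticAt_const.fun_mul hlog))).rexp'
  · refine hv.congr ?_
    filter_upwards [eventually_sign_sub_eq hp] with q hq
    simp [ksChart, uvChart, hq]
  · exact hψ.fun_sub (analyticAt_const.fun_mul ht)
  · exact hφ.fun_sub (analyticAt_const.fun_mul ht)

theorem injOn_ksChart (hε : ε ^ 2 = 1) (hσ : σ ≠ 0) :
    Set.InjOn (ksChart ε σ a b r) {p | p 1 ≠ r} := by
  intro p hp q hq hpq
  have hε0 : ε ≠ 0 := by
    rintro rfl
    norm_num at hε
  have hy : p 1 = q 1 := by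
    rw [← ksY_ksChart (a := a) (b := b) hε hσ hp, hpq, ksY_ksChart hε hσ hq]
  have ht : p 0 = q 0 := by
    have hu := congrFun hpq 0
    simp only [ksChart, uvChart, Matrix.cons_val_zero] at hu
    have hexponent := mul_left_cancel₀ (by positivity)
      (Real.exp_injective (mul_left_cancel₀ hε0 hu))
    rw [hy] at hexponent
    exact add_right_cancel hexponent
  have hψ : p 2 - a * p 0 = q 2 - a * q 0 := congrFun hpq 2
  have hφ : p 3 - b * p 0 = q 3 - b * q 0 := congrFun hpq 3
  rw [ht, sub_left_inj] at hψ hφ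
  ext i
  fin_cases i
  exacts [ht, hy, hψ, hφ, congrFun hpq 4]

end ksChart

namespace KillingHorizon

variable (h : KillingHorizon)

theorem isOpen_isRegular : IsOpen {z : ℝ × ℝ | h.IsRegular z.1 z.2} := by
  have hG : Continuous fun z : ℝ × ℝ => G h.ν h.lam z.1 := by
    unfold G
    fun_prop
  have hH : Continuous fun z : ℝ × ℝ => H h.ν h.lam z.1 z.2 := by
    unfold H
    fun_prop
  exact (isOpen_ne_fun hG continuous_const).inter
    ((isOpen_ne_fun continuous_fst continuous_snd).inter
      ((isOpen_ne_fun (continuous_snd.pow 2) continuous_const).inter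
        ((isOpen_ne_fun continuous_snd continuous_const).inter
          (isOpen_ne_fun hH continuous_const))))

/-- The region of the coordinates `(û, v̂, ψ̂, φ̂, x)` covered by the extension across `y = r`. -/
def ksRegion : Set Coords := {p | h.IsRegular (p 4) (ksY h.r p)}

/-- The extended metric in the coordinates `(û, v̂, ψ̂, φ̂, x)`. Here `E` is to be the quotient
`(σ² g_KK + g_yy) / (y - r)` of the rescaled components, as a function of `(x, y)`. -/
def ksExtension (E : ℝ × ℝ → ℝ) (σ : ℝ) (p : Coords) : Mat5 :=
  (h.coeffs (p 4) (ksY h.r p)).ksMatrix σ (E (p 4, ksY h.r p)) (p 0) (p 1)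

theorem isOpen_ksRegion : IsOpen h.ksRegion := by
  refine h.isOpen_isRegular.preimage (f := fun p : Coords => (p 4, ksY h.r p)) ?_
  unfold ksY
  fun_prop

variable {h} {σ : ℝ} {E : ℝ × ℝ → ℝ}

theorem det_ksExtension
    (hE : ∀ x y, h.IsRegular x y →
      σ ^ 2 * (h.coeffs x y).KK + (h.coeffs x y).yy = (y - h.r) * E (x, y))
    {p : Coords} (hp : p ∈ h.ksRegion) :
    (h.ksExtension E σ p).det = -(64 * h.k ^ 8 * σ ^ 2 * H h.ν h.lam (p 4) (ksY h.r p) ^ 2)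
      / ((1 - h.ν) ^ 6 * (p 4 - ksY h.r p) ^ 8) := by
  have huv : p 0 * p 1 = ksY h.r p - h.r := (add_sub_cancel_left _ _).symm
  rw [ksExtension, FrameCoeffs.det_ksMatrix _ (by rw [hE _ _ hp, huv]), huv,
    IsRegular.det_coeffs hp]
  ring

theorem isAnalyticMetricOn_ksExtension (hσ : σ ≠ 0)
    (hE : ∀ x y, h.IsRegular x y → AnalyticAt ℝ E (x, y) ∧
      σ ^ 2 * (h.coeffs x y).KK + (h.coeffs x y).yy = (y - h.r) * E (x, y)) :
    IsAnalyticMetricOn (h.ksExtension E σ) h.ksRegion where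
  isOpen := h.isOpen_ksRegion
  analytic i j p hp := by
    have hu := analyticAt_coord 0 p
    have hv := analyticAt_coord 1 p
    have hxy : AnalyticAt ℝ (fun q : Coords => (q 4, ksY h.r q)) p :=
      (analyticAt_coord 4 p).prod (analyticAt_const.fun_add (hu.fun_mul hv))
    exact (FrameCoeffs.IsAnalyticAt.comp (f := fun q : Coords => (q 4, ksY h.r q))
      (IsRegular.isAnalyticAt_coeffs hp) hxy).ksMatrix σ
      (AnalyticAt.fun_comp (g := E) (f := fun q : Coords => (q 4, ksY h.r q)) (hE _ _ hp).1 hxy)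
      hu hv i j
  symm p _ := FrameCoeffs.ksMatrix_isSymm _ _ _ _ _
  nondegenerate p hp := by
    rw [det_ksExtension (fun x y hxy => (hE x y hxy).2) hp]
    obtain ⟨-, hxy, -, -, hH⟩ := hp
    have hk := h.k_ne
    have hν := h.one_sub_ν_ne
    have := sub_ne_zero.mpr hxy
    exact div_ne_zero (neg_ne_zero.mpr (by positivity)) (by positivity)

theorem isIsometricEmbeddingOn_ksChart (hσ : σ ≠ 0)
    (hE : ∀ x y, h.IsRegular x y →
      σ ^ 2 * (h.coeffs x y).KK + (h.coeffs x y).yy = (y - h.r) * E (x, y))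
    {ε : ℝ} (hε : ε ^ 2 = 1) :
    IsIsometricEmbeddingOn (ksChart ε σ h.a h.b h.r) (domain h.ν h.lam) (metric h.k h.ν h.lam)
      h.ksRegion (h.ksExtension E σ) where
  analytic p hp := analyticAt_ksChart ε σ h.a h.b (h.isRegular_of_mem_domain hp).2
  injOn := (injOn_ksChart hε hσ).mono fun p hp => (h.isRegular_of_mem_domain hp).2
  mapsTo p hp := by
    obtain ⟨hreg, hr⟩ := h.isRegular_of_mem_domain hp
    change h.IsRegular (p 4) (ksY h.r _)
    rwa [ksY_ksChart hε hσ hr]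
  pullback p hp := by
    obtain ⟨hreg, hr⟩ := h.isRegular_of_mem_domain hp
    have huv := ksChart_zero_mul_ksChart_one (a := h.a) (b := h.b) hε hσ hr
    have hx : ksChart ε σ h.a h.b h.r p 4 = p 4 := rfl
    have hpull := (h.coeffs (p 4) (p 1)).ksMatrix_pullback hσ
      (huv ▸ sub_ne_zero.mpr hr) (huv ▸ hE _ _ hreg)
    rw [jac_ksChart ε hσ h.a h.b hr, ksExtension, ksY_ksChart hε hσ hr, hx,
      h.metric_eq_atHorizon hp, ← huv, ← hpull, Matrix.transpose_mul]
    simp only [Matrix.mul_assoc]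

theorem exists_ksExtension (hrs : h.r ≠ h.s) (hσ : σ ^ 2 = h.sigmaSq) :
    ∃ gExt : Coords → Mat5, IsAnalyticMetricOn gExt h.ksRegion ∧
      (∀ p q, p 0 = q 0 → p 1 = q 1 → p 4 = q 4 → gExt p = gExt q) ∧
      (∀ p ∈ h.ksRegion, (gExt p).det =
        -(64 * h.k ^ 8 * σ ^ 2 * H h.ν h.lam (p 4) (ksY h.r p) ^ 2)
          / ((1 - h.ν) ^ 6 * (p 4 - ksY h.r p) ^ 8)) ∧
      ∀ ε : ℝ, ε = 1 ∨ ε = -1 → IsIsometricEmbeddingOn (ksChart ε σ h.a h.b h.r)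
        (domain h.ν h.lam) (metric h.k h.ν h.lam) h.ksRegion gExt := by
  have hσ0 : σ ≠ 0 := by
    rintro rfl
    exact (h.sigmaSq_pos hrs).ne (by rw [← hσ, zero_pow two_ne_zero])
  obtain ⟨E, hE⟩ := h.exists_radialQuotient hrs
  rw [← hσ] at hE
  have hE' := fun x y hxy => (hE x y hxy).2
  refine ⟨h.ksExtension E σ, isAnalyticMetricOn_ksExtension hσ0 hE, fun p q hu hv hx => ?_,
    fun p => det_ksExtension hE', fun ε hε => isIsometricEmbeddingOn_ksChart hσ0 hE' ?_⟩
  · simp only [ksExtension, ksY, hu, hv, hx]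
  · exact sq_eq_one_iff.mpr hε

end KillingHorizon

namespace Horizon

/-- The square root of the discriminant `λ² - 4ν`, with the sign for which the horizon is the
upper root. -/
def disc (ν lam : ℝ) : Horizon → ℝ
  | h => √(lam ^ 2 - 4 * ν)
  | c => -√(lam ^ 2 - 4 * ν)

section

variable {k ν lam : ℝ} (hor : Horizon)

theorem disc_sq (hd : 4 * ν < lam ^ 2) : hor.disc ν lam ^ 2 = lam ^ 2 - 4 * ν := by
  have := Real.sq_sqrt (sub_pos.mpr hd).le
  cases hor <;> simpa [disc] using this

theorem disc_ne_zero (hd : 4 * ν < lam ^ 2) : hor.disc ν lam ≠ 0 := by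
  rw [← sq_pos_iff, hor.disc_sq hd]
  exact sub_pos.mpr hd

theorem root_eq : hor.root ν lam = -(lam - hor.disc ν lam) / (2 * ν) := by
  cases hor <;> simp [root, disc, yh, yc]

theorem otherRoot_eq : hor.otherRoot ν lam = -(lam + hor.disc ν lam) / (2 * ν) := by
  cases hor <;> simp [otherRoot, disc, yh, yc, sub_eq_add_neg]

theorem b_eq : hor.b k ν lam = ((ν - 1) * hor.disc ν lam + lam * (1 + ν)) * (1 + ν - lam)
    / (4 * k * lam * √(ν * ((1 + ν) ^ 2 - lam ^ 2))) := by
  cases hor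
  · rfl
  · simp only [b, disc]; ring

theorem sigmaSq_eq : hor.sigmaSq k ν lam = 2 * k ^ 2 * lam ^ 2 *
      (lam ^ 2 * (ν ^ 2 + 1) - lam * (ν ^ 2 - 1) * hor.disc ν lam - 2 * ν * (ν + 1) ^ 2)
    / ((ν - 1) ^ 2 * (lam ^ 2 - 4 * ν) * (-lam + ν + 1) ^ 2) := by
  cases hor
  · rfl
  · simp only [sigmaSq, disc]; ring

theorem root_ne_otherRoot (hν : 0 < ν) (hd : 4 * ν < lam ^ 2) :
    hor.root ν lam ≠ hor.otherRoot ν lam := by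
  rw [root_eq, otherRoot_eq]
  intro h
  field_simp at h
  exact hor.disc_ne_zero hd (by linarith)

/-- The horizon `hor` with its null Killing field, for parameters with `λ² > 4ν`. -/
@[simps k ν lam r]
def killingHorizon (hk : k ≠ 0) (hν : 0 < ν) (hν1 : ν ≠ 1) (hl : |lam| < 1 + ν)
    (hd : 4 * ν < lam ^ 2) : KillingHorizon where
  k := k
  ν := ν
  lam := lam
  r := hor.root ν lam
  s := hor.otherRoot ν lam
  k_ne := hk
  ν_pos := hν
  ν_ne := hν1
  lam_ne := by
    rintro rfl
    linarith
  abs_lam_lt := hl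
  mul_roots := by
    rw [root_eq, otherRoot_eq]
    field_simp
    linear_combination -hor.disc_sq hd
  add_roots := by
    rw [root_eq, otherRoot_eq]
    field_simp
    ring

variable (hk : k ≠ 0) (hν : 0 < ν) (hν1 : ν ≠ 1) (hl : |lam| < 1 + ν) (hd : 4 * ν < lam ^ 2)

theorem killingHorizon_b : (hor.killingHorizon hk hν hν1 hl hd).b = hor.b k ν lam := by
  have hm := (hor.killingHorizon hk hν hν1 hl hd).m_pos
  have hn := (hor.killingHorizon hk hν hν1 hl hd).n_pos
  have hn2 := (hor.killingHorizon hk hν hν1 hl hd).n_sq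
  have hlam := (hor.killingHorizon hk hν hν1 hl hd).lam_ne
  simp only [KillingHorizon.b, KillingHorizon.a, KillingHorizon.n, KillingHorizon.m,
    killingHorizon_k, killingHorizon_ν, killingHorizon_lam, killingHorizon_r]
    at hm hn hn2 hlam ⊢
  rw [b_eq, root_eq, Real.sqrt_mul hν.le]
  field_simp
  rw [hn2]
  ring

theorem killingHorizon_sigmaSq :
    (hor.killingHorizon hk hν hν1 hl hd).sigmaSq = hor.sigmaSq k ν lam := by
  set h := hor.killingHorizon hk hν hν1 hl hd with hdef
  set q := hor.disc ν lam with hq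
  have hq0 : q ≠ 0 := hor.disc_ne_zero hd
  have hqr : q = 2 * ν * h.r + lam := by
    rw [hdef, killingHorizon_r, root_eq, ← hq]
    field_simp
    ring
  have hν1' : 1 - ν ≠ 0 := h.one_sub_ν_ne
  have he : 1 - lam + ν ≠ 0 := h.one_sub_lam_add_ν_pos.ne'
  have hr : h.r ≠ 0 := h.r_ne
  have hr1 : 1 + h.r ≠ 0 := h.one_add_r_ne
  have hadd : ν * h.r ^ 2 + 1 = -(lam * h.r) := by
    have : lam = -(ν * h.r ^ 2 + 1) / h.r := h.lam_eq
    rw [this]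
    field_simp
  have hsub : ν * h.r ^ 2 - 1 = h.r * q := by
    rw [hqr]
    linear_combination -hadd
  have hquot : (1 - ν * h.r) / (1 + h.r)
      = -(lam * (1 - ν) + q * (1 + ν)) / (2 * (1 - lam + ν)) := by
    field_simp
    rw [hqr]
    linear_combination (2 + 2 * ν) * hadd
  have hsq : (lam * (1 - ν) + q * (1 + ν)) ^ 2
      = 2 * (lam ^ 2 * (ν ^ 2 + 1) - lam * (ν ^ 2 - 1) * q - 2 * ν * (ν + 1) ^ 2) := by
    linear_combination (1 + ν) ^ 2 * hor.disc_sq hd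
  calc h.sigmaSq
      = (2 * k * (ν * h.r ^ 2 + 1) * (1 - ν * h.r)
          / ((1 - ν) * (ν * h.r ^ 2 - 1) * (1 + h.r))) ^ 2 := rfl
    _ = (2 * k * lam / ((1 - ν) * q) * ((1 - ν * h.r) / (1 + h.r))) ^ 2 := by
        rw [hadd, hsub]
        field_simp
    _ = hor.sigmaSq k ν lam := by
        rw [hquot, mul_pow, div_pow (-_), neg_sq, hsq, sigmaSq_eq, ← hor.disc_sq hd, ← hq,
          show -lam + ν + 1 = 1 - lam + ν by ring, show ν - 1 = -(1 - ν) by ring]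
        field_simp

end

end Horizon

theorem quadratic_pos_of_one_lt {ν R x : ℝ} (hν : 0 < ν) (hν1 : ν < 1) (hR : 1 < R)
    (hx : -1 ≤ x) :
    0 < ν * R ^ 2 * (R ^ 2 + 1) * x ^ 2 + 2 * R * (ν * R ^ 2 + 1) * x + (R ^ 2 + 1) := by
  have : 0 < R := by linarith
  have : 0 < R - 1 := by linarith
  have hx1 : 0 ≤ x + 1 := by linarith
  rcases le_or_gt (ν * R ^ 4) 1 with hνR | hνR
  · -- Expanded at `x = -1`, the polynomial has nonnegative coefficients.
    have hνR3 : ν * R ^ 3 ≤ 1 := hνR.trans' (by gcongr <;> linarith)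
    have : 0 ≤ (1 - ν * R ^ 3) + ν * R * (R - 1) := by
      have : 0 ≤ ν * R * (R - 1) := by positivity
      linarith
    calc 0 < (R - 1) ^ 2 * (1 + ν * R ^ 2)
          + (x + 1) * (2 * R * ((1 - ν * R ^ 3) + ν * R * (R - 1)))
          + (x + 1) ^ 2 * (ν * R ^ 2 * (R ^ 2 + 1)) := by positivity
      _ = _ := by ring
  · -- The discriminant is negative.
    have hlead : 0 < ν * R ^ 2 * (R ^ 2 + 1) := by positivity
    have : 0 < (1 - ν) * (ν * R ^ 4 - 1) := mul_pos (by linarith) (by linarith)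
    refine pos_of_mul_pos_right (a := ν * R ^ 2 * (R ^ 2 + 1)) ?_ hlead.le
    calc 0 < (ν * R ^ 2 * (R ^ 2 + 1) * x + R * (ν * R ^ 2 + 1)) ^ 2
          + R ^ 2 * ((1 - ν) * (ν * R ^ 4 - 1)) := by positivity
      _ = _ := by ring

theorem exists_forall_abs_sub_lt {ν lam r : ℝ} (hr : r < -1)
    (hH : ∀ x ∈ Set.Icc (-1 : ℝ) 1, H ν lam x r ≠ 0) :
    ∃ δ > 0, ∀ x y, |x| < 1 → |y - r| < δ → x ≠ y ∧ y ^ 2 ≠ 1 ∧ H ν lam x y ≠ 0 := by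
  have hev : ∀ᶠ y in 𝓝 r, ∀ x ∈ Set.Icc (-1 : ℝ) 1, x ≠ y ∧ y ^ 2 ≠ 1 ∧ H ν lam x y ≠ 0 := by
    refine isCompact_Icc.eventually_forall_of_forall_eventually fun x hx => ?_
    have hHcont : ContinuousAt (fun z : ℝ × ℝ => H ν lam z.2 z.1) (r, x) := by
      unfold H; fun_prop
    have hsub : ContinuousAt (fun z : ℝ × ℝ => z.2 - z.1) (r, x) := by fun_prop
    have hsq : ContinuousAt (fun z : ℝ × ℝ => z.1 ^ 2) (r, x) := by fun_prop
    filter_upwards [hHcont.eventually_ne (hH x hx),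
      hsub.eventually_ne (sub_pos.mpr (hr.trans_le hx.1)).ne',
      hsq.eventually_ne (y := 1) (by change r ^ 2 ≠ 1; nlinarith)] with z hHz hzne hzsq
    exact ⟨sub_ne_zero.mp hzne, hzsq, hHz⟩
  obtain ⟨δ, hδ, hnhds⟩ := Metric.eventually_nhds_iff.mp hev
  exact ⟨δ, hδ, fun x y hx hy => hnhds (by rwa [Real.dist_eq]) x
    ⟨(abs_lt.mp hx).1.le, (abs_lt.mp hx).2.le⟩⟩

namespace KillingHorizon

variable (h : KillingHorizon)

theorem H_root_mul (x : ℝ) : H h.ν h.lam x h.r * h.r ^ 2 = (1 - h.ν * h.r) * (1 + h.ν * h.r)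
    * (h.ν * h.r ^ 2 * (h.r ^ 2 + 1) * x ^ 2 - 2 * h.r * (h.ν * h.r ^ 2 + 1) * x
      + (h.r ^ 2 + 1)) := by
  have := h.r_ne
  rw [h.lam_eq]
  unfold H
  field_simp
  ring

theorem H_root_ne (hν1 : h.ν < 1) (hr : h.r < -1) {x : ℝ} (hx : -1 ≤ x) :
    H h.ν h.lam x h.r ≠ 0 := by
  have hpos := quadratic_pos_of_one_lt h.ν_pos hν1 (lt_neg_of_lt_neg hr) hx
  refine left_ne_zero_of_mul (b := h.r ^ 2) ?_
  rw [h.H_root_mul]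
  refine mul_ne_zero (mul_ne_zero h.one_sub_mul_r_ne h.one_add_mul_r_ne) ?_
  convert hpos.ne' using 1
  ring

theorem roots_lt_neg_one (hν1 : h.ν < 1) (hl : 0 < h.lam) : h.r < -1 ∧ h.s < -1 := by
  have hν := h.ν_pos
  have hmul := h.mul_roots
  have hadd := h.add_roots
  have hprod : 1 < h.r * h.s := by
    by_contra! hle
    nlinarith
  have hsum : h.r + h.s < 0 := by
    by_contra! hle
    nlinarith
  have hone : 0 < (1 + h.r) * (1 + h.s) := by
    refine pos_of_mul_pos_right (a := h.ν) ?_ hν.le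
    linarith [h.one_sub_lam_add_ν_pos]
  rcases pos_and_pos_or_neg_and_neg_of_mul_pos hone with ⟨hr, hs⟩ | ⟨hr, hs⟩
  · have : h.r < 0 := by nlinarith
    nlinarith
  · exact ⟨by linarith, by linarith⟩

theorem G_ne_zero (hν1 : h.ν < 1) (hl : 0 < h.lam) {x : ℝ} (hx : |x| < 1) :
    G h.ν h.lam x ≠ 0 := by
  obtain ⟨hr, hs⟩ := h.roots_lt_neg_one hν1 hl
  obtain ⟨hx1, hx2⟩ := abs_lt.mp hx
  unfold G
  rw [h.quadratic_eq]
  refine mul_ne_zero (by nlinarith) (mul_ne_zero (mul_ne_zero h.ν_pos.ne' ?_) ?_) <;> linarith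

theorem exists_subset_ksRegion (hrs : h.r ≠ h.s) (hν1 : h.ν < 1) (hl : 0 < h.lam) :
    ∃ δ > 0, {p : Coords | |p 4| < 1 ∧ |p 0 * p 1| < δ} ⊆ h.ksRegion := by
  obtain ⟨δ, hδ, hball⟩ := exists_forall_abs_sub_lt (h.roots_lt_neg_one hν1 hl).1
    fun x hx => h.H_root_ne hν1 (h.roots_lt_neg_one hν1 hl).1 hx.1
  refine ⟨min δ |h.s - h.r|, lt_min hδ (abs_pos.mpr (sub_ne_zero.mpr hrs.symm)), ?_⟩
  rintro p ⟨hx, huv⟩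
  have hdist : |ksY h.r p - h.r| < min δ |h.s - h.r| := by rwa [ksY, add_sub_cancel_left]
  obtain ⟨hne, hsq, hH⟩ := hball _ _ hx (hdist.trans_le (min_le_left _ _))
  refine ⟨h.G_ne_zero hν1 hl hx, hne, hsq, ?_, hH⟩
  intro hs
  exact absurd (hdist.trans_le (min_le_right _ _)) (by rw [hs]; exact lt_irrefl _)

end KillingHorizon

theorem y0_sq {n : ℝ} (hn : 0 ≤ n) : y0 (n ^ 2) = -1 / n := by
  rw [y0, Real.sqrt_sq hn]

section Parameters

variable {k n : ℝ} (hk : k ≠ 0) (hn : 0 < n) (hn1 : n < 1)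

/-- The degenerate horizon, for `ν = n²` and `λ = 2n`: the two roots coincide. -/
@[simps k ν lam r s]
def degenerateHorizon : KillingHorizon where
  k := k
  ν := n ^ 2
  lam := 2 * n
  r := y0 (n ^ 2)
  s := y0 (n ^ 2)
  k_ne := hk
  ν_pos := by positivity
  ν_ne := by nlinarith
  lam_ne := by positivity
  abs_lam_lt := by
    rw [abs_of_pos (by positivity)]
    nlinarith
  mul_roots := by
    rw [y0_sq hn.le]
    field_simp
  add_roots := by
    rw [y0_sq hn.le]
    field_simp
    ring

theorem degenerateHorizon_n : (degenerateHorizon hk hn hn1).n = n := Real.sqrt_sq hn.le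

theorem degenerateHorizon_m : (degenerateHorizon hk hn hn1).m = 1 - n ^ 2 := by
  have hsq : (1 + n ^ 2) ^ 2 - (2 * n) ^ 2 = (1 - n ^ 2) ^ 2 := by ring
  rw [KillingHorizon.m, degenerateHorizon_ν, degenerateHorizon_lam, hsq]
  exact Real.sqrt_sq (by nlinarith)

theorem degenerateHorizon_a : (degenerateHorizon hk hn hn1).a = aPsi k (n ^ 2) := by
  have hν : 1 - n ^ 2 ≠ 0 := (degenerateHorizon hk hn hn1).one_sub_ν_ne
  rw [KillingHorizon.a, degenerateHorizon_m, degenerateHorizon_ν, degenerateHorizon_lam,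
    degenerateHorizon_k, aPsi, Real.sqrt_sq hn.le]
  field_simp
  ring

theorem degenerateHorizon_b : (degenerateHorizon hk hn hn1).b = aPhi k (n ^ 2) := by
  rw [KillingHorizon.b, degenerateHorizon_a, degenerateHorizon_n, degenerateHorizon_ν,
    degenerateHorizon_lam, degenerateHorizon_r, aPsi, aPhi, Real.sqrt_sq hn.le, y0_sq hn.le]
  field_simp
  ring

theorem y0_sq_lt_neg_one (hn : 0 < n) (hn1 : n < 1) : y0 (n ^ 2) < -1 := by
  rw [y0_sq hn.le, div_lt_iff₀ hn]
  linarith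

end Parameters

/-- The second quotient of the numerator of `g(K, K)` by `y - y₀`, up to a constant, obtained by
polynomial division. -/
def degenerateKillingNum (n x y : ℝ) : ℝ :=
  ((-n ^ 8 - 3 * n ^ 6 + 5 * n ^ 4 - n ^ 2) * x ^ 4
    + (-6 * n ^ 7 + 12 * n ^ 5 + 2 * n ^ 3) * x ^ 3
    + (n ^ 8 + 7 * n ^ 6 + 19 * n ^ 4 - 3 * n ^ 2) * x ^ 2
    + (6 * n ^ 7 + 20 * n ^ 5 - 2 * n ^ 3) * x + 8 * n ^ 6) * y ^ 2
  + ((2 * n ^ 7 - 12 * n ^ 5 + 2 * n ^ 3) * x ^ 4 + (-4 * n ^ 6 - 24 * n ^ 4 + 12 * n ^ 2) * x ^ 3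
    + (-2 * n ^ 7 - 18 * n ^ 5 + 18 * n ^ 3 + 2 * n) * x ^ 2
    + (-12 * n ^ 6 + 24 * n ^ 4 + 4 * n ^ 2) * x - 2 * n ^ 5 + 12 * n ^ 3 - 2 * n) * y
  - 8 * n ^ 2 * x ^ 4 + (2 * n ^ 5 - 20 * n ^ 3 - 6 * n) * x ^ 3
  + (3 * n ^ 6 - 19 * n ^ 4 - 7 * n ^ 2 - 1) * x ^ 2 + (-2 * n ^ 5 - 12 * n ^ 3 + 6 * n) * x
  + n ^ 6 - 5 * n ^ 4 + 3 * n ^ 2 + 1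

theorem killingKillingNum_degenerate {n : ℝ} (hn : 0 < n) (x y : ℝ) :
    killingKillingNum (n ^ 2) (2 * n) (y0 (n ^ 2)) (y0 (n ^ 2)) x y
      = (1 - n ^ 2) / 4 * ((y - y0 (n ^ 2)) * degenerateKillingNum n x y) := by
  rw [y0_sq hn.le]
  unfold killingKillingNum killingPsiNum killingPhiNum killingPsiReduced psiPhiReduced
    killingPhiReduced phiPhiReduced degenerateKillingNum
  field_simp
  ring

/-- The components of the metric in the frame `(K, ∂y, ∂ψ, ∂φ, ∂x)` for `ν = n²` and `λ = 2n`, with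
the double zero of `g(K, K)`, the zeros of `g(K, ∂ψ)` and `g(K, ∂φ)` and the double pole of `g_yy`
at `y = y₀` divided out. -/
def degenerateCoeffs (k n x y : ℝ) : FrameCoeffs where
  KK := (1 - n) ^ 4 * degenerateKillingNum n x y / (8 * den (n ^ 2) (2 * n) x y)
  Kψ := k * (1 - n) ^ 2 * ((1 + y) * killingPsiNum (n ^ 2) (2 * n) (y0 (n ^ 2)) x y)
    / den (n ^ 2) (2 * n) x y
  Kφ := k * (1 - n) ^ 2 * ((1 - x ^ 2) * killingPhiNum (n ^ 2) (2 * n) (y0 (n ^ 2)) x y)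
    / (2 * den (n ^ 2) (2 * n) x y)
  ψψ := -(2 * k ^ 2 * psiPsiNum (n ^ 2) (2 * n) x y / ((1 - n) ^ 2 * den (n ^ 2) (2 * n) x y))
  ψφ := -(2 * k ^ 2 * n * psiPhiNum (n ^ 2) (2 * n) x y / den (n ^ 2) (2 * n) x y)
  φφ := 2 * k ^ 2 * phiPhiNum (n ^ 2) (2 * n) x y / den (n ^ 2) (2 * n) x y
  yy := -(conf k (n ^ 2) (2 * n) x y / ((1 - y ^ 2) * n ^ 2))
  xx := conf k (n ^ 2) (2 * n) x y / G (n ^ 2) (2 * n) x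

theorem FrameCoeffs.det_atHorizon_two (c : FrameCoeffs) {w : ℝ} (hw : w ≠ 0) :
    (c.atHorizon 2 w).toMatrix.det = c.yy * c.xx * c.reducedDet 1 := by
  rw [det_toMatrix]
  simp only [atHorizon, reducedDet]
  field_simp
  ring

/-- The points `(x, y)` at which `degenerateCoeffs` is regular. -/
def IsDegenerateRegular (n x y : ℝ) : Prop :=
  G (n ^ 2) (2 * n) x ≠ 0 ∧ x ≠ y ∧ y ^ 2 ≠ 1 ∧ H (n ^ 2) (2 * n) x y ≠ 0

theorem mem_degDomain {n : ℝ} (hn : 0 ≤ n) {p : Coords} :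
    p ∈ degDomain (n ^ 2) ↔ IsDegenerateRegular n (p 4) (p 1) := by
  rw [degDomain, Real.sqrt_sq hn]
  rfl

theorem coeffs_degenerateHorizon_atHorizon {k n : ℝ} (hk : k ≠ 0) (hn : 0 < n) (hn1 : n < 1)
    {x y : ℝ} (hy : y ≠ y0 (n ^ 2)) :
    ((degenerateHorizon hk hn hn1).coeffs x y).atHorizon 1 (y - y0 (n ^ 2))
      = (degenerateCoeffs k n x y).atHorizon 2 (y - y0 (n ^ 2)) := by
  have hw : y - y0 (n ^ 2) ≠ 0 := sub_ne_zero.mpr hy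
  have hν : 1 - n ^ 2 ≠ 0 := (degenerateHorizon hk hn hn1).one_sub_ν_ne
  have : 1 - n ≠ 0 := by linarith
  have hfactor : 1 - n ^ 2 = (1 - n) * (1 + n) := by ring
  have hsub : 1 - 2 * n + n ^ 2 = (1 - n) ^ 2 := by ring
  have hadd : 1 + n ^ 2 + 2 * n = (1 + n) ^ 2 := by ring
  ext <;> simp only [FrameCoeffs.atHorizon, KillingHorizon.coeffs, degenerateCoeffs,
    degenerateHorizon_n, degenerateHorizon_m, degenerateHorizon_k, degenerateHorizon_ν,
    degenerateHorizon_lam, degenerateHorizon_r, degenerateHorizon_s,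
    killingKillingNum_degenerate hn, hsub, hadd, pow_one]
  · rw [hfactor]; field_simp; ring
  · field_simp
  · field_simp
  · field_simp

theorem metric_eq_degenerateCoeffs {k n : ℝ} (hk : k ≠ 0) (hn : 0 < n) (hn1 : n < 1) {p : Coords}
    (hp : p ∈ domain (n ^ 2) (2 * n)) :
    metric k (n ^ 2) (2 * n) p = (shiftMat (aPsi k (n ^ 2)) (aPhi k (n ^ 2)))ᵀ
      * ((degenerateCoeffs k n (p 4) (p 1)).atHorizon 2 (p 1 - y0 (n ^ 2))).toMatrix
      * shiftMat (aPsi k (n ^ 2)) (aPhi k (n ^ 2)) := by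
  set h := degenerateHorizon hk hn hn1
  have hy : p 1 ≠ y0 (n ^ 2) := (h.isRegular_of_mem_domain hp).2
  rw [← coeffs_degenerateHorizon_atHorizon hk hn hn1 hy, ← degenerateHorizon_a hk hn hn1,
    ← degenerateHorizon_b hk hn hn1]
  exact h.metric_eq_atHorizon hp

namespace IsDegenerateRegular

variable {k n x y : ℝ}

theorem den_ne (hn : 0 < n) (hn1 : n < 1) (hxy : IsDegenerateRegular n x y) :
    den (n ^ 2) (2 * n) x y ≠ 0 :=
  den_ne_zero (by nlinarith) hxy.2.1 hxy.2.2.2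

theorem isAnalyticAt_degenerateCoeffs (hn : 0 < n) (hn1 : n < 1)
    (hxy : IsDegenerateRegular n x y) :
    FrameCoeffs.IsAnalyticAt (fun z : ℝ × ℝ => degenerateCoeffs k n z.1 z.2) (x, y) := by
  have hsub : x - y ≠ 0 := sub_ne_zero.mpr hxy.2.1
  have hν : 1 - n ^ 2 ≠ 0 := by nlinarith
  have : 1 - n ≠ 0 := by linarith
  have hden := hxy.den_ne hn hn1
  have hconf : AnalyticAt ℝ (fun z : ℝ × ℝ => conf k (n ^ 2) (2 * n) z.1 z.2) (x, y) :=
    IsPolynomial₂.analyticAt_div (by fun_prop) (by fun_prop) (by positivity)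
  exact
    { KK := IsPolynomial₂.analyticAt_div (by unfold degenerateKillingNum; fun_prop)
        (by fun_prop) (by positivity)
      Kψ := IsPolynomial₂.analyticAt_div (by fun_prop) (by fun_prop) (by positivity)
      Kφ := IsPolynomial₂.analyticAt_div (by fun_prop) (by fun_prop) (by positivity)
      ψψ := (IsPolynomial₂.analyticAt_div (by fun_prop) (by fun_prop) (by positivity)).fun_neg
      ψφ := (IsPolynomial₂.analyticAt_div (by fun_prop) (by fun_prop) (by positivity)).fun_neg
      φφ := IsPolynomial₂.analyticAt_div (by fun_prop) (by fun_prop) (by positivity)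
      yy := (hconf.fun_div (IsPolynomial₂.analyticAt (by fun_prop) _)
        (mul_ne_zero (sub_ne_zero.mpr hxy.2.2.1.symm) (pow_ne_zero 2 hn.ne'))).fun_neg
      xx := hconf.fun_div (IsPolynomial₂.analyticAt (by unfold G; fun_prop) _) hxy.1 }

theorem det_degenerateCoeffs (hk : k ≠ 0) (hn : 0 < n) (hn1 : n < 1)
    (hxy : IsDegenerateRegular n x y) :
    (degenerateCoeffs k n x y).yy * (degenerateCoeffs k n x y).xx
        * (degenerateCoeffs k n x y).reducedDet 1
      = -(16 * k ^ 8 * H (n ^ 2) (2 * n) x y ^ 2) / ((1 - n ^ 2) ^ 6 * (x - y) ^ 8) := by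
  set h := degenerateHorizon hk hn hn1
  have hc := (hxy.isAnalyticAt_degenerateCoeffs (k := k) hn hn1).comp (f := fun z => (x, z))
    (by fun_prop)
  refine h.eq_of_eventually_eq_det hxy.1 hxy.2.1 hxy.2.2.2
    (f := fun z => (degenerateCoeffs k n x z).yy * (degenerateCoeffs k n x z).xx
      * (degenerateCoeffs k n x z).reducedDet 1)
    ((hc.yy.fun_mul hc.xx).fun_mul (hc.reducedDet (by fun_prop))).continuousAt
    (Eventually.of_forall fun z hz => ?_)
  have hz' : z ≠ y0 (n ^ 2) := (KillingHorizon.isRegular_of_mem_domain hz).2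
  rw [h.det_metric_eq_det_atHorizon hz]
  refine (FrameCoeffs.det_atHorizon_two _ (sub_ne_zero.mpr hz')).symm.trans ?_
  rw [← coeffs_degenerateHorizon_atHorizon hk hn hn1 hz']
  rfl

end IsDegenerateRegular

theorem IsPolynomial₂.exists_eq_sub_sq_mul {𝕜 : Type*} [NontriviallyNormedField 𝕜]
    {f : 𝕜 × 𝕜 → 𝕜} {r : 𝕜} (hf : IsPolynomial₂ f) (hr : ∀ x, f (x, r) = 0)
    (hr' : ∀ x, deriv (fun y => f (x, y)) r = 0) :
    ∃ g, IsPolynomial₂ g ∧ ∀ x y, f (x, y) = (y - r) ^ 2 * g (x, y) := by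
  have := NontriviallyNormedField.infinite 𝕜
  obtain ⟨g, hg, hfg⟩ := hf.exists_eq_sub_mul hr
  have hgr (x : 𝕜) : g (x, r) = 0 := by
    have hgx : DifferentiableAt 𝕜 (fun y => g (x, y)) r :=
      ((hg.analyticAt (x, r)).fun_comp (f := fun y => (x, y)) (by fun_prop)).differentiableAt
    have hderiv := ((hasDerivAt_id' r).sub_const r).mul hgx.hasDerivAt
    rw [sub_self, zero_mul, add_zero, one_mul] at hderiv
    rw [← hderiv.deriv, ← hr' x]
    exact congrArg (deriv · r) (funext fun y => (hfg x y).symm)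
  obtain ⟨q, hq, hgq⟩ := hg.exists_eq_sub_mul hgr
  exact ⟨q, hq, fun x y => by rw [hfg, hgq, sq, mul_assoc]⟩

/-- Components, in the frame `(∂z, K, ∂ψ, ∂φ)` at a degenerate horizon, that involve the radial
field `∂z = ∂y + S / w² K + bψ / w ∂ψ + bφ / w ∂φ`. -/
@[ext]
structure RadialComponents where
  (zz zψ zφ : ℝ)

namespace FrameCoeffs

variable (c : FrameCoeffs)

/-- `w² g(∂z, ∂z)`, `w g(∂z, ∂ψ)` and `w g(∂z, ∂φ)` for the metric `c.atHorizon 2 w`. -/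
def radial (S bψ bφ : ℝ) : RadialComponents where
  zz := c.KK * S ^ 2 + 2 * S * (c.Kψ * bψ + c.Kφ * bφ)
    + (c.ψψ * bψ ^ 2 + 2 * c.ψφ * bψ * bφ + c.φφ * bφ ^ 2) + c.yy
  zψ := c.Kψ * S + c.ψψ * bψ + c.ψφ * bφ
  zφ := c.Kφ * S + c.ψφ * bψ + c.φφ * bφ

end FrameCoeffs

/-- `R` are the components of the metric `c.atHorizon 2 w` involving `∂z`, for `bψ = 0`, `bφ = -1`;
stated without division so that it makes sense at `w = 0`. -/
structure RadialComponents.IsRadial (R : RadialComponents) (c : FrameCoeffs) (w S : ℝ) : Prop where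
  zz : w ^ 2 * R.zz = (c.radial S 0 (-1)).zz
  zψ : w * R.zψ = (c.radial S 0 (-1)).zψ
  zφ : w * R.zφ = (c.radial S 0 (-1)).zφ

/-- `a₀ + a₁ (y - y₀)` for the constants `a₀` and `a₁` of `IsDegConstants k (n ^ 2) 1`, up to a
constant factor. -/
def shiftNum (n y : ℝ) : ℝ :=
  1 - n ^ 2 + (1 + n ^ 2) * (y * n + 1)

/-- `a₀ + a₁ (y - y₀)` for the constants `a₀` and `a₁` of `IsDegConstants k (n ^ 2) 1`. -/
def degenerateShift (k n y : ℝ) : ℝ :=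
  4 * k * shiftNum n y / ((1 - n) ^ 2 * (1 - n ^ 2))

/-- The numerator of `((degenerateCoeffs k n x y).radial (degenerateShift k n y) 0 (-1)).zψ`, up to
a constant. -/
def radialPsiNum (n x y : ℝ) : ℝ :=
  2 * shiftNum n y * ((1 + y) * killingPsiNum (n ^ 2) (2 * n) (y0 (n ^ 2)) x y)
    + (1 - n ^ 2) * n * psiPhiNum (n ^ 2) (2 * n) x y

/-- The analogue of `radialPsiNum` for `zφ`. -/
def radialPhiNum (n x y : ℝ) : ℝ :=
  (1 - x ^ 2) * (shiftNum n y * killingPhiNum (n ^ 2) (2 * n) (y0 (n ^ 2)) x y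
    - (1 - n ^ 2) * phiPhiReduced (n ^ 2) (2 * n) x y)

/-- The analogue of `radialPsiNum` for `zz`. -/
def radialRadialNum (n x y : ℝ) : ℝ :=
  (1 - y ^ 2) * n ^ 2 * (shiftNum n y ^ 2 * degenerateKillingNum n x y
      - 2 * shiftNum n y * (1 - n ^ 2)
        * ((1 - x ^ 2) * killingPhiNum (n ^ 2) (2 * n) (y0 (n ^ 2)) x y)
      + (1 - n ^ 2) ^ 2 * ((1 - x ^ 2) * phiPhiReduced (n ^ 2) (2 * n) x y))
    - (1 - n ^ 2) ^ 2 * H (n ^ 2) (2 * n) x y ^ 2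

section Roots

variable {n : ℝ} (hn : 0 < n) (x : ℝ)

include hn

theorem radialPsiNum_root : radialPsiNum n x (y0 (n ^ 2)) = 0 := by
  unfold radialPsiNum shiftNum killingPsiNum killingPsiReduced psiPhiNum psiPhiReduced
  rw [y0_sq hn.le]
  field_simp
  ring

theorem radialPhiNum_root : radialPhiNum n x (y0 (n ^ 2)) = 0 := by
  unfold radialPhiNum shiftNum killingPhiNum killingPhiReduced phiPhiReduced
  rw [y0_sq hn.le]
  field_simp
  ring

theorem radialRadialNum_root : radialRadialNum n x (y0 (n ^ 2)) = 0 := by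
  unfold radialRadialNum shiftNum degenerateKillingNum killingPhiNum killingPhiReduced
    phiPhiReduced H
  rw [y0_sq hn.le]
  field_simp
  ring

set_option maxRecDepth 4000 in
theorem deriv_radialRadialNum_root : deriv (fun y => radialRadialNum n x y) (y0 (n ^ 2)) = 0 := by
  unfold radialRadialNum shiftNum degenerateKillingNum killingPhiNum killingPhiReduced
    phiPhiReduced H
  have hlin (c z : ℝ) : deriv (HMul.hMul c) z = c := (hasDerivAt_const_mul c).deriv
  simp (disch := fun_prop) only [hlin, deriv_fun_add, deriv_fun_sub, deriv_fun_mul, deriv_const,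
    deriv_id'', deriv_fun_pow, Nat.cast_ofNat, Nat.reduceSub, pow_one]
  rw [y0_sq hn.le]
  field_simp
  ring

end Roots

namespace IsDegenerateRegular

variable {n x y : ℝ} (hxy : IsDegenerateRegular n x y) (k : ℝ) (hn : 0 < n) (hn1 : n < 1)

include hxy hn hn1

theorem radial_degenerateCoeffs_zψ :
    ((degenerateCoeffs k n x y).radial (degenerateShift k n y) 0 (-1)).zψ
      = 2 * k ^ 2 * radialPsiNum n x y / ((1 - n ^ 2) * den (n ^ 2) (2 * n) x y) := by
  have hν : 1 - n ^ 2 ≠ 0 := by nlinarith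
  have : 1 - n ≠ 0 := by linarith
  have := hxy.den_ne hn hn1
  simp only [FrameCoeffs.radial, degenerateCoeffs, degenerateShift, radialPsiNum]
  field_simp
  ring

theorem radial_degenerateCoeffs_zφ :
    ((degenerateCoeffs k n x y).radial (degenerateShift k n y) 0 (-1)).zφ
      = 2 * k ^ 2 * radialPhiNum n x y / ((1 - n ^ 2) * den (n ^ 2) (2 * n) x y) := by
  have hν : 1 - n ^ 2 ≠ 0 := by nlinarith
  have : 1 - n ≠ 0 := by linarith
  have := hxy.den_ne hn hn1
  simp only [FrameCoeffs.radial, degenerateCoeffs, degenerateShift, radialPhiNum, phiPhiNum]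
  field_simp
  ring

theorem radial_degenerateCoeffs_zz :
    ((degenerateCoeffs k n x y).radial (degenerateShift k n y) 0 (-1)).zz
      = 2 * k ^ 2 * radialRadialNum n x y
        / (n ^ 2 * (1 - n ^ 2) ^ 2 * ((1 - y ^ 2) * den (n ^ 2) (2 * n) x y)) := by
  have hν : 1 - n ^ 2 ≠ 0 := by nlinarith
  have : 1 - n ≠ 0 := by linarith
  have hy : 1 - y ^ 2 ≠ 0 := sub_ne_zero.mpr hxy.2.2.1.symm
  have hconf : conf k (n ^ 2) (2 * n) x y
      = 2 * k ^ 2 * H (n ^ 2) (2 * n) x y ^ 2 / den (n ^ 2) (2 * n) x y := by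
    have hsub : x - y ≠ 0 := sub_ne_zero.mpr hxy.2.1
    have hH := hxy.2.2.2
    unfold conf den
    field_simp
  have := hxy.den_ne hn hn1
  simp only [FrameCoeffs.radial, degenerateCoeffs, degenerateShift, radialRadialNum, phiPhiNum,
    hconf]
  field_simp
  ring

end IsDegenerateRegular

theorem exists_isRadial_degenerateCoeffs (k : ℝ) {n : ℝ} (hn : 0 < n) (hn1 : n < 1) :
    ∃ R : ℝ × ℝ → RadialComponents, ∀ x y, IsDegenerateRegular n x y →
      (R (x, y)).IsRadial (degenerateCoeffs k n x y) (y - y0 (n ^ 2)) (degenerateShift k n y) ∧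
      AnalyticAt ℝ (fun z => (R z).zz) (x, y) ∧ AnalyticAt ℝ (fun z => (R z).zψ) (x, y) ∧
      AnalyticAt ℝ (fun z => (R z).zφ) (x, y) := by
  obtain ⟨qψ, hqψ, eψ⟩ := IsPolynomial₂.exists_eq_sub_mul (r := y0 (n ^ 2))
    (f := fun z : ℝ × ℝ => radialPsiNum n z.1 z.2)
    (by unfold radialPsiNum shiftNum; fun_prop) (radialPsiNum_root hn)
  obtain ⟨qφ, hqφ, eφ⟩ := IsPolynomial₂.exists_eq_sub_mul (r := y0 (n ^ 2))
    (f := fun z : ℝ × ℝ => radialPhiNum n z.1 z.2)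
    (by unfold radialPhiNum shiftNum phiPhiReduced; fun_prop) (radialPhiNum_root hn)
  obtain ⟨qz, hqz, ez⟩ := IsPolynomial₂.exists_eq_sub_sq_mul (r := y0 (n ^ 2))
    (f := fun z : ℝ × ℝ => radialRadialNum n z.1 z.2)
    (by unfold radialRadialNum shiftNum degenerateKillingNum phiPhiReduced; fun_prop)
    (radialRadialNum_root hn) (deriv_radialRadialNum_root hn)
  have hν : 1 - n ^ 2 ≠ 0 := by nlinarith
  refine ⟨fun z =>
    { zz := 2 * k ^ 2 * qz z
        / (n ^ 2 * (1 - n ^ 2) ^ 2 * ((1 - z.2 ^ 2) * den (n ^ 2) (2 * n) z.1 z.2))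
      zψ := 2 * k ^ 2 * qψ z / ((1 - n ^ 2) * den (n ^ 2) (2 * n) z.1 z.2)
      zφ := 2 * k ^ 2 * qφ z / ((1 - n ^ 2) * den (n ^ 2) (2 * n) z.1 z.2) },
    fun x y hxy => ?_⟩
  have hden := hxy.den_ne hn hn1
  have hy : 1 - y ^ 2 ≠ 0 := sub_ne_zero.mpr hxy.2.2.1.symm
  refine ⟨⟨?_, ?_, ?_⟩, IsPolynomial₂.analyticAt_div (by fun_prop) (by fun_prop) (by positivity),
    IsPolynomial₂.analyticAt_div (by fun_prop) (by fun_prop) (by positivity),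
    IsPolynomial₂.analyticAt_div (by fun_prop) (by fun_prop) (by positivity)⟩
  · rw [hxy.radial_degenerateCoeffs_zz k hn hn1, ez, ← mul_div_assoc, mul_left_comm]
  · rw [hxy.radial_degenerateCoeffs_zψ k hn hn1, eψ, ← mul_div_assoc, mul_left_comm]
  · rw [hxy.radial_degenerateCoeffs_zφ k hn hn1, eφ, ← mul_div_assoc, mul_left_comm]

theorem isBigO_one_of_continuousAt {f : ℝ → ℝ} {r : ℝ} (hf : ContinuousAt f r) :
    f =O[𝓝[≠] r] fun _ => (1 : ℝ) :=
  (hf.tendsto.mono_left nhdsWithin_le_nhds).isBigO_one ℝ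

theorem isBigO_sub_one (r : ℝ) : (fun y => y - r) =O[𝓝[≠] r] fun _ => (1 : ℝ) :=
  isBigO_one_of_continuousAt (by fun_prop)

theorem eventually_sub_ne_zero (r : ℝ) : ∀ᶠ y in 𝓝[≠] r, y - r ≠ 0 :=
  eventually_mem_nhdsWithin.mono fun _ => sub_ne_zero.mpr

theorem eq_zero_of_div_isBigO_one {f : ℝ → ℝ} {r : ℝ} (hf : ContinuousAt f r)
    (h : (fun y => f y / (y - r)) =O[𝓝[≠] r] fun _ => (1 : ℝ)) : f r = 0 := by
  refine eq_zero_of_isBigO_sub hf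
    ((h.mul (isBigO_refl (fun y : ℝ => y - r) (𝓝[≠] r))).congr' ?_ (by simp))
  exact (eventually_sub_ne_zero r).mono fun y hy => div_mul_cancel₀ _ hy

theorem div_isBigO_one_of_div_sq {f : ℝ → ℝ} {r : ℝ}
    (h : (fun y => f y / (y - r) ^ 2) =O[𝓝[≠] r] fun _ => (1 : ℝ)) :
    (fun y => f y / (y - r)) =O[𝓝[≠] r] fun _ => (1 : ℝ) := by
  refine (h.mul (isBigO_sub_one r)).congr' ?_ (by simp)
  filter_upwards [eventually_sub_ne_zero r] with y hy
  field_simp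

namespace FrameCoeffs

theorem eq_of_radial_eq_zero (c : FrameCoeffs) {α a₀ bψ bφ : ℝ} (hα : α ≠ 0)
    (hyy : c.yy ≠ 0) (hdet : c.reducedDet 1 ≠ 0) (hα0 : c.radial α 0 (-1) = ⟨0, 0, 0⟩)
    (h0 : c.radial a₀ bψ bφ = ⟨0, 0, 0⟩) : bψ = 0 ∧ a₀ = -bφ * α ∧ bφ ^ 2 = 1 := by
  simp only [radial, RadialComponents.mk.injEq] at hα0 h0
  obtain ⟨f3, f1, f2⟩ := hα0
  obtain ⟨e3, e1, e2⟩ := h0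
  have hq : c.ψψ * c.φφ - c.ψφ ^ 2 ≠ 0 := fun hq => by
    have hψφ : c.ψφ = c.Kψ * α := by linear_combination -f1
    have hφφ : c.φφ = c.Kφ * α := by linear_combination -f2
    rw [hψφ, hφφ] at hq
    refine hdet (mul_left_cancel₀ (pow_ne_zero 2 hα) ?_)
    rw [reducedDet, hψφ, hφφ]
    linear_combination (c.KK * α ^ 2 - α * c.Kφ) * hq
  have hbψ : bψ = 0 := by
    refine (mul_eq_zero.mp ?_).resolve_left (mul_ne_zero hq hα)
    linear_combination α * (c.φφ * e1 - c.ψφ * e2) - a₀ * (c.φφ * f1 - c.ψφ * f2)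
  subst hbψ
  have ha₀ : a₀ + bφ * α = 0 := by
    refine (mul_eq_zero.mp ?_).resolve_left hq
    linear_combination α * (c.ψψ * e2 - c.ψφ * e1) - a₀ * (c.ψψ * f2 - c.ψφ * f1)
  obtain rfl : a₀ = -bφ * α := by linear_combination ha₀
  have hbφ : (bφ ^ 2 - 1) * c.yy = 0 := by
    linear_combination bφ ^ 2 * f3 - e3
  exact ⟨rfl, rfl, by linear_combination (mul_eq_zero.mp hbφ).resolve_right hyy⟩

theorem radial_zz_sub (c : FrameCoeffs) (S T : ℝ) {bφ : ℝ} (hbφ : bφ ^ 2 = 1) :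
    (c.radial S 0 bφ).zz - (c.radial T 0 (-1)).zz
      = (S + bφ * T) * (c.KK * (S - bφ * T) + 2 * bφ * c.Kφ) := by
  simp only [radial]
  linear_combination (c.φφ + c.KK * T ^ 2 - 2 * c.Kφ * T) * hbφ

theorem radial_neg_mul (c : FrameCoeffs) (S : ℝ) {bφ : ℝ} (hbφ : bφ ^ 2 = 1) :
    c.radial (-bφ * S) 0 bφ = ⟨(c.radial S 0 (-1)).zz, -bφ * (c.radial S 0 (-1)).zψ,
      -bφ * (c.radial S 0 (-1)).zφ⟩ := by
  simp only [radial, RadialComponents.mk.injEq]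
  exact ⟨by linear_combination (c.KK * S ^ 2 - 2 * S * c.Kφ + c.φφ) * hbφ, by ring, by ring⟩

variable {c : ℝ → FrameCoeffs} {r : ℝ}

theorem IsAnalyticAt.continuousAt_radial (hc : IsAnalyticAt c r) {S : ℝ → ℝ}
    (hS : ContinuousAt S r) (bψ bφ : ℝ) :
    ContinuousAt (fun y => ((c y).radial (S y) bψ bφ).zz) r ∧
    ContinuousAt (fun y => ((c y).radial (S y) bψ bφ).zψ) r ∧
    ContinuousAt (fun y => ((c y).radial (S y) bψ bφ).zφ) r := by
  obtain ⟨hKK, hKψ, hKφ, hψψ, hψφ, hφφ, hyy, -⟩ := hc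
  have := hKK.continuousAt
  have := hKψ.continuousAt
  have := hKφ.continuousAt
  have := hψψ.continuousAt
  have := hψφ.continuousAt
  have := hφφ.continuousAt
  have := hyy.continuousAt
  unfold radial
  exact ⟨by fun_prop, by fun_prop, by fun_prop⟩

/-- Boundedness, as `y → r`, of the components involving `∂z` for `w = y - r` and
`S = a₀ + a₁ w`. -/
def RadialBounded (c : ℝ → FrameCoeffs) (r a₀ a₁ bψ bφ : ℝ) : Prop :=
  (fun y => ((c y).radial (a₀ + a₁ * (y - r)) bψ bφ).zz / (y - r) ^ 2)
    =O[𝓝[≠] r] (fun _ => (1 : ℝ)) ∧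
  (fun y => ((c y).radial (a₀ + a₁ * (y - r)) bψ bφ).zψ / (y - r))
    =O[𝓝[≠] r] (fun _ => (1 : ℝ)) ∧
  (fun y => ((c y).radial (a₀ + a₁ * (y - r)) bψ bφ).zφ / (y - r))
    =O[𝓝[≠] r] (fun _ => (1 : ℝ))

theorem RadialBounded.radial_eq_zero (hc : IsAnalyticAt c r) {a₀ a₁ bψ bφ : ℝ}
    (h : RadialBounded c r a₀ a₁ bψ bφ) : (c r).radial a₀ bψ bφ = ⟨0, 0, 0⟩ := by
  obtain ⟨czz, czψ, czφ⟩ := hc.continuousAt_radial (S := fun y => a₀ + a₁ * (y - r))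
    (by fun_prop) bψ bφ
  have hzz := eq_zero_of_div_isBigO_one czz (div_isBigO_one_of_div_sq h.1)
  have hzψ := eq_zero_of_div_isBigO_one czψ h.2.1
  have hzφ := eq_zero_of_div_isBigO_one czφ h.2.2
  rw [sub_self, mul_zero, add_zero] at hzz hzψ hzφ
  exact RadialComponents.ext hzz hzψ hzφ

theorem RadialBounded.slope_eq (hc : IsAnalyticAt c r) {α β a₁ bφ : ℝ} (hyy : (c r).yy ≠ 0)
    (hα0 : (c r).radial α 0 (-1) = ⟨0, 0, 0⟩) (hbφ : bφ ^ 2 = 1)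
    (hα : RadialBounded c r α β 0 (-1)) (h : RadialBounded c r (-bφ * α) a₁ 0 bφ) :
    a₁ = -bφ * β := by
  have := hc.KK.continuousAt
  have := hc.Kφ.continuousAt
  have hlim := eq_zero_of_div_isBigO_one (r := r) (f := fun y => (a₁ + bφ * β)
      * ((c y).KK * (-bφ * α + a₁ * (y - r) - bφ * (α + β * (y - r))) + 2 * bφ * (c y).Kφ))
    (by fun_prop) ((h.1.sub hα.1).congr' ?_ EventuallyEq.rfl)
  · simp only [radial, RadialComponents.mk.injEq] at hα0
    obtain ⟨hzz, -, hzφ⟩ := hα0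
    have hmul : (a₁ + bφ * β) * (2 * (bφ * (c r).yy)) = 0 := by
      linear_combination α * hlim + (a₁ + bφ * β) * 2 * bφ * (hzz + hzφ)
    have hbφ0 : bφ ≠ 0 := by
      rintro rfl
      norm_num at hbφ
    linear_combination (mul_eq_zero.mp hmul).resolve_right (by positivity)
  · filter_upwards [eventually_sub_ne_zero r] with y hy
    rw [← sub_div, radial_zz_sub _ _ _ hbφ, div_eq_div_iff (pow_ne_zero 2 hy) hy]
    ring

theorem RadialBounded.neg_mul {α β bφ : ℝ} (hα : RadialBounded c r α β 0 (-1))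
    (hbφ : bφ ^ 2 = 1) : RadialBounded c r (-bφ * α) (-bφ * β) 0 bφ := by
  have hS (y : ℝ) : -bφ * α + -bφ * β * (y - r) = -bφ * (α + β * (y - r)) := by ring
  simp only [RadialBounded, hS, radial_neg_mul _ _ hbφ, mul_div_assoc]
  exact ⟨hα.1, hα.2.1.const_mul_left _, hα.2.2.const_mul_left _⟩

theorem radialBounded_iff (hc : IsAnalyticAt c r) {α β a₀ a₁ bψ bφ : ℝ} (hα0 : α ≠ 0)
    (hyy : (c r).yy ≠ 0) (hdet : (c r).reducedDet 1 ≠ 0) (hα : RadialBounded c r α β 0 (-1)) :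
    RadialBounded c r a₀ a₁ bψ bφ ↔
      bφ ^ 2 = 1 ∧ a₀ = -bφ * α ∧ a₁ = -bφ * β ∧ bψ = 0 := by
  refine ⟨fun h => ?_, ?_⟩
  · have hα' := hα.radial_eq_zero hc
    obtain ⟨rfl, rfl, hbφ⟩ := (c r).eq_of_radial_eq_zero hα0 hyy hdet hα' (h.radial_eq_zero hc)
    exact ⟨hbφ, rfl, hα.slope_eq hc hyy hα' hbφ h, rfl⟩
  · rintro ⟨hbφ, rfl, rfl, rfl⟩
    exact hα.neg_mul hbφ

end FrameCoeffs

theorem RadialComponents.radialBounded_of_isRadial {c : ℝ → FrameCoeffs}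
    {R : ℝ → RadialComponents} {r α β : ℝ}
    (hR : ∀ᶠ y in 𝓝[≠] r, (R y).IsRadial (c y) (y - r) (α + β * (y - r)))
    (hzz : ContinuousAt (fun y => (R y).zz) r) (hzψ : ContinuousAt (fun y => (R y).zψ) r)
    (hzφ : ContinuousAt (fun y => (R y).zφ) r) : FrameCoeffs.RadialBounded c r α β 0 (-1) := by
  have hsub := eventually_sub_ne_zero r
  refine ⟨(isBigO_one_of_continuousAt hzz).congr' ?_ EventuallyEq.rfl,
    (isBigO_one_of_continuousAt hzψ).congr' ?_ EventuallyEq.rfl,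
    (isBigO_one_of_continuousAt hzφ).congr' ?_ EventuallyEq.rfl⟩ <;>
  filter_upwards [hR, hsub] with y hy hyr
  · rw [← hy.zz, mul_div_cancel_left₀ _ (pow_ne_zero 2 hyr)]
  · rw [← hy.zψ, mul_div_cancel_left₀ _ hyr]
  · rw [← hy.zφ, mul_div_cancel_left₀ _ hyr]

/-- The coefficient `a₀` of `IsDegConstants k (n ^ 2) 1`. -/
def degenerateIntercept (k n : ℝ) : ℝ :=
  4 * k / (1 - n) ^ 2

/-- The coefficient `a₁` of `IsDegConstants k (n ^ 2) 1`. -/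
def degenerateSlope (k n : ℝ) : ℝ :=
  4 * k * n * (1 + n ^ 2) / ((1 - n) ^ 2 * (1 - n ^ 2))

section Constants

variable {k n : ℝ} (hn : 0 < n)

include hn

theorem degenerateShift_eq (hn1 : n < 1) (y : ℝ) : degenerateShift k n y
    = degenerateIntercept k n + degenerateSlope k n * (y - y0 (n ^ 2)) := by
  have hν : 1 - n ^ 2 ≠ 0 := by nlinarith
  have : 1 - n ≠ 0 := by linarith
  rw [degenerateShift, shiftNum, degenerateIntercept, degenerateSlope, y0_sq hn.le]
  field_simp
  ring

theorem isDegConstants_iff {s a₀ a₁ bψ bφ : ℝ} : IsDegConstants k (n ^ 2) s a₀ a₁ bψ bφ ↔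
    a₀ = s * degenerateIntercept k n ∧ a₁ = s * degenerateSlope k n ∧ bψ = 0 ∧ bφ = -s := by
  rw [IsDegConstants, Real.sqrt_sq hn.le]
  rfl

theorem isDegConstants_or_iff {a₀ a₁ bψ bφ : ℝ} :
    IsDegConstants k (n ^ 2) 1 a₀ a₁ bψ bφ ∨ IsDegConstants k (n ^ 2) (-1) a₀ a₁ bψ bφ ↔
      bφ ^ 2 = 1 ∧ a₀ = -bφ * degenerateIntercept k n ∧ a₁ = -bφ * degenerateSlope k n
        ∧ bψ = 0 := by
  rw [isDegConstants_iff hn, isDegConstants_iff hn, sq_eq_one_iff]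
  constructor
  · rintro (⟨rfl, rfl, rfl, rfl⟩ | ⟨rfl, rfl, rfl, rfl⟩) <;> simp
  · rintro ⟨rfl | rfl, rfl, rfl, rfl⟩ <;> simp

end Constants

/-- The components of the metric `c.atHorizon 2 w` in the coordinates `(v, z, Ψ, Φ, x)`, where
`S` stands for `a₀ + a₁ w`. -/
def FrameCoeffs.radialMatrix (c : FrameCoeffs) (S bψ bφ w : ℝ) : Mat5 :=
  !![w ^ 2 * c.KK, c.KK * S + c.Kψ * bψ + c.Kφ * bφ, w * c.Kψ, w * c.Kφ, 0;
     c.KK * S + c.Kψ * bψ + c.Kφ * bφ, (c.radial S bψ bφ).zz / w ^ 2, (c.radial S bψ bφ).zψ / w,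
       (c.radial S bψ bφ).zφ / w, 0;
     w * c.Kψ, (c.radial S bψ bφ).zψ / w, c.ψψ, c.ψφ, 0;
     w * c.Kφ, (c.radial S bψ bφ).zφ / w, c.ψφ, c.φφ, 0;
     0, 0, 0, 0, c.xx]

theorem FrameCoeffs.degMat_transpose_mul_atHorizon (c : FrameCoeffs) (a₀ a₁ bψ bφ : ℝ) {w : ℝ}
    (hw : w ≠ 0) :
    (degMat (-a₀) (-a₁) (-bψ) (-bφ) w)ᵀ * (c.atHorizon 2 w).toMatrix
        * degMat (-a₀) (-a₁) (-bψ) (-bφ) w = c.radialMatrix (a₀ + a₁ * w) bψ bφ w := by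
  ext i j
  fin_cases i <;> fin_cases j <;>
    simp [degMat, radialMatrix, toMatrix, atHorizon, radial, Matrix.mul_apply,
      Fin.sum_univ_five] <;>
    field_simp <;> ring

theorem isDegenerateRegular_y0 {n : ℝ} (hn : 0 < n) (hn1 : n < 1) {x : ℝ} (hx : |x| < 1) :
    IsDegenerateRegular n x (y0 (n ^ 2)) := by
  have hν1 : n ^ 2 < 1 := by nlinarith
  have hy := y0_sq_lt_neg_one hn hn1
  obtain ⟨hx1, -⟩ := abs_lt.mp hx
  exact ⟨(degenerateHorizon one_ne_zero hn hn1).G_ne_zero hν1 (by simpa using hn) hx, by linarith,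
    by nlinarith, (degenerateHorizon one_ne_zero hn hn1).H_root_ne hν1 hy hx1.le⟩

theorem isOpen_isDegenerateRegular (n : ℝ) :
    IsOpen {z : ℝ × ℝ | IsDegenerateRegular n z.1 z.2} := by
  have hG : Continuous fun z : ℝ × ℝ => G (n ^ 2) (2 * n) z.1 := by
    unfold G
    fun_prop
  have hH : Continuous fun z : ℝ × ℝ => H (n ^ 2) (2 * n) z.1 z.2 := by
    unfold H
    fun_prop
  exact (isOpen_ne_fun hG continuous_const).inter
    ((isOpen_ne_fun continuous_fst continuous_snd).inter
      ((isOpen_ne_fun (continuous_snd.pow 2) continuous_const).inter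
        (isOpen_ne_fun hH continuous_const)))

namespace IsDegenerateRegular

variable {n x y : ℝ} (hn : 0 < n) (hn1 : n < 1)

theorem eventually (hxy : IsDegenerateRegular n x y) :
    ∀ᶠ z in 𝓝 y, IsDegenerateRegular n x z :=
  ((isOpen_isDegenerateRegular n).preimage (f := fun z => (x, z)) (by fun_prop)).mem_nhds hxy

include hn hn1

theorem radialBounded_iff {k a₀ a₁ bψ bφ : ℝ} (hk : k ≠ 0)
    (hx : IsDegenerateRegular n x (y0 (n ^ 2))) :
    FrameCoeffs.RadialBounded (degenerateCoeffs k n x) (y0 (n ^ 2)) a₀ a₁ bψ bφ ↔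
      IsDegConstants k (n ^ 2) 1 a₀ a₁ bψ bφ ∨ IsDegConstants k (n ^ 2) (-1) a₀ a₁ bψ bφ := by
  obtain ⟨R, hR⟩ := exists_isRadial_degenerateCoeffs k hn hn1
  obtain ⟨-, hzz, hzψ, hzφ⟩ := hR _ _ hx
  have hslice : ContinuousAt (fun y => (x, y)) (y0 (n ^ 2)) := by fun_prop
  have hbounded : FrameCoeffs.RadialBounded (degenerateCoeffs k n x) (y0 (n ^ 2))
      (degenerateIntercept k n) (degenerateSlope k n) 0 (-1) := by
    refine RadialComponents.radialBounded_of_isRadial (R := fun y => R (x, y)) ?_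
      (hzz.continuousAt.comp hslice) (hzψ.continuousAt.comp hslice)
      (hzφ.continuousAt.comp hslice)
    filter_upwards [nhdsWithin_le_nhds hx.eventually] with y hy
    simpa only [degenerateShift_eq hn hn1] using (hR x y hy).1
  have hdet : (degenerateCoeffs k n x (y0 (n ^ 2))).yy * (degenerateCoeffs k n x (y0 (n ^ 2))).xx
      * (degenerateCoeffs k n x (y0 (n ^ 2))).reducedDet 1 ≠ 0 := by
    have hν : 1 - n ^ 2 ≠ 0 := by nlinarith
    have hsub := sub_ne_zero.mpr hx.2.1
    have hH := hx.2.2.2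
    rw [hx.det_degenerateCoeffs hk hn hn1]
    exact div_ne_zero (neg_ne_zero.mpr (by positivity)) (by positivity)
  have hα : degenerateIntercept k n ≠ 0 :=
    div_ne_zero (mul_ne_zero four_ne_zero hk) (pow_ne_zero 2 (by linarith))
  rw [isDegConstants_or_iff hn]
  exact FrameCoeffs.radialBounded_iff ((hx.isAnalyticAt_degenerateCoeffs hn hn1).comp
    (f := fun y => (x, y)) (by fun_prop)) hα (left_ne_zero_of_mul (left_ne_zero_of_mul hdet))
    (right_ne_zero_of_mul hdet) hbounded

theorem eventually_newComponents_degChart {k : ℝ} (hk : k ≠ 0) (a₀ a₁ bψ bφ t ψ φ : ℝ)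
    (hx : IsDegenerateRegular n x (y0 (n ^ 2))) :
    ∀ᶠ y in 𝓝[≠] y0 (n ^ 2),
      newComponents (degChart k (n ^ 2) a₀ a₁ bψ bφ) (metric k (n ^ 2) (2 * n)) ![t, y, ψ, φ, x]
        = (degenerateCoeffs k n x y).radialMatrix (a₀ + a₁ * (y - y0 (n ^ 2))) bψ bφ
          (y - y0 (n ^ 2)) := by
  set h := degenerateHorizon hk hn hn1
  filter_upwards [h.eventually_mem_domain hx.1 hx.2.1 hx.2.2.2 t ψ φ, eventually_mem_nhdsWithin]
    with y hp hy
  rw [← FrameCoeffs.degMat_transpose_mul_atHorizon _ _ _ _ _ (sub_ne_zero.mpr hy)]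
  exact newComponents_eq (jac_degChart (p := ![t, y, ψ, φ, x]) k (n ^ 2) a₀ a₁ bψ bφ hy)
    (degMat_mul_degMat_neg a₀ a₁ bψ bφ (y - y0 (n ^ 2))) (shiftMat_mul_shiftMat_neg _ _)
    (metric_eq_degenerateCoeffs hk hn hn1 hp)

end IsDegenerateRegular

theorem newComponents_degChart_isBigO {k n x : ℝ} (hk : k ≠ 0) (hn : 0 < n) (hn1 : n < 1)
    (hx : |x| < 1) (a₀ a₁ bψ bφ t ψ φ : ℝ) :
    let g : ℝ → Mat5 := fun y =>
      newComponents (degChart k (n ^ 2) a₀ a₁ bψ bφ) (metric k (n ^ 2) (2 * n)) ![t, y, ψ, φ, x]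
    ((fun y => g y 0 0) =O[𝓝[≠] y0 (n ^ 2)] fun y => (y - y0 (n ^ 2)) ^ 2) ∧
    ((fun y => g y 0 2) =O[𝓝[≠] y0 (n ^ 2)] fun y => y - y0 (n ^ 2)) ∧
    ((fun y => g y 0 3) =O[𝓝[≠] y0 (n ^ 2)] fun y => y - y0 (n ^ 2)) ∧
    ((∀ j ∈ ({1, 2, 3} : Set (Fin 5)), (fun y => g y 1 j) =O[𝓝[≠] y0 (n ^ 2)] fun _ => (1 : ℝ)) ↔
      IsDegConstants k (n ^ 2) 1 a₀ a₁ bψ bφ ∨ IsDegConstants k (n ^ 2) (-1) a₀ a₁ bψ bφ) := by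
  intro g
  have hx := isDegenerateRegular_y0 hn hn1 hx
  obtain ⟨hKK, hKψ, hKφ, -⟩ : FrameCoeffs.IsAnalyticAt (degenerateCoeffs k n x) (y0 (n ^ 2)) :=
    (hx.isAnalyticAt_degenerateCoeffs hn hn1).comp (f := fun y => (x, y)) (by fun_prop)
  have hg := hx.eventually_newComponents_degChart hn hn1 hk a₀ a₁ bψ bφ t ψ φ
  have hentry (i j : Fin 5) {f q : ℝ → ℝ} (hf : ∀ y, (degenerateCoeffs k n x y).radialMatrix
      (a₀ + a₁ * (y - y0 (n ^ 2))) bψ bφ (y - y0 (n ^ 2)) i j = f y) :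
      ((fun y => g y i j) =O[𝓝[≠] y0 (n ^ 2)] q) ↔ f =O[𝓝[≠] y0 (n ^ 2)] q :=
    isBigO_congr (hg.mono fun y hy => (congrFun₂ hy i j).trans (hf y)) EventuallyEq.rfl
  have hmul {f q : ℝ → ℝ} (hf : ContinuousAt f (y0 (n ^ 2))) :
      (fun y => q y * f y) =O[𝓝[≠] y0 (n ^ 2)] q := by
    simpa using (isBigO_refl q _).mul (isBigO_one_of_continuousAt hf)
  refine ⟨(hentry 0 0 fun y => rfl).mpr (hmul hKK.continuousAt),
    (hentry 0 2 fun y => rfl).mpr (hmul hKψ.continuousAt),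
    (hentry 0 3 fun y => rfl).mpr (hmul hKφ.continuousAt), ?_⟩
  simp only [Set.mem_insert_iff, Set.mem_singleton_iff, forall_eq_or_imp, forall_eq]
  rw [hentry 1 1 fun y => rfl, hentry 1 2 fun y => rfl, hentry 1 3 fun y => rfl]
  exact hx.radialBounded_iff hn hn1 hk

theorem FrameCoeffs.degMat_transpose_mul_radialMatrix (c : FrameCoeffs) (a₀ a₁ bψ bφ : ℝ) {w : ℝ}
    (hw : w ≠ 0) :
    (degMat a₀ a₁ bψ bφ w)ᵀ * c.radialMatrix (a₀ + a₁ * w) bψ bφ w * degMat a₀ a₁ bψ bφ w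
      = (c.atHorizon 2 w).toMatrix := by
  have hinv := mul_eq_one_comm.mp (degMat_mul_degMat_neg a₀ a₁ bψ bφ w)
  have hinv' := congrArg Matrix.transpose hinv
  rw [Matrix.transpose_mul, Matrix.transpose_one] at hinv'
  rw [← c.degMat_transpose_mul_atHorizon a₀ a₁ bψ bφ hw]
  simp only [Matrix.mul_assoc, hinv, Matrix.mul_one]
  rw [← Matrix.mul_assoc, hinv', Matrix.one_mul]

/-- The components of the extended metric in the coordinates `(v, z, Ψ, Φ, x)`, for the sign `s`,
where `R` stands for the quotients described by `IsRadial`. -/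
def FrameCoeffs.degMatrix (c : FrameCoeffs) (R : RadialComponents) (s S w : ℝ) : Mat5 :=
  !![w ^ 2 * c.KK, s * (c.KK * S - c.Kφ), w * c.Kψ, w * c.Kφ, 0;
     s * (c.KK * S - c.Kφ), R.zz, s * R.zψ, s * R.zφ, 0;
     w * c.Kψ, s * R.zψ, c.ψψ, c.ψφ, 0;
     w * c.Kφ, s * R.zφ, c.ψφ, c.φφ, 0;
     0, 0, 0, 0, c.xx]

theorem FrameCoeffs.degMatrix_isSymm (c : FrameCoeffs) (R : RadialComponents) (s S w : ℝ) :
    (c.degMatrix R s S w).IsSymm := by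
  ext i j
  fin_cases i <;> fin_cases j <;> rfl

theorem FrameCoeffs.IsAnalyticAt.degMatrix {V : Type*} [NormedAddCommGroup V] [NormedSpace ℝ V]
    {c : V → FrameCoeffs} {R : V → RadialComponents} {S w : V → ℝ} {p : V}
    (hc : IsAnalyticAt c p) (hzz : AnalyticAt ℝ (fun q => (R q).zz) p)
    (hzψ : AnalyticAt ℝ (fun q => (R q).zψ) p) (hzφ : AnalyticAt ℝ (fun q => (R q).zφ) p)
    (s : ℝ) (hS : AnalyticAt ℝ S p) (hw : AnalyticAt ℝ w p) (i j : Fin 5) :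
    AnalyticAt ℝ (fun q => (c q).degMatrix (R q) s (S q) (w q) i j) p := by
  obtain ⟨hKK, hKψ, hKφ, hψψ, hψφ, hφφ, -, hxx⟩ := hc
  fin_cases i <;> fin_cases j <;>
    simp only [FrameCoeffs.degMatrix, Fin.zero_eta, Fin.mk_one, Fin.reduceFinMk, Matrix.of_apply,
      Matrix.cons_val', Matrix.cons_val_zero, Matrix.cons_val_one, Matrix.cons_val,
      Matrix.cons_val_fin_one] <;> fun_prop

namespace RadialComponents.IsRadial

variable {R : RadialComponents} {c : FrameCoeffs} {s S w : ℝ}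

theorem det_degMatrix (hR : R.IsRadial c w S) (hs : s ^ 2 = 1) :
    (c.degMatrix R s S w).det = c.yy * c.xx * c.reducedDet 1 := by
  have hexpand : (c.degMatrix R s S w).det
      = c.xx * (c.KK * (w ^ 2 * R.zz * (c.ψψ * c.φφ - c.ψφ ^ 2)
          - s ^ 2 * ((w * R.zψ) ^ 2 * c.φφ - 2 * (w * R.zψ) * (w * R.zφ) * c.ψφ
            + (w * R.zφ) ^ 2 * c.ψψ))
        - s ^ 2 * (c.KK * S - c.Kφ) ^ 2 * (c.ψψ * c.φφ - c.ψφ ^ 2)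
        + 2 * s ^ 2 * (c.KK * S - c.Kφ) * (c.Kψ * (w * R.zψ) * c.φφ - c.Kψ * (w * R.zφ) * c.ψφ
          - c.Kφ * (w * R.zψ) * c.ψφ + c.Kφ * (w * R.zφ) * c.ψψ)
        - w ^ 2 * R.zz * (c.Kψ ^ 2 * c.φφ - 2 * c.Kψ * c.Kφ * c.ψφ + c.Kφ ^ 2 * c.ψψ)
        + s ^ 2 * (c.Kψ * (w * R.zφ) - c.Kφ * (w * R.zψ)) ^ 2) := by
    simp [FrameCoeffs.degMatrix, Matrix.det_succ_row_zero, Fin.sum_univ_succ, Fin.succAbove]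
    ring
  rw [hexpand, hR.zz, hR.zψ, hR.zφ, hs, FrameCoeffs.reducedDet]
  simp only [FrameCoeffs.radial]
  ring

theorem degMatrix_eq_radialMatrix (hR : R.IsRadial c w S) (hs : s ^ 2 = 1) (hw : w ≠ 0) :
    c.degMatrix R s S w = c.radialMatrix (s * S) 0 (-s) w := by
  have hrad : c.radial (s * S) 0 (-s)
      = ⟨w ^ 2 * R.zz, s * (w * R.zψ), s * (w * R.zφ)⟩ := by
    simpa [hR.zz, hR.zψ, hR.zφ] using c.radial_neg_mul S (bφ := -s) (by simpa using hs)
  have hzz : w ^ 2 * R.zz / w ^ 2 = R.zz := mul_div_cancel_left₀ _ (pow_ne_zero 2 hw)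
  have hmul (f : ℝ) : s * (w * f) / w = s * f := by
    rw [mul_left_comm, mul_div_cancel_left₀ _ hw]
  have h01 : s * (c.KK * S - c.Kφ) = c.KK * (s * S) + c.Kψ * 0 + c.Kφ * -s := by ring
  rw [FrameCoeffs.degMatrix, FrameCoeffs.radialMatrix, hrad, hzz, hmul, hmul, h01]

end RadialComponents.IsRadial

section degChart

variable {k ν a₀ a₁ bψ bφ : ℝ}

theorem analyticAt_degChart {p : Coords} (hp : p 1 ≠ y0 ν) :
    AnalyticAt ℝ (degChart k ν a₀ a₁ bψ bφ) p := by
  have ht := analyticAt_coord 0 p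
  have hsub := (analyticAt_coord 1 p).fun_sub (analyticAt_const (v := y0 ν))
  have hw : p 1 - y0 ν ≠ 0 := sub_ne_zero.mpr hp
  have hlog := analyticAt_log_of_ne_zero hsub hw
  refine AnalyticAt.pi (Fin.forall_fin_succ.mpr ⟨?_, Fin.forall_fin_succ.mpr
    ⟨analyticAt_coord 1 p, Fin.forall_fin_succ.mpr ⟨?_, Fin.forall_fin_two.mpr
      ⟨?_, analyticAt_coord 4 p⟩⟩⟩⟩)
  · exact (ht.fun_add (analyticAt_const.fun_div hsub hw)).fun_sub (analyticAt_const.fun_mul hlog)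
  · exact ((analyticAt_coord 2 p).fun_sub (analyticAt_const.fun_mul ht)).fun_sub
      (analyticAt_const.fun_mul hlog)
  · exact ((analyticAt_coord 3 p).fun_sub (analyticAt_const.fun_mul ht)).fun_sub
      (analyticAt_const.fun_mul hlog)

theorem degChart_injective : Function.Injective (degChart k ν a₀ a₁ bψ bφ) := by
  intro p q hpq
  have hy : p 1 = q 1 := congrFun hpq 1
  have ht : p 0 + a₀ / (p 1 - y0 ν) - a₁ * Real.log (p 1 - y0 ν)
      = q 0 + a₀ / (q 1 - y0 ν) - a₁ * Real.log (q 1 - y0 ν) := congrFun hpq 0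
  have hψ : p 2 - aPsi k ν * p 0 - bψ * Real.log (p 1 - y0 ν)
      = q 2 - aPsi k ν * q 0 - bψ * Real.log (q 1 - y0 ν) := congrFun hpq 2
  have hφ : p 3 - aPhi k ν * p 0 - bφ * Real.log (p 1 - y0 ν)
      = q 3 - aPhi k ν * q 0 - bφ * Real.log (q 1 - y0 ν) := congrFun hpq 3
  rw [hy, sub_left_inj, add_left_inj] at ht
  rw [ht, hy, sub_left_inj, sub_left_inj] at hψ hφ
  ext i
  fin_cases i
  exacts [ht, hy, hψ, hφ, congrFun hpq 4]

end degChart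

/-- The extended metric in the coordinates `(v, z, Ψ, Φ, x)`, for the sign `s`. Here `R` is to be
the quotients described by `IsRadial`, as functions of `(x, y)`. -/
def degExtension (k n s : ℝ) (R : ℝ × ℝ → RadialComponents) (p : Coords) : Mat5 :=
  (degenerateCoeffs k n (p 4) (p 1)).degMatrix (R (p 4, p 1)) s (degenerateShift k n (p 1))
    (p 1 - y0 (n ^ 2))

section Extension

variable {k n s : ℝ} {R : ℝ × ℝ → RadialComponents}

theorem isOpen_degDomain (hn : 0 ≤ n) : IsOpen (degDomain (n ^ 2)) := by
  have hset : degDomain (n ^ 2) = (fun p : Coords => (p 4, p 1)) ⁻¹'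
      {z | IsDegenerateRegular n z.1 z.2} := Set.ext fun _ => mem_degDomain hn
  rw [hset]
  exact (isOpen_isDegenerateRegular n).preimage (by fun_prop)

variable (hk : k ≠ 0) (hn : 0 < n) (hn1 : n < 1) (hs : s ^ 2 = 1)

include hk hn hn1 hs

theorem det_degExtension
    (hR : ∀ x y, IsDegenerateRegular n x y →
      (R (x, y)).IsRadial (degenerateCoeffs k n x y) (y - y0 (n ^ 2)) (degenerateShift k n y))
    {p : Coords} (hp : p ∈ degDomain (n ^ 2)) :
    (degExtension k n s R p).det = -(16 * k ^ 8 * H (n ^ 2) (2 * n) (p 4) (p 1) ^ 2)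
      / ((1 - n ^ 2) ^ 6 * (p 4 - p 1) ^ 8) := by
  rw [mem_degDomain hn.le] at hp
  rw [degExtension, (hR _ _ hp).det_degMatrix hs, hp.det_degenerateCoeffs hk hn hn1]

theorem isAnalyticMetricOn_degExtension
    (hR : ∀ x y, IsDegenerateRegular n x y →
      (R (x, y)).IsRadial (degenerateCoeffs k n x y) (y - y0 (n ^ 2)) (degenerateShift k n y) ∧
      AnalyticAt ℝ (fun z => (R z).zz) (x, y) ∧ AnalyticAt ℝ (fun z => (R z).zψ) (x, y) ∧
      AnalyticAt ℝ (fun z => (R z).zφ) (x, y)) :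
    IsAnalyticMetricOn (degExtension k n s R) (degDomain (n ^ 2)) where
  isOpen := isOpen_degDomain hn.le
  analytic i j p hp := by
    have hreg := (mem_degDomain hn.le).mp hp
    obtain ⟨-, hzz, hzψ, hzφ⟩ := hR _ _ hreg
    have hy := analyticAt_coord 1 p
    have hxy : AnalyticAt ℝ (fun q : Coords => (q 4, q 1)) p := (analyticAt_coord 4 p).prod hy
    have hS : AnalyticAt ℝ (fun q : Coords => degenerateShift k n (q 1)) p := by
      simp only [degenerateShift_eq hn hn1]
      exact analyticAt_const.fun_add (analyticAt_const.fun_mul (hy.fun_sub analyticAt_const))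
    exact (FrameCoeffs.IsAnalyticAt.comp (f := fun q : Coords => (q 4, q 1))
      (hreg.isAnalyticAt_degenerateCoeffs hn hn1) hxy).degMatrix
      (hzz.fun_comp (f := fun q : Coords => (q 4, q 1)) hxy)
      (hzψ.fun_comp (f := fun q : Coords => (q 4, q 1)) hxy)
      (hzφ.fun_comp (f := fun q : Coords => (q 4, q 1)) hxy) s hS
      (hy.fun_sub analyticAt_const) i j
  symm p _ := FrameCoeffs.degMatrix_isSymm _ _ _ _ _
  nondegenerate p hp := by
    rw [det_degExtension hk hn hn1 hs (fun x y hxy => (hR x y hxy).1) hp]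
    obtain ⟨-, hxy, -, hH⟩ := (mem_degDomain hn.le).mp hp
    have hν : 1 - n ^ 2 ≠ 0 := by nlinarith
    have := sub_ne_zero.mpr hxy
    exact div_ne_zero (neg_ne_zero.mpr (by positivity)) (by positivity)

theorem isIsometricEmbeddingOn_degChart
    (hR : ∀ x y, IsDegenerateRegular n x y →
      (R (x, y)).IsRadial (degenerateCoeffs k n x y) (y - y0 (n ^ 2)) (degenerateShift k n y))
    {a₀ a₁ bψ bφ : ℝ} (hconst : IsDegConstants k (n ^ 2) s a₀ a₁ bψ bφ) :
    IsIsometricEmbeddingOn (degChart k (n ^ 2) a₀ a₁ bψ bφ) (domain (n ^ 2) (2 * n))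
      (metric k (n ^ 2) (2 * n)) (degDomain (n ^ 2)) (degExtension k n s R) := by
  have hreg {p : Coords} (hp : p ∈ domain (n ^ 2) (2 * n)) :
      IsDegenerateRegular n (p 4) (p 1) ∧ p 1 ≠ y0 (n ^ 2) := by
    obtain ⟨⟨hG, hxy, hy, -, hH⟩, hr⟩ := (degenerateHorizon hk hn hn1).isRegular_of_mem_domain hp
    exact ⟨⟨hG, hxy, hy, hH⟩, hr⟩
  refine ⟨fun p hp => analyticAt_degChart (hreg hp).2, degChart_injective.injOn,
    fun p hp => (mem_degDomain hn.le).mpr (hreg hp).1, fun p hp => ?_⟩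
  obtain ⟨hxy, hy⟩ := hreg hp
  have hw : p 1 - y0 (n ^ 2) ≠ 0 := sub_ne_zero.mpr hy
  obtain ⟨rfl, rfl, rfl, rfl⟩ := (isDegConstants_iff hn).mp hconst
  have hpull := (degenerateCoeffs k n (p 4) (p 1)).degMat_transpose_mul_radialMatrix
    (s * degenerateIntercept k n) (s * degenerateSlope k n) 0 (-s) hw
  rw [mul_assoc s, ← mul_add, ← degenerateShift_eq hn hn1,
    ← (hR _ _ hxy).degMatrix_eq_radialMatrix hs hw] at hpull
  rw [metric_eq_degenerateCoeffs hk hn hn1 hp, ← hpull, jac_degChart _ _ _ _ _ _ hy,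
    Matrix.transpose_mul]
  simp only [Matrix.mul_assoc]
  rfl

end Extension

theorem exists_degExtension {k n s a₀ a₁ bψ bφ : ℝ} (hk : k ≠ 0) (hn : 0 < n) (hn1 : n < 1)
    (hs : s = 1 ∨ s = -1) (hconst : IsDegConstants k (n ^ 2) s a₀ a₁ bψ bφ) :
    ∃ gExt : Coords → Mat5, IsAnalyticMetricOn gExt (degDomain (n ^ 2)) ∧
      (∀ p q, p 1 = q 1 → p 4 = q 4 → gExt p = gExt q) ∧
      (∀ p ∈ degDomain (n ^ 2), (gExt p).det =
        -(16 * k ^ 8 * H (n ^ 2) (2 * n) (p 4) (p 1) ^ 2)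
          / ((1 - n ^ 2) ^ 6 * (p 4 - p 1) ^ 8)) ∧
      IsIsometricEmbeddingOn (degChart k (n ^ 2) a₀ a₁ bψ bφ) (domain (n ^ 2) (2 * n))
        (metric k (n ^ 2) (2 * n)) (degDomain (n ^ 2)) gExt := by
  have hs2 : s ^ 2 = 1 := sq_eq_one_iff.mpr hs
  obtain ⟨R, hR⟩ := exists_isRadial_degenerateCoeffs k hn hn1
  have hR' := fun x y hxy => (hR x y hxy).1
  refine ⟨degExtension k n s R, isAnalyticMetricOn_degExtension hk hn hn1 hs2 hR,
    fun p q hy hx => ?_, fun p => det_degExtension hk hn hn1 hs2 hR',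
    isIsometricEmbeddingOn_degChart hk hn hn1 hs2 hR' hconst⟩
  simp only [degExtension, hy, hx]

theorem exists_subset_degDomain {n : ℝ} (hn : 0 < n) (hn1 : n < 1) :
    ∃ δ > 0, {p : Coords | |p 4| < 1 ∧ |p 1 - y0 (n ^ 2)| < δ} ⊆ degDomain (n ^ 2) := by
  have hr := y0_sq_lt_neg_one hn hn1
  have hν1 : n ^ 2 < 1 := by nlinarith
  obtain ⟨δ, hδ, hball⟩ := exists_forall_abs_sub_lt (ν := n ^ 2) (lam := 2 * n) hr fun x hx =>
    (degenerateHorizon one_ne_zero hn hn1).H_root_ne hν1 hr hx.1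
  refine ⟨δ, hδ, fun p ⟨hx, hy⟩ => (mem_degDomain hn.le).mpr ?_⟩
  exact ⟨(isDegenerateRegular_y0 hn hn1 hx).1, hball _ _ hx hy⟩

end PomeranskySenkov

end

open PomeranskySenkov in
theorem mainTheorem4 (k ν lam : ℝ) (hk : k ≠ 0) (hν : 0 < ν) :
    -- two distinct, non-degenerate horizons
    (ν ≠ 1 → |lam| < 1 + ν → 4 * ν < lam ^ 2 → ∀ hor : Horizon,
      -- behaviour at `y = y⋆` of the metric coefficients in the coordinates `(u, v, ψ̂, φ̂, x)`
      (∀ σ : ℝ, σ ≠ 0 → ∀ t ψ φ x : ℝ, G ν lam x ≠ 0 → x ≠ hor.root ν lam →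
        H ν lam x (hor.root ν lam) ≠ 0 →
        let gNew : ℝ → Mat5 := fun y =>
          newComponents (uvChart σ (aConst k ν lam) (hor.b k ν lam) (hor.root ν lam))
            (metric k ν lam) ![t, y, ψ, φ, x]
        (∀ i ∈ ({0, 1} : Set (Fin 5)), ∀ j ∈ ({0, 1, 2, 3} : Set (Fin 5)),
          Tendsto (fun y => gNew y i j) (𝓝[≠] (hor.root ν lam)) (𝓝 0)) ∧
        ((fun y => gNew y 0 0) =O[𝓝[≠] (hor.root ν lam)] (fun y => (y - hor.root ν lam) ^ 2) ↔
          σ ^ 2 = hor.sigmaSq k ν lam)) ∧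
      0 < hor.sigmaSq k ν lam ∧
      -- the analytic extension in the coordinates `(û, v̂, ψ̂, φ̂, x)`
      (∀ σ : ℝ, σ ^ 2 = hor.sigmaSq k ν lam →
        ∃ gExt : Coords → Mat5,
          IsAnalyticMetricOn gExt (ksDomain ν lam hor) ∧
          (∀ p q, p 0 = q 0 → p 1 = q 1 → p 4 = q 4 → gExt p = gExt q) ∧
          (∀ p ∈ ksDomain ν lam hor, (gExt p).det =
            -(64 * k ^ 8 * σ ^ 2 * H ν lam (p 4) (ksY (hor.root ν lam) p) ^ 2)
              / ((1 - ν) ^ 6 * (p 4 - ksY (hor.root ν lam) p) ^ 8)) ∧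
          (∀ ε : ℝ, ε = 1 ∨ ε = -1 →
            IsIsometricEmbeddingOn
              (ksChart ε σ (aConst k ν lam) (hor.b k ν lam) (hor.root ν lam))
              (domain ν lam) (metric k ν lam) (ksDomain ν lam hor) gExt)) ∧
      -- for admissible parameters the extension covers a whole neighbourhood of `û v̂ = 0`
      (ν < 1 → 0 < lam → ∃ δ > 0,
        {p : Coords | |p 4| < 1 ∧ |p 0 * p 1| < δ} ⊆ ksDomain ν lam hor)) ∧
    -- the degenerate horizon
    (ν < 1 → lam = 2 * √ν →
      -- regularity at `z = y₀` in the coordinates `(v, z, Ψ, Φ, x)` fixes the constants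
      (∀ a₀ a₁ bψ bφ t ψ φ x : ℝ, |x| < 1 →
        let gNew : ℝ → Mat5 := fun y =>
          newComponents (degChart k ν a₀ a₁ bψ bφ) (metric k ν lam) ![t, y, ψ, φ, x]
        (fun y => gNew y 0 0) =O[𝓝[≠] (y0 ν)] (fun y => (y - y0 ν) ^ 2) ∧
        (fun y => gNew y 0 2) =O[𝓝[≠] (y0 ν)] (fun y => y - y0 ν) ∧
        (fun y => gNew y 0 3) =O[𝓝[≠] (y0 ν)] (fun y => y - y0 ν) ∧
        ((∀ j ∈ ({1, 2, 3} : Set (Fin 5)),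
            (fun y => gNew y 1 j) =O[𝓝[≠] (y0 ν)] (fun _ => (1 : ℝ))) ↔
          IsDegConstants k ν 1 a₀ a₁ bψ bφ ∨ IsDegConstants k ν (-1) a₀ a₁ bψ bφ)) ∧
      -- the analytic extensions, one for each choice of the constants
      (∀ s a₀ a₁ bψ bφ : ℝ, s = 1 ∨ s = -1 → IsDegConstants k ν s a₀ a₁ bψ bφ →
        ∃ gExt : Coords → Mat5,
          IsAnalyticMetricOn gExt (degDomain ν) ∧
          (∀ p q, p 1 = q 1 → p 4 = q 4 → gExt p = gExt q) ∧
          (∀ p ∈ degDomain ν, (gExt p).det =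
            -(16 * k ^ 8 * H ν lam (p 4) (p 1) ^ 2) / ((1 - ν) ^ 6 * (p 4 - p 1) ^ 8)) ∧
          IsIsometricEmbeddingOn (degChart k ν a₀ a₁ bψ bφ)
            (domain ν lam) (metric k ν lam) (degDomain ν) gExt) ∧
      -- the extension covers a whole neighbourhood of `z = y₀`
      (∃ δ > 0, {p : Coords | |p 4| < 1 ∧ |p 1 - y0 ν| < δ} ⊆ degDomain ν)) := by
  refine ⟨fun hν1 hl hd hor => ?_, fun hν1 hlam => ?_⟩
  · have hrs := hor.root_ne_otherRoot hν hd
    rw [← hor.killingHorizon_b hk hν hν1 hl hd, ← hor.killingHorizon_sigmaSq hk hν hν1 hl hd]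
    set h := hor.killingHorizon hk hν hν1 hl hd
    refine ⟨fun σ hσ t ψ φ x hG hxr hH => ?_, h.sigmaSq_pos hrs,
      fun σ hσ => h.exists_ksExtension hrs hσ, h.exists_subset_ksRegion hrs⟩
    have hx : h.IsRegular x h.r := h.isRegular_horizon hrs hG hxr hH
    exact ⟨fun i hi j hj => hx.tendsto_newComponents_uvChart hσ t ψ φ hi hj,
      hx.newComponents_uvChart_isBigO_sq_iff hσ t ψ φ⟩
  · obtain ⟨n, hn, rfl⟩ : ∃ n, 0 < n ∧ ν = n ^ 2 :=
      ⟨√ν, Real.sqrt_pos.mpr hν, (Real.sq_sqrt hν.le).symm⟩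
    have hn1 : n < 1 := by nlinarith
    rw [Real.sqrt_sq hn.le] at hlam
    subst hlam
    exact ⟨fun a₀ a₁ bψ bφ t ψ φ x hx =>
        newComponents_degChart_isBigO hk hn hn1 hx a₀ a₁ bψ bφ t ψ φ,
      fun s a₀ a₁ bψ bφ hs hconst => exists_degExtension hk hn hn1 hs hconst,
      exists_subset_degDomain hn hn1⟩
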